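/- Consider independent nearest-neighbour bond percolation, or independent nearest-neighbour site percolation, on $\mathbb Z^d$ with $d>6$, at its critical density $p_c=\inf\{p: \mathbb P_p(0 \text{ belongs to an infinite cluster})>0\}$. Let $\tau(x,y)=\mathbb P_{p_c}(x \text{ and } y \text{ are connected by an open path})$, and assume that there are constants $0<C'\le C<\infty$ with $$\frac{C'}{|x-y|^{d-2}}\ \le\ \tau(x,y)\ \le\ \frac{C}{|x-y|^{d-2}}\qquad\text{for all } x\neq y \text{ in } \mathbb Z^d .$$ (This is the power law $\tau(x,y)\asymp |x-y|^{-(d-2+\eta)}$ with $\eta=0$.) For an integer $L$ let $\Lambda_L=[-L,L]^d\cap\mathbb Z^d$, let $\partial\Lambda_L$ be the set of the sites of $\Lambda_L$ on its $2d$ faces, and let $\partial\Lambda_\pm=\{x\in\Lambda_L: x_1=\pm L\}$. The clusters $\mathcal C\subset\Lambda_L$ are the non-empty intersections with $\Lambda_L$ of the connected clusters of the configuration in all of $\mathbb Z^d$ (bulk boundary conditions); such a cluster is spanning if it meets both $\partial\Lambda_-$ and $\partial\Lambda_+$. $|\cdot|$ denotes the number of sites, and a maximum over an empty family is $0$. Then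 there is a constant $c\in(0,\infty)$, independent of $L$, such that for every function $\varepsilon:\mathbb N\to\mathbb R$ with $\varepsilon(L)\to0$ as $L\to\infty$: $$\mathbb P_{p_c}\Big(\varepsilon(L)\,L^4\ \le\ \max_{\mathcal C\subset\Lambda_L}|\mathcal C|\ \le\ c\,\log L\cdot L^4\Big)\longrightarrow 1 ,$$ $$\mathbb P_{p_c}\Big(\varepsilon(L)\,L^3\ \le\ \max_{\mathcal C\subset\Lambda_L}|\mathcal C\cap\partial\Lambda_L|\ \le\ c\,\log L\cdot L^3\Big)\longrightarrow 1$$ as $L\to\infty$, and both statements also hold when the maximum is restricted to the spanning clusters. -/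

import Mathlib

open MeasureTheory ProbabilityTheory Filter Topology

namespace Percolation

/-- The sites of the lattice `ℤ^d`. -/
abbrev Site (d : ℕ) : Type := Fin d → ℤ

/-- The nearest-neighbour graph on `ℤ^d`: two sites are adjacent when their `ℓ¹`-distance is `1`. -/
def lattice (d : ℕ) : SimpleGraph (Site d) where
  Adj x y := ∑ i, |x i - y i| = 1
  symm := ⟨fun x y h => by simpa only [abs_sub_comm] using h⟩
  loopless := ⟨fun x h => by simp at h⟩

/-- The two kinds of independent nearest-neighbour percolation on `ℤ^d`. -/
inductive Model
  | bond
  | site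

/-- The elements which are open or closed: unordered pairs of sites for bond percolation (only the
lattice edges among them are ever open), sites for site percolation. -/
def Item : Model → ℕ → Type
  | .bond, d => Sym2 (Site d)
  | .site, d => Site d

/-- The elements which may be open: the lattice edges, respectively all sites. -/
def candidates : (M : Model) → (d : ℕ) → Set (Item M d)
  | .bond, d => (lattice d).edgeSet
  | .site, _ => Set.univ

/-- A configuration is the set of its open elements. -/
abbrev Config (M : Model) (d : ℕ) : Type := Set (Item M d)

/-- The percolation law at density `p`: each lattice edge (respectively each site) is open with
probability `p`, independently of the others. -/
noncomputable def law (M : Model) (d : ℕ) (p : unitInterval) : Measure (Config M d) :=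
  setBernoulli (candidates M d) p

/-- Bond percolation: the graph of the open edges. -/
def bondGraph {d : ℕ} (ω : Set (Sym2 (Site d))) : SimpleGraph (Site d) :=
  lattice d ⊓ SimpleGraph.fromEdgeSet ω

/-- Site percolation: the graph of the lattice edges between open sites. -/
def siteGraph {d : ℕ} (ω : Set (Site d)) : SimpleGraph (Site d) where
  Adj x y := (lattice d).Adj x y ∧ x ∈ ω ∧ y ∈ ω
  symm := ⟨fun _ _ h => ⟨h.1.symm, h.2.2, h.2.1⟩⟩
  loopless := ⟨fun x h => (lattice d).loopless.irrefl x h.1⟩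

/-- The sites `x` and `y` are connected by an open path, which may use the whole of `ℤ^d`.
In site percolation all sites of the path, including its ends, have to be open; in particular
closed sites belong to no cluster. -/
def Connected : {M : Model} → {d : ℕ} → Config M d → Site d → Site d → Prop
  | .bond, _, ω, x, y => (bondGraph ω).Reachable x y
  | .site, _, ω, x, y => x ∈ ω ∧ y ∈ ω ∧ (siteGraph ω).Reachable x y

/-- The two-point function `τ_p(x, y)`. -/
noncomputable def twoPoint (M : Model) (d : ℕ) (p : unitInterval) (x y : Site d) : ℝ :=
  (law M d p).real {ω | Connected ω x y}

/-- The percolation density: the probability that the cluster of the origin is infinite. -/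
noncomputable def density (M : Model) (d : ℕ) (p : unitInterval) : ℝ :=
  (law M d p).real {ω | {y : Site d | Connected ω 0 y}.Infinite}

/-- The critical point `p_c`. (At `p = 1` the density is positive if `d ≥ 1`.) -/
noncomputable def criticalPoint (M : Model) (d : ℕ) : unitInterval :=
  sInf {p | 0 < density M d p}

/-- The Euclidean distance of two sites. -/
noncomputable def euclDist {d : ℕ} (x y : Site d) : ℝ :=
  √(∑ i, ((x i : ℝ) - (y i : ℝ)) ^ 2)

/-- The power law `τ(x, y) ≍ |x - y|^{-(d - 2 + η)}` at the critical point, as upper and lower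
bounds with possibly distinct constants. -/
def PowerLaw (M : Model) (d : ℕ) (η : ℝ) : Prop :=
  ∃ C' C : ℝ, 0 < C' ∧ C' ≤ C ∧ ∀ x y : Site d, x ≠ y →
    C' / euclDist x y ^ ((d : ℝ) - 2 + η) ≤ twoPoint M d (criticalPoint M d) x y ∧
    twoPoint M d (criticalPoint M d) x y ≤ C / euclDist x y ^ ((d : ℝ) - 2 + η)

/-- The cube `Λ_L = [-L, L]^d`. -/
noncomputable def box (d L : ℕ) : Finset (Site d) :=
  Finset.Icc (fun _ => -(L : ℤ)) (fun _ => (L : ℤ))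

/-- The boundary `∂Λ_L`, the union of the `2d` faces of the cube. -/
noncomputable def boundary (d L : ℕ) : Finset (Site d) :=
  (box d L).filter fun x => ∃ i, x i = -(L : ℤ) ∨ x i = (L : ℤ)

open Classical in
/-- The clusters in `Λ_L`, with bulk boundary conditions: the non-empty intersections with `Λ_L` of
the connected clusters of the configuration in `ℤ^d`. -/
noncomputable def clusters {M : Model} {d : ℕ} (ω : Config M d) (L : ℕ) :
    Finset (Finset (Site d)) :=
  ((box d L).image fun x => (box d L).filter fun y => Connected ω x y).filter Finset.Nonempty

/-- The cluster `C` in `Λ_L` meets both faces of `Λ_L` which are orthogonal to the direction `i`. -/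
def Spans {d : ℕ} (i : Fin d) (L : ℕ) (C : Finset (Site d)) : Prop :=
  (∃ x ∈ C, x i = -(L : ℤ)) ∧ (∃ x ∈ C, x i = (L : ℤ))

open Classical in
/-- The spanning clusters in `Λ_L`, for the direction `i`. -/
noncomputable def spanningClusters {M : Model} {d : ℕ} (i : Fin d) (ω : Config M d) (L : ℕ) :
    Finset (Finset (Site d)) :=
  (clusters ω L).filter (Spans i L)

/-- The maximal size of the members of a finite family of clusters (`0` for the empty family). -/
def maxSize {d : ℕ} (F : Finset (Finset (Site d))) : ℕ :=
  F.sup fun C => C.card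

/-- The maximal size of the intersection with `∂Λ_L` of the members of a finite family of clusters
(`0` for the empty family). -/
noncomputable def maxBoundarySize {d : ℕ} (L : ℕ) (F : Finset (Finset (Site d))) : ℕ :=
  F.sup fun C => (C ∩ boundary d L).card

/-- With probability tending to `1` as `L → ∞`, the random variable `X L` lies between
`ε L * L ^ k` and `c * log L * L ^ k`. -/
def TypicallyBetween (M : Model) (d : ℕ) (X : ℕ → Config M d → ℕ) (ε : ℕ → ℝ) (c : ℝ) (k : ℕ) :
    Prop :=
  Tendsto (fun L : ℕ => (law M d (criticalPoint M d)).real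
    {ω | ε L * (L : ℝ) ^ k ≤ (X L ω : ℝ) ∧ (X L ω : ℝ) ≤ c * Real.log L * (L : ℝ) ^ k})
    atTop (𝓝 1)

end Percolation

open Percolation

/-! Bonds and sites are treated alike, as items of a graph in which touching items are adjacent.
Both models become independent site percolation on that graph, first in a finite volume `F`, which
at the end exhausts the lattice. Clusters are measured inside a set T of dimension d - 2 + a: the
box (a = 2) or its boundary (a = 1). Both bounds live on the scale L^(2 + a).

Upper bound. The van den Berg–Kesten inequality (`bk_relation`) yields the tree-graph inequality
(`tauMulti_le`). Summed over the targets, it bounds the k-th moment of the number of items of T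
connected to a given item (`moment_le`): there are k! C(k - 1) labelled binary trees, with C the
Catalan numbers, each of the k ends contributes a factor of order L^a, and each of the k - 1
branching points a factor of order L^2. Markov's inequality with k close to log L, at the level c
log L · L^(2 + a), beats the union bound over all starting items (`Spread.exists_upper_tail`).

Lower bound. The second moment method is applied to the number Z of connected triples (x, y, z) with
x and y on opposite faces and z in T. If every cluster joining the faces has fewer than t items in
T, then Z is at most t times the number of connected pairs (x, y), whose mean is of order at most
L^d (`PF_all_small_le`). The mean of Z is at least of order L^(d + 2 + a). Two triples in different
clusters occur disjointly, so only those in a common cluster add to the variance; a fifth moment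
controls them, and the relative variance is of order at most L^(6 - d) (`EF_triples_sq_le`,
`exists_lower_tail`). The bound concerns spanning clusters, hence all clusters.

The mean of Z requires a lower bound for three-point functions. Of order L^d disjoint segments are
placed in the box, each with three items u, v, w at mutual distance at least R. Summed over the
targets, the connections u–x, v–y, w–z lie in distinct clusters with nearly the product probability:
the error is an open triangle diagram, which is small for large R because d > 6 (`separated_ge`,
`sum_meetBound_le`). Opening the segment costs a constant factor and joins the three clusters. A
configuration can arise in this way from at most one segment (`Glued.not_of_disjoint`), so the
contributions of the segments add up (`sum_separated_le`). -/

namespace Percolation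

/-! ### Independent percolation in a finite volume. -/

section FiniteVolume

variable {V : Type*} [DecidableEq V]

/-- The probability of the configuration `S` in the finite volume `F`. -/
noncomputable def weight (p : ℝ) (F S : Finset V) : ℝ :=
  p ^ S.card * (1 - p) ^ (F \ S).card

/-- The expectation in the finite volume `F`. -/
noncomputable def EF (p : ℝ) (F : Finset V) (f : Finset V → ℝ) : ℝ :=
  ∑ S ∈ F.powerset, weight p F S * f S

open Classical in
/-- The indicator function of a proposition. -/
noncomputable def ind (A : Prop) : ℝ := if A then 1 else 0

/-- The probability of an event in the finite volume `F`. -/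
noncomputable def PF (p : ℝ) (F : Finset V) (A : Finset V → Prop) : ℝ :=
  EF p F fun S => ind (A S)

lemma ind_nonneg (A : Prop) : 0 ≤ ind A := by unfold ind; split_ifs <;> norm_num
lemma ind_of_true {A : Prop} (h : A) : ind A = 1 := if_pos h
lemma ind_of_false {A : Prop} (h : ¬ A) : ind A = 0 := if_neg h
lemma ind_mono {A B : Prop} (h : A → B) : ind A ≤ ind B := by
  by_cases hA : A
  · rw [ind_of_true hA, ind_of_true (h hA)]
  · rw [ind_of_false hA]; exact ind_nonneg _
lemma ind_and (A B : Prop) : ind (A ∧ B) = ind A * ind B := by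
  unfold ind; split_ifs <;> simp_all
lemma ind_congr {A B : Prop} (h : A ↔ B) : ind A = ind B := by rw [propext h]

variable {p : ℝ} {F : Finset V}

lemma weight_nonneg (hp0 : 0 ≤ p) (hp1 : p ≤ 1) (F S : Finset V) : 0 ≤ weight p F S :=
  mul_nonneg (pow_nonneg hp0 _) (pow_nonneg (by linarith) _)

/-- Conditioning on the state of one item; the inductions on the volume rest on this identity. -/
lemma EF_insert {e : V} (he : e ∉ F) (f : Finset V → ℝ) :
    EF p (insert e F) f = (1 - p) * EF p F f + p * EF p F fun S => f (insert e S) := by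
  unfold EF
  rw [Finset.sum_powerset_insert he, Finset.mul_sum, Finset.mul_sum]
  congr 1
  · refine Finset.sum_congr rfl fun S hS => ?_
    have hS' : e ∉ S := fun h => he (Finset.mem_powerset.1 hS h)
    rw [weight, weight, Finset.insert_sdiff_of_notMem _ hS', Finset.card_insert_of_notMem
      (fun h => he (Finset.mem_sdiff.1 h).1)]
    ring
  · refine Finset.sum_congr rfl fun S hS => ?_
    have hS' : e ∉ S := fun h => he (Finset.mem_powerset.1 hS h)
    have : (insert e F) \ (insert e S) = F \ S := by
      ext x; simp only [Finset.mem_sdiff, Finset.mem_insert]; grind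
    rw [weight, weight, this, Finset.card_insert_of_notMem hS']
    ring

lemma EF_const (c : ℝ) : EF p F (fun _ => c) = c := by
  induction F using Finset.induction_on with
  | empty => simp [EF, weight]
  | insert e F he ih => rw [EF_insert he, ih]; ring

lemma EF_add (f g : Finset V → ℝ) : EF p F (fun S => f S + g S) = EF p F f + EF p F g := by
  simp only [EF, mul_add, Finset.sum_add_distrib]

lemma EF_mul_left (c : ℝ) (f : Finset V → ℝ) : EF p F (fun S => c * f S) = c * EF p F f := by
  simp only [EF, Finset.mul_sum]
  exact Finset.sum_congr rfl fun _ _ => by ring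

lemma EF_mul_right (c : ℝ) (f : Finset V → ℝ) : EF p F (fun S => f S * c) = EF p F f * c := by
  simp only [mul_comm _ c, EF_mul_left]

lemma EF_sum {ι : Type*} (s : Finset ι) (f : ι → Finset V → ℝ) :
    EF p F (fun S => ∑ i ∈ s, f i S) = ∑ i ∈ s, EF p F (f i) := by
  simp only [EF, Finset.mul_sum]
  exact Finset.sum_comm

lemma EF_mono (hp0 : 0 ≤ p) (hp1 : p ≤ 1) {f g : Finset V → ℝ} (h : ∀ S ⊆ F, f S ≤ g S) :
    EF p F f ≤ EF p F g :=
  Finset.sum_le_sum fun S hS =>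
    mul_le_mul_of_nonneg_left (h S (Finset.mem_powerset.1 hS)) (weight_nonneg hp0 hp1 F S)

lemma EF_congr {f g : Finset V → ℝ} (h : ∀ S ⊆ F, f S = g S) : EF p F f = EF p F g :=
  Finset.sum_congr rfl fun S hS => by rw [h S (Finset.mem_powerset.1 hS)]

lemma EF_nonneg (hp0 : 0 ≤ p) (hp1 : p ≤ 1) {f : Finset V → ℝ} (h : ∀ S ⊆ F, 0 ≤ f S) :
    0 ≤ EF p F f := by
  have := EF_mono hp0 hp1 (F := F) (f := fun _ => 0) (g := f) h
  rwa [EF_const] at this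

lemma EF_mul_EF (f g : Finset V → ℝ) :
    EF p F f * EF p F g = EF p F fun S => EF p F fun T => f S * g T := by
  simp only [EF_mul_left, EF_mul_right]

lemma PF_nonneg (hp0 : 0 ≤ p) (hp1 : p ≤ 1) (A : Finset V → Prop) : 0 ≤ PF p F A :=
  EF_nonneg hp0 hp1 fun _ _ => ind_nonneg _

lemma PF_mono (hp0 : 0 ≤ p) (hp1 : p ≤ 1) {A B : Finset V → Prop} (h : ∀ S ⊆ F, A S → B S) :
    PF p F A ≤ PF p F B :=
  EF_mono hp0 hp1 fun S hS => ind_mono (h S hS)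

lemma PF_congr {A B : Finset V → Prop} (h : ∀ S ⊆ F, A S ↔ B S) : PF p F A = PF p F B :=
  EF_congr fun S hS => ind_congr (h S hS)

lemma PF_insert {e : V} (he : e ∉ F) (A : Finset V → Prop) :
    PF p (insert e F) A = (1 - p) * PF p F A + p * PF p F fun S => A (insert e S) :=
  EF_insert he _

lemma ind_exists_le {ι : Type*} (s : Finset ι) (A : ι → Prop) :
    ind (∃ i ∈ s, A i) ≤ ∑ i ∈ s, ind (A i) := by
  by_cases h : ∃ i ∈ s, A i
  · obtain ⟨i, hi, hA⟩ := h
    rw [ind_of_true ⟨i, hi, hA⟩, ← ind_of_true hA]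
    exact Finset.single_le_sum (f := fun i => ind (A i)) (fun _ _ => ind_nonneg _) hi
  · rw [ind_of_false h]; exact Finset.sum_nonneg fun _ _ => ind_nonneg _

lemma ind_or_le (A B : Prop) : ind (A ∨ B) ≤ ind A + ind B := by
  by_cases hA : A
  · rw [ind_of_true hA, ind_of_true (Or.inl hA)]; linarith [ind_nonneg B]
  · rw [ind_of_false hA, zero_add]; exact ind_mono (fun h => h.resolve_left hA)

lemma PF_exists_le (hp0 : 0 ≤ p) (hp1 : p ≤ 1) {ι : Type*} (s : Finset ι)
    (A : ι → Finset V → Prop) :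
    PF p F (fun S => ∃ i ∈ s, A i S) ≤ ∑ i ∈ s, PF p F (A i) := by
  unfold PF
  rw [← EF_sum]
  exact EF_mono hp0 hp1 fun S _ => ind_exists_le s _

lemma PF_or_le (hp0 : 0 ≤ p) (hp1 : p ≤ 1) (A B : Finset V → Prop) :
    PF p F (fun S => A S ∨ B S) ≤ PF p F A + PF p F B := by
  unfold PF
  rw [← EF_add]
  exact EF_mono hp0 hp1 fun S _ => ind_or_le _ _

/-- The probability that all items of `B` are open and that an event occurs. -/
lemma PF_and_subset {B : Finset V} (hB : B ⊆ F) (A : Finset V → Prop) :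
    PF p F (fun S => A S ∧ B ⊆ S) = p ^ B.card * PF p F fun S => A (S ∪ B) := by
  induction B using Finset.induction_on generalizing A with
  | empty => simp
  | insert e B he ih =>
    have heF : e ∈ F := hB (Finset.mem_insert_self _ _)
    have key : ∀ A : Finset V → Prop,
        PF p F (fun S => A S ∧ e ∈ S) = p * PF p F fun S => A (insert e S) := by
      intro A
      obtain ⟨G, heG, rfl⟩ : ∃ G : Finset V, e ∉ G ∧ insert e G = F :=
        ⟨F.erase e, Finset.notMem_erase _ _, Finset.insert_erase heF⟩
      rw [PF_insert heG, PF_insert heG]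
      have h1 : PF p G (fun S => A S ∧ e ∈ S) = 0 := by
        rw [PF, EF_congr (g := fun _ => 0), EF_const]
        exact fun S hS => ind_of_false fun h => heG (hS h.2)
      simp only [Finset.insert_idem, Finset.mem_insert_self, and_true, h1]
      ring
    rw [PF_congr (B := fun S => (A S ∧ e ∈ S) ∧ B ⊆ S)
      (fun S _ => by rw [Finset.insert_subset_iff, and_assoc]),
      ih (fun x hx => hB (Finset.mem_insert_of_mem hx)) (fun S => A S ∧ e ∈ S),
      PF_congr (B := fun S => A (S ∪ B) ∧ e ∈ S)
      (fun S _ => by simp [Finset.mem_union, he]), key, Finset.card_insert_of_notMem he]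
    simp only [Finset.union_insert, Finset.insert_union]
    ring

/-- Markov's inequality. -/
lemma PF_le_EF_div (hp0 : 0 ≤ p) (hp1 : p ≤ 1) {f : Finset V → ℝ} (hf : ∀ S ⊆ F, 0 ≤ f S)
    {t : ℝ} (ht : 0 < t) : PF p F (fun S => t ≤ f S) ≤ EF p F f / t := by
  rw [le_div_iff₀ ht, PF, ← EF_mul_right]
  refine EF_mono hp0 hp1 fun S hS => ?_
  by_cases h : t ≤ f S
  · rw [ind_of_true h]; linarith
  · rw [ind_of_false h]; linarith [hf S hS]

/-- Chebyshev's inequality for the event that a variable is at most half of its mean. -/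
lemma PF_le_half_le (hp0 : 0 ≤ p) (hp1 : p ≤ 1) (f : Finset V → ℝ) (h : 0 < EF p F f) :
    PF p F (fun S => f S ≤ EF p F f / 2) ≤
      4 * (EF p F (fun S => f S ^ 2) - EF p F f ^ 2) / EF p F f ^ 2 := by
  set m := EF p F f with hm
  have hv : EF p F (fun S => (f S - m) ^ 2) = EF p F (fun S => f S ^ 2) - m ^ 2 := by
    have : (fun S => (f S - m) ^ 2) = fun S => (f S ^ 2 + (-2 * m) * f S) + m ^ 2 := by
      funext S; ring
    rw [this, EF_add, EF_add, EF_mul_left, EF_const, ← hm]; ring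
  have h1 := PF_le_EF_div hp0 hp1 (F := F) (f := fun S => (f S - m) ^ 2)
    (fun _ _ => sq_nonneg _) (t := (m / 2) ^ 2) (by positivity)
  rw [hv] at h1
  calc _ ≤ PF p F (fun S => (m / 2) ^ 2 ≤ (f S - m) ^ 2) := by
        refine PF_mono hp0 hp1 fun S _ hS => ?_
        nlinarith
    _ ≤ _ := h1
    _ = _ := by field_simp; ring

end FiniteVolume

/-! ### The van den Berg–Kesten inequality. -/

section DisjointOccurrence

variable {V : Type*} [DecidableEq V] {p : ℝ} {F : Finset V}

/-- The van den Berg–Kesten inequality for increasing relations. -/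
lemma bk_relation (hp0 : 0 ≤ p) (hp1 : p ≤ 1) (F : Finset V) (R : Finset V → Finset V → Prop)
    (hR : ∀ S S' T T', S ⊆ S' → T ⊆ T' → R S T → R S' T') :
    PF p F (fun ω => ∃ S ⊆ ω, ∃ T ⊆ ω, Disjoint S T ∧ R S T) ≤
      EF p F fun ω => PF p F fun ω' => R ω ω' := by
  -- Relations are used instead of pairs of events because the induction leads to the union `U`
  -- below, which is again an increasing relation but no longer a product of two events.
  induction F using Finset.induction_on generalizing R with
  | empty =>
    simp only [PF, EF, Finset.powerset_empty, Finset.sum_singleton, weight]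
    simp only [Finset.subset_empty]
    refine le_of_eq ?_
    simp
  | insert e F he ih =>
    have hq : 0 ≤ 1 - p := by linarith
    let P2 : (Finset V → Finset V → Prop) → ℝ := fun R => EF p F fun ω => PF p F fun ω' => R ω ω'
    have hP2 : ∀ R R' : Finset V → Finset V → Prop, (∀ S T, R S T → R' S T) → P2 R ≤ P2 R' :=
      fun R R' h => EF_mono hp0 hp1 fun S _ => PF_mono hp0 hp1 fun T _ => h S T
    -- The indices tell which of the two arguments may use `e`. In a single configuration an open
    -- `e` serves at most one of two disjoint witnesses, which is what `U` records.
    let R10 : Finset V → Finset V → Prop := fun S T => R (insert e S) T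
    let R01 : Finset V → Finset V → Prop := fun S T => R S (insert e T)
    let R11 : Finset V → Finset V → Prop := fun S T => R (insert e S) (insert e T)
    let U : Finset V → Finset V → Prop := fun S T => R10 S T ∨ R01 S T
    have hins : ∀ S T : Finset V, S ⊆ T → insert e S ⊆ insert e T :=
      fun S T h => Finset.insert_subset_insert _ h
    have hRHS : (EF p (insert e F) fun ω => PF p (insert e F) fun ω' => R ω ω') =
        (1 - p) * ((1 - p) * P2 R + p * P2 R01) + p * ((1 - p) * P2 R10 + p * P2 R11) := by
      rw [EF_insert he]
      simp only [PF_insert he, EF_add, EF_mul_left]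
      rfl
    -- Inclusion–exclusion: `R` implies both `R10` and `R01` by monotonicity.
    have hincl : P2 U + P2 R ≤ P2 R10 + P2 R01 := by
      simp only [P2, PF, ← EF_add]
      refine EF_mono hp0 hp1 fun S _ => EF_mono hp0 hp1 fun T _ => ?_
      have h1 : R S T → R10 S T := hR _ _ _ _ (Finset.subset_insert _ _) subset_rfl
      have h2 : R S T → R01 S T := hR _ _ _ _ subset_rfl (Finset.subset_insert _ _)
      by_cases a : R10 S T <;> by_cases b : R01 S T <;> by_cases c : R S T <;>
        simp_all [U, ind]
    have hU11 : P2 U ≤ P2 R11 := hP2 _ _ fun S T h => h.elim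
      (fun h => hR _ _ _ _ subset_rfl (Finset.subset_insert _ _) h)
      (fun h => hR _ _ _ _ (Finset.subset_insert _ _) subset_rfl h)
    have hU : ∀ S S' T T', S ⊆ S' → T ⊆ T' → U S T → U S' T' := fun S S' T T' h1 h2 h =>
      h.elim (fun h => Or.inl (hR _ _ _ _ (hins _ _ h1) h2 h))
        (fun h => Or.inr (hR _ _ _ _ h1 (hins _ _ h2) h))
    have hopen : (PF p F fun ω => ∃ S ⊆ insert e ω, ∃ T ⊆ insert e ω, Disjoint S T ∧ R S T) ≤
        PF p F fun ω => ∃ S ⊆ ω, ∃ T ⊆ ω, Disjoint S T ∧ U S T := by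
      refine PF_mono hp0 hp1 fun ω hω => ?_
      rintro ⟨S, hS, T, hT, hST, h⟩
      refine ⟨S.erase e, ?_, T.erase e, ?_, ?_, ?_⟩
      · rw [← Finset.subset_insert_iff]; exact hS
      · rw [← Finset.subset_insert_iff]; exact hT
      · exact Finset.disjoint_of_subset_left (Finset.erase_subset _ _)
          (Finset.disjoint_of_subset_right (Finset.erase_subset _ _) hST)
      · by_cases heS : e ∈ S
        · have heT : e ∉ T := Finset.disjoint_left.1 hST heS
          left
          simp only [R10, Finset.insert_erase heS, Finset.erase_eq_of_notMem heT]
          exact h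
        · right
          simp only [R01, Finset.erase_eq_of_notMem heS]
          exact hR _ _ _ _ subset_rfl (Finset.insert_erase_subset e T) h
    -- With q = 1 - p, the left side is at most q R + p U = q² R + p q (R + U) + p² U, to be
    -- compared with q² R + p q (R10 + R01) + p² R11.
    rw [PF_insert he, hRHS]
    have i1 : (PF p F fun ω => ∃ S ⊆ ω, ∃ T ⊆ ω, Disjoint S T ∧ R S T) ≤ P2 R := ih R hR
    have i2 := hopen.trans (ih U hU)
    change _ ≤ P2 U at i2
    nlinarith [mul_le_mul_of_nonneg_left i1 hq, mul_le_mul_of_nonneg_left i2 hp0,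
      mul_le_mul_of_nonneg_left hincl (mul_nonneg hp0 hq),
      mul_le_mul_of_nonneg_left hU11 (mul_nonneg hp0 hp0)]

/-- An event is increasing. -/
def Increasing (A : Finset V → Prop) : Prop := ∀ S T, S ⊆ T → A S → A T

/-- The van den Berg–Kesten inequality. -/
lemma bk_inequality (hp0 : 0 ≤ p) (hp1 : p ≤ 1) (F : Finset V) {A B : Finset V → Prop}
    (hA : Increasing A) (hB : Increasing B) :
    PF p F (fun ω => ∃ S ⊆ ω, ∃ T ⊆ ω, Disjoint S T ∧ A S ∧ B T) ≤ PF p F A * PF p F B := by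
  refine (bk_relation hp0 hp1 F (fun S T => A S ∧ B T)
    fun S S' T T' h1 h2 h => ⟨hA _ _ h1 h.1, hB _ _ h2 h.2⟩).trans (le_of_eq ?_)
  simp only [PF, ind_and, EF_mul_left, EF_mul_right]

/-- The van den Berg–Kesten inequality for events whose witnesses share exactly one item. -/
lemma bk_sharing (hp0 : 0 ≤ p) (hp1 : p ≤ 1) {F : Finset V} (b : V) {A B : Finset V → Prop}
    (hA : Increasing A) (hB : Increasing B) :
    p * PF p F (fun ω => ∃ S ⊆ ω, ∃ T ⊆ ω, S ∩ T = {b} ∧ A S ∧ B T) ≤ PF p F A * PF p F B := by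
  by_cases hb : b ∈ F
  swap
  · rw [PF, EF_congr (g := fun _ => 0), EF_const, mul_zero]
    · exact mul_nonneg (PF_nonneg hp0 hp1 _) (PF_nonneg hp0 hp1 _)
    · refine fun ω hω => ind_of_false ?_
      rintro ⟨S, hS, T, hT, hST, -⟩
      have : b ∈ S ∩ T := by rw [hST]; exact Finset.mem_singleton_self b
      exact hb (hω (hS (Finset.mem_of_mem_inter_left this)))
  obtain ⟨G, hbG, rfl⟩ : ∃ G : Finset V, b ∉ G ∧ insert b G = F :=
    ⟨F.erase b, Finset.notMem_erase _ _, Finset.insert_erase hb⟩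
  have hins : ∀ S T : Finset V, S ⊆ T → insert b S ⊆ insert b T :=
    fun S T h => Finset.insert_subset_insert _ h
  have h0 : PF p G (fun ω => ∃ S ⊆ ω, ∃ T ⊆ ω, S ∩ T = {b} ∧ A S ∧ B T) = 0 := by
    rw [PF, EF_congr (g := fun _ => 0), EF_const]
    refine fun ω hω => ind_of_false ?_
    rintro ⟨S, hS, T, hT, hST, -⟩
    have : b ∈ S ∩ T := by rw [hST]; exact Finset.mem_singleton_self b
    exact hbG (hω (hS (Finset.mem_of_mem_inter_left this)))
  -- Given that `b` is open, deleting it from both witnesses makes them disjoint.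
  have h1 : (PF p G fun ω => ∃ S ⊆ insert b ω, ∃ T ⊆ insert b ω, S ∩ T = {b} ∧ A S ∧ B T) ≤
      PF p G (fun ω => A (insert b ω)) * PF p G (fun ω => B (insert b ω)) := by
    refine le_trans (PF_mono hp0 hp1 ?_) (bk_inequality hp0 hp1 G
      (A := fun ω => A (insert b ω)) (B := fun ω => B (insert b ω))
      (fun S T h => hA _ _ (hins _ _ h)) (fun S T h => hB _ _ (hins _ _ h)))
    rintro ω hω ⟨S, hS, T, hT, hST, h1, h2⟩
    refine ⟨S.erase b, by rwa [← Finset.subset_insert_iff], T.erase b,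
      by rwa [← Finset.subset_insert_iff], ?_, ?_, ?_⟩
    · rw [Finset.disjoint_left]
      intro x hx hx'
      have : x ∈ S ∩ T := Finset.mem_inter.2 ⟨Finset.mem_of_mem_erase hx, Finset.mem_of_mem_erase hx'⟩
      rw [hST, Finset.mem_singleton] at this
      exact Finset.ne_of_mem_erase hx this
    · exact hA _ _ (Finset.insert_erase_subset b S) h1
    · exact hB _ _ (Finset.insert_erase_subset b T) h2
  have hle : ∀ A : Finset V → Prop, p * PF p G (fun ω => A (insert b ω)) ≤ PF p (insert b G) A := by
    intro A
    rw [PF_insert hbG]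
    have := mul_nonneg (show 0 ≤ 1 - p by linarith) (PF_nonneg hp0 hp1 (F := G) A)
    linarith
  rw [PF_insert hbG, h0, mul_zero, zero_add]
  -- One factor p is the probability that `b` is open, the other is the one in the statement; each
  -- event absorbs one of them.
  calc _ ≤ p * (p * (PF p G (fun ω => A (insert b ω)) * PF p G (fun ω => B (insert b ω)))) := by
        gcongr
    _ = (p * PF p G (fun ω => A (insert b ω))) * (p * PF p G (fun ω => B (insert b ω))) := by ring
    _ ≤ _ := mul_le_mul (hle A) (hle B) (mul_nonneg hp0 (PF_nonneg hp0 hp1 _))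
      (PF_nonneg hp0 hp1 _)

end DisjointOccurrence


/-! ### Connections, cut items and branching items. -/

section Connectivity

variable {V : Type*}

/-- The items `i` and `j` are connected within the set `S`, for the adjacency relation `H`. -/
def Conn (H : V → V → Prop) (S : Set V) (i j : V) : Prop :=
  i ∈ S ∧ Relation.ReflTransGen (fun a b => H a b ∧ b ∈ S) i j

variable {H : V → V → Prop} {S T : Set V} {i j k : V}

lemma Conn.left_mem (h : Conn H S i j) : i ∈ S := h.1

lemma Conn.right_mem (h : Conn H S i j) : j ∈ S := by
  obtain ⟨h1, h2⟩ := h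
  cases h2 with
  | refl => exact h1
  | tail _ h => exact h.2

lemma Conn.refl (h : i ∈ S) : Conn H S i i := ⟨h, .refl⟩

lemma Conn.tail (h : Conn H S i j) (h1 : H j k) (h2 : k ∈ S) : Conn H S i k :=
  ⟨h.1, h.2.tail ⟨h1, h2⟩⟩

lemma Conn.trans (h : Conn H S i j) (h' : Conn H S j k) : Conn H S i k := ⟨h.1, h.2.trans h'.2⟩

@[elab_as_elim]
lemma Conn.induction {P : V → Prop} (h : Conn H S i j) (base : P i)
    (step : ∀ a b, Conn H S i a → P a → H a b → b ∈ S → P b) : P j := by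
  obtain ⟨h1, h2⟩ := h
  induction h2 with
  | refl => exact base
  | tail h3 h4 ih => exact step _ _ ⟨h1, h3⟩ ih h4.1 h4.2

lemma Conn.mono (hST : S ⊆ T) (h : Conn H S i j) : Conn H T i j :=
  h.induction (.refl (hST h.1)) fun _ _ _ h1 h2 h3 => h1.tail h2 (hST h3)

lemma Conn.single (hi : i ∈ S) (hj : j ∈ S) (h : H i j) : Conn H S i j := (Conn.refl hi).tail h hj

lemma Conn.symm (hH : ∀ ⦃a b⦄, H a b → H b a) (h : Conn H S i j) : Conn H S j i :=
  h.induction (.refl h.1) fun _ _ h0 h1 h2 h3 =>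
    (Conn.single h3 h0.right_mem (hH h2)).trans h1

/-- A connection stays in the cluster. -/
lemma Conn.within (h : Conn H S i j) : Conn H {a | Conn H S i a} i j :=
  h.induction (.refl (.refl h.1)) fun _ _ h0 h1 h2 h3 => h1.tail h2 (h0.tail h2 h3)

lemma Conn.within_of_subset {U : Set V} (h : Conn H S i j) (hU : ∀ a, Conn H S i a → a ∈ U) :
    Conn H U i j := h.within.mono hU

lemma increasing_conn (i j : V) : Increasing fun S : Finset V => Conn H (S : Set V) i j :=
  fun _ _ hST h => h.mono (Finset.coe_subset.2 hST)

variable [DecidableEq V]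

lemma Conn.exists_finset (h : Conn H S i j) : ∃ T : Finset V, ↑T ⊆ S ∧ Conn H ↑T i j := by
  refine h.induction ⟨{i}, by simpa using h.1, .refl (by simp)⟩ ?_
  rintro a b - ⟨T, hT, hc⟩ hab hb
  refine ⟨insert b T, ?_, ?_⟩
  · rw [Finset.coe_insert]; exact Set.insert_subset hb hT
  · exact (hc.mono (by simp)).tail hab (by simp)

open Classical in
/-- If the removal of `a` disconnects `i` and `j`, then there are connections from `i` to `a` and
from `a` to `j` which share only `a`. -/
lemma Conn.split_at (hH : ∀ ⦃a b⦄, H a b → H b a) {S : Finset V} {a : V} (h : Conn H (S : Set V) i j)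
    (h' : ¬ Conn H (↑(S.erase a) : Set V) i j) :
    ∃ S1 ⊆ S, ∃ S2 ⊆ S, S1 ∩ S2 = {a} ∧ Conn H (S1 : Set V) i a ∧ Conn H (S2 : Set V) a j := by
  have haS : a ∈ S := by
    by_contra haS
    rw [Finset.erase_eq_of_notMem haS] at h'
    exact h' h
  -- The cluster of `i` once `a` is removed. The two witnesses are `insert a K` and `S \ K`, which
  -- meet only in `a`.
  let K : Finset V := S.filter fun b => Conn H (↑(S.erase a) : Set V) i b
  have hK : ∀ b, b ∈ K ↔ Conn H (↑(S.erase a) : Set V) i b := fun b => by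
    simp only [K, Finset.mem_filter, and_iff_right_iff_imp]
    exact fun hb => Finset.mem_of_mem_erase (Finset.mem_coe.1 hb.right_mem)
  have haK : a ∉ K := fun ha => by
    have := ((hK a).1 ha).right_mem
    simp at this
  -- A path from `i` stays in `K` until it reaches `a`.
  have first : ∀ b, Conn H (S : Set V) i b → b ∈ K ∨ Conn H (↑(insert a K) : Set V) i a := by
    intro b hb
    refine hb.induction ?_ ?_
    · by_cases hia : i = a
      · right; subst hia; exact .refl (by simp)
      · left; exact (hK i).2 (.refl (by simpa [hia] using h.left_mem))
    · rintro c b hc (hcK | h1) hcb hbS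
      · by_cases hba : b = a
        · subst hba
          right
          refine Conn.tail (j := c) ?_ hcb (by simp)
          refine ((hK c).1 hcK).within_of_subset fun x hx => ?_
          simp [(hK x).2 hx]
        · left; exact (hK b).2 (((hK c).1 hcK).tail hcb (by simpa [hba] using hbS))
      · exact Or.inr h1
  refine ⟨insert a K, ?_, S \ K, Finset.sdiff_subset, ?_, ?_, ?_⟩
  · exact Finset.insert_subset haS (Finset.filter_subset _ _)
  · ext x; simp only [Finset.mem_inter, Finset.mem_insert, Finset.mem_sdiff, Finset.mem_singleton]
    grind
  · exact (first j h).resolve_left fun hj => h' ((hK j).1 hj)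
  · have hjK : j ∉ K := fun hj => h' ((hK j).1 hj)
    refine Conn.symm hH ?_
    -- A path from `j` avoids `K` until it reaches `a`, since `K` can be entered only through `a`.
    have second : ∀ b, Conn H (S : Set V) j b →
        (b ∉ K ∧ Conn H (↑(S \ K) : Set V) j b) ∨ Conn H (↑(S \ K) : Set V) j a := by
      intro b hb
      refine hb.induction (Or.inl ⟨hjK, .refl (by simpa [hjK] using h.right_mem)⟩) ?_
      rintro c b hc (⟨hcK, h1⟩ | h1) hcb hbS
      · by_cases hbK : b ∈ K
        · right
          by_cases hca : c = a
          · rwa [hca] at h1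
          · refine absurd ?_ hcK
            refine (hK c).2 (((hK b).1 hbK).tail (hH hcb) ?_)
            simpa [hca] using hc.right_mem
        · left; exact ⟨hbK, h1.tail hcb (by simpa [hbK] using hbS)⟩
      · exact Or.inr h1
    have hja : Conn H (S : Set V) j a := by
      have := first j h
      refine (h.symm hH).trans ?_
      refine (this.resolve_left hjK).mono ?_
      rw [Finset.coe_subset]
      exact Finset.insert_subset haS (Finset.filter_subset _ _)
    exact (second a hja).elim (fun h => h.2) id

/-- If `i` and `j` are connected, but not when the items of `X` are removed, then there is an
item of `X` at which the connection splits. -/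
lemma Conn.exists_split (hH : ∀ ⦃a b⦄, H a b → H b a) {S X : Finset V} (h : Conn H (S : Set V) i j)
    (h' : ¬ Conn H (↑(S \ X) : Set V) i j) :
    ∃ a ∈ X, ∃ S1 ⊆ S, ∃ S2 ⊆ S, S1 ∩ S2 = {a} ∧ Conn H (S1 : Set V) i a ∧
      Conn H (S2 : Set V) a j := by
  -- The items of `X` are removed one at a time; the connection splits at the item whose removal
  -- breaks it.
  induction X using Finset.induction_on generalizing S with
  | empty => simp_all
  | insert a X ha ih =>
    by_cases hc : Conn H (↑(S.erase a) : Set V) i j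
    · have : S \ insert a X = S.erase a \ X := by
        ext x; simp only [Finset.mem_sdiff, Finset.mem_insert, Finset.mem_erase]; grind
      rw [this] at h'
      obtain ⟨b, hb, S1, h1, S2, h2, h3⟩ := ih hc h'
      exact ⟨b, Finset.mem_insert_of_mem hb, S1, h1.trans (Finset.erase_subset _ _), S2,
        h2.trans (Finset.erase_subset _ _), h3⟩
    · obtain ⟨S1, h1, S2, h2, h3⟩ := h.split_at hH hc
      exact ⟨a, Finset.mem_insert_self _ _, S1, h1, S2, h2, h3⟩

open Classical in
/-- The branching of the connections from `i` to several items. -/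
lemma Conn.exists_branching (hH : ∀ ⦃a b⦄, H a b → H b a) {ℓ : Type*} [DecidableEq ℓ] (I : Finset ℓ)
    (hI : 1 < I.card) (x : ℓ → V) (S : Finset V) (i : V)
    (h : ∀ l ∈ I, Conn H (S : Set V) i (x l)) :
    ∃ J ⊆ I, J.Nonempty ∧ (I \ J).Nonempty ∧ ∃ b ∈ S, ∃ S1 ⊆ S, ∃ S2 ⊆ S, ∃ S3 ⊆ S,
      S1 ∩ (S2 ∪ S3) = {b} ∧ S2 ∩ S3 = {b} ∧ Conn H (S1 : Set V) i b ∧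
      (∀ l ∈ J, Conn H (S2 : Set V) b (x l)) ∧ (∀ l ∈ I \ J, Conn H (S3 : Set V) b (x l)) := by
  -- The item `i` advances into ever smaller sets as long as all targets remain in one component; it
  -- becomes the branching item when it hits the chosen target or when the targets fall apart.
  induction hn : S.card using Nat.strong_induction_on generalizing S i with
  | _ n ih =>
  obtain ⟨j, hj⟩ : I.Nonempty := Finset.card_pos.1 (by omega)
  have hiS : i ∈ S := by simpa using (h j hj).left_mem
  by_cases hji : x j = i
  · refine ⟨{j}, by simpa using hj, by simp, ?_, i, hiS, {i}, by simpa using hiS, {i},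
      by simpa using hiS, S, subset_rfl, Finset.inter_eq_left.2 (by simp), by simpa using hiS, .refl (by simp), ?_, ?_⟩
    · rw [← Finset.card_pos, Finset.card_sdiff_of_subset (by simpa using hj)]; simp; omega
    · intro l hl
      rw [Finset.mem_singleton.1 hl, hji]; exact .refl (by simp)
    · exact fun l hl => h l (Finset.mem_sdiff.1 hl).1
  -- The component of the chosen target after the removal of `i`.
  let K : Finset V := S.filter fun b => Conn H (↑(S.erase i) : Set V) (x j) b
  have hK : ∀ b, b ∈ K ↔ Conn H (↑(S.erase i) : Set V) (x j) b := fun b => by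
    simp only [K, Finset.mem_filter, and_iff_right_iff_imp]
    exact fun hb => Finset.mem_of_mem_erase (Finset.mem_coe.1 hb.right_mem)
  have hiK : i ∉ K := fun ha => by
    have := ((hK i).1 ha).right_mem
    simp at this
  have hKS : K ⊆ S := Finset.filter_subset _ _
  have hjK : x j ∈ K := (hK _).2 (.refl (by simpa [hji] using (h j hj).right_mem))
  -- connections from `i` enter `K` only through a neighbour of `i`, and never leave it
  have walk : ∀ b, Conn H (S : Set V) i b →
      Conn H (↑(insert i K) : Set V) i b ∧ b ∈ K ∨ Conn H (↑(S \ K) : Set V) i b ∧ b ∉ K := by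
    intro b hb
    refine hb.induction (Or.inr ⟨.refl (by simpa [hiK] using hiS), hiK⟩) ?_
    intro c b hc hcase hcb hbS
    by_cases hbi : b = i
    · subst hbi; exact Or.inr ⟨.refl (by simpa [hiK] using hiS), hiK⟩
    by_cases hci : c = i
    · subst hci
      by_cases hbK : b ∈ K
      · exact Or.inl ⟨.single (by simp) (by simp [hbK]) hcb, hbK⟩
      · exact Or.inr ⟨.single (by simpa [hiK] using hiS) (by simpa [hbK] using hbS) hcb, hbK⟩
    · have hiff : c ∈ K ↔ b ∈ K := by
        rw [hK, hK]
        exact ⟨fun h => h.tail hcb (by simpa [hbi] using hbS),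
          fun h => h.tail (hH hcb) (by simpa [hci] using hc.right_mem)⟩
      rcases hcase with ⟨h1, h2⟩ | ⟨h1, h2⟩
      · exact Or.inl ⟨h1.tail hcb (by simp [hiff.1 h2]), hiff.1 h2⟩
      · have hbK : b ∉ K := fun h => h2 (hiff.2 h)
        exact Or.inr ⟨h1.tail hcb (by simpa [hbK] using hbS), hbK⟩
  by_cases hall : ∀ l ∈ I, x l ∈ K
  · -- all targets are in `K`: continue from a neighbour of `i` in `K`
    have hiK' : ∃ c ∈ K, H i c := by
      have := h j hj
      have key : ∀ b, Conn H (S : Set V) i b → b ∈ K → ∃ c ∈ K, H i c := by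
        intro b hb
        refine hb.induction (fun hi => absurd hi hiK) ?_
        intro c b hc ihc hcb hbS hbK
        by_cases hci : c = i
        · subst hci; exact ⟨b, hbK, hcb⟩
        · exact ihc ((hK c).2 (((hK b).1 hbK).tail (hH hcb) (by simpa [hci] using hc.right_mem)))
      exact key _ this hjK
    obtain ⟨c, hcK, hic⟩ := hiK'
    have hconn : ∀ l ∈ I, Conn H (K : Set V) c (x l) := by
      have hin : ∀ b ∈ K, Conn H (K : Set V) (x j) b := fun b hb =>
        ((hK b).1 hb).within_of_subset fun a ha => by simpa using (hK a).2 ha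
      exact fun l hl => ((hin c hcK).symm hH).trans (hin _ (hall l hl))
    have hlt : K.card < n := by
      rw [← hn]; exact Finset.card_lt_card ⟨hKS, fun h => hiK (h hiS)⟩
    obtain ⟨J, hJ, hJn, hJn', b, hb, S1, h1, S2, h2, S3, h3, e1, e2, c1, c2, c3⟩ :=
      ih K.card hlt K c hconn rfl
    refine ⟨J, hJ, hJn, hJn', b, hKS hb, insert i S1, ?_, S2, h2.trans hKS, S3, h3.trans hKS, ?_,
      e2, ?_, c2, c3⟩
    · exact Finset.insert_subset hiS (h1.trans hKS)
    · rw [Finset.insert_inter_of_notMem, e1]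
      intro hi
      rcases Finset.mem_union.1 hi with hi | hi
      · exact hiK (h2 hi)
      · exact hiK (h3 hi)
    · exact (Conn.single (by simp) (by simpa using Or.inr c1.left_mem) hic).trans
        (c1.mono (by simp))
  -- Some targets are in `K` and some are not, and `i` separates them: it is the branching item.
  · push Not at hall
    obtain ⟨m, hm, hmK⟩ := hall
    refine ⟨I.filter fun l => x l ∈ K, Finset.filter_subset _ _, ⟨j, by simp [hj, hjK]⟩,
      ⟨m, by simp [hm, hmK]⟩, i, hiS, {i}, by simpa using hiS, insert i K,
      Finset.insert_subset hiS hKS, S \ K, Finset.sdiff_subset,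
      Finset.inter_eq_left.2 (by simp), ?_, .refl (by simp),
      ?_, ?_⟩
    · ext y; simp only [Finset.mem_inter, Finset.mem_insert, Finset.mem_sdiff, Finset.mem_singleton]
      grind
    · intro l hl
      rw [Finset.mem_filter] at hl
      exact ((walk _ (h l hl.1)).resolve_right fun h => h.2 hl.2).1
    · intro l hl
      simp only [Finset.mem_sdiff, Finset.mem_filter, not_and] at hl
      exact ((walk _ (h l hl.1)).resolve_left fun h => hl.2 hl.1 h.2).1

end Connectivity

/-! ### The tree-graph inequality. -/

section TreeGraph

variable {V : Type*} [DecidableEq V] {H : V → V → Prop} {p : ℝ}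

/-- The probability that `i` and `j` are connected in the finite volume `F`. -/
noncomputable def tau (H : V → V → Prop) (p : ℝ) (F : Finset V) (i j : V) : ℝ :=
  PF p F fun S => Conn H (S : Set V) i j

lemma tau_nonneg (hp0 : 0 ≤ p) (hp1 : p ≤ 1) (F : Finset V) (i j : V) : 0 ≤ tau H p F i j :=
  PF_nonneg hp0 hp1 _

/-- The probability that `i` is connected to all items `x l`, `l ∈ I`. -/
noncomputable def tauMulti (H : V → V → Prop) (p : ℝ) (F : Finset V) {ℓ : Type*} (I : Finset ℓ)
    (x : ℓ → V) (i : V) : ℝ :=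
  PF p F fun S => ∀ l ∈ I, Conn H (S : Set V) i (x l)

/-- The proper non-empty subsets of a finite set. -/
def splits {ℓ : Type*} [DecidableEq ℓ] (I : Finset ℓ) : Finset (Finset ℓ) :=
  I.powerset.filter fun J => J.Nonempty ∧ (I \ J).Nonempty

/-- The tree-graph inequality. -/
lemma tauMulti_le (hH : ∀ ⦃a b⦄, H a b → H b a) (hp0 : 0 < p) (hp1 : p ≤ 1) (F : Finset V) {ℓ : Type*}
    [DecidableEq ℓ] (I : Finset ℓ) (hI : 1 < I.card) (x : ℓ → V) (i : V) :
    tauMulti H p F I x i ≤ ∑ J ∈ splits I, ∑ b ∈ F, (p ^ 2)⁻¹ *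
      (tau H p F i b * (tauMulti H p F J x b * tauMulti H p F (I \ J) x b)) := by
  have hincr : ∀ (J : Finset ℓ) (b : V),
      Increasing fun S : Finset V => ∀ l ∈ J, Conn H (S : Set V) b (x l) :=
    fun J b S T hST h l hl => increasing_conn _ _ S T hST (h l hl)
  -- The trunk and the two groups of branches share only `b`. Nesting the events allows `bk_sharing`
  -- to be used twice, each time at the price 1/p: first for the trunk against the branches, then
  -- for one group against the other.
  let E2 : Finset ℓ → V → Finset V → Prop := fun J b ω => ∃ S ⊆ ω, ∃ T ⊆ ω, S ∩ T = {b} ∧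
    (∀ l ∈ J, Conn H (S : Set V) b (x l)) ∧ (∀ l ∈ I \ J, Conn H (T : Set V) b (x l))
  let E3 : Finset ℓ → V → Finset V → Prop := fun J b ω => ∃ S ⊆ ω, ∃ T ⊆ ω, S ∩ T = {b} ∧
    Conn H (S : Set V) i b ∧ E2 J b T
  have hE2 : ∀ J b, Increasing (E2 J b) := by
    rintro J b S T hST ⟨S1, h1, S2, h2, h3⟩
    exact ⟨S1, h1.trans hST, S2, h2.trans hST, h3⟩
  have hbound : ∀ J b, PF p F (E3 J b) ≤ (p ^ 2)⁻¹ *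
      (tau H p F i b * (tauMulti H p F J x b * tauMulti H p F (I \ J) x b)) := by
    intro J b
    have h2 : p * PF p F (E2 J b) ≤ tauMulti H p F J x b * tauMulti H p F (I \ J) x b :=
      bk_sharing hp0.le hp1 b (hincr J b) (hincr (I \ J) b)
    have h3 : p * PF p F (E3 J b) ≤ tau H p F i b * PF p F (E2 J b) :=
      bk_sharing hp0.le hp1 b (increasing_conn i b) (hE2 J b)
    rw [← div_eq_inv_mul, le_div_iff₀ (by positivity)]
    calc PF p F (E3 J b) * p ^ 2 = p * (p * PF p F (E3 J b)) := by ring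
      _ ≤ p * (tau H p F i b * PF p F (E2 J b)) := by gcongr
      _ = tau H p F i b * (p * PF p F (E2 J b)) := by ring
      _ ≤ _ := mul_le_mul_of_nonneg_left h2 (tau_nonneg hp0.le hp1 _ _ _)
  calc tauMulti H p F I x i ≤ PF p F fun ω => ∃ J ∈ splits I, ∃ b ∈ F, E3 J b ω := by
        refine PF_mono hp0.le hp1 fun ω hω h => ?_
        obtain ⟨J, hJ, hJn, hJn', b, hb, S1, h1, S2, h2, S3, h3, e1, e2, c1, c2, c3⟩ :=
          Conn.exists_branching hH I hI x ω i h
        exact ⟨J, by simp [splits, hJ, hJn, hJn'], b, hω hb, S1, h1, S2 ∪ S3,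
          Finset.union_subset h2 h3, e1, c1, S2, Finset.subset_union_left, S3,
          Finset.subset_union_right, e2, c2, c3⟩
    _ ≤ ∑ J ∈ splits I, PF p F fun ω => ∃ b ∈ F, E3 J b ω := PF_exists_le hp0.le hp1 _ _
    _ ≤ ∑ J ∈ splits I, ∑ b ∈ F, PF p F (E3 J b) :=
        Finset.sum_le_sum fun J _ => PF_exists_le hp0.le hp1 _ _
    _ ≤ _ := Finset.sum_le_sum fun J _ => Finset.sum_le_sum fun b _ => hbound J b

end TreeGraph


/-! ### Counting labelled binary trees. -/

section TreeCount

/-- The number of labelled trees which occur in the bound for the `k`-th moment. -/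
def treeCount (k : ℕ) : ℕ := k.factorial * catalan (k - 1)

lemma treeCount_one : treeCount 1 = 1 := by simp [treeCount]

/-- Growth of the order (const · k)^k is what produces the logarithm in the upper bound, once k is
of order log L. -/
lemma treeCount_le (k : ℕ) : treeCount k ≤ (4 * k) ^ k := by
  have h1 : catalan (k - 1) ≤ 4 ^ k := by
    rw [catalan_eq_centralBinom_div]
    calc _ ≤ (k - 1).centralBinom := Nat.div_le_self _ _
      _ ≤ 2 ^ (2 * (k - 1)) := Nat.choose_le_two_pow _ _
      _ = 4 ^ (k - 1) := by rw [pow_mul]; norm_num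
      _ ≤ 4 ^ k := Nat.pow_le_pow_right (by norm_num) (by omega)
  calc treeCount k ≤ k ^ k * 4 ^ k := Nat.mul_le_mul (Nat.factorial_le_pow k) h1
    _ = (4 * k) ^ k := by rw [mul_pow]; ring

/-- The number of choices of `J` of a given size cancels against the factorials, which leaves the
Catalan convolution. Thus the count reproduces itself under the tree-graph recursion. -/
lemma sum_splits_treeCount {ℓ : Type*} [DecidableEq ℓ] (I : Finset ℓ) (hI : 1 < I.card) :
    ∑ J ∈ splits I, treeCount J.card * treeCount (I \ J).card = treeCount I.card := by
  obtain ⟨k, hk⟩ : ∃ k, I.card = k + 2 := ⟨I.card - 2, by omega⟩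
  let f : ℕ → ℕ := fun j =>
    if 0 < j ∧ j < k + 2 then treeCount j * treeCount (k + 2 - j) else 0
  have h1 : ∑ J ∈ splits I, treeCount J.card * treeCount (I \ J).card =
      ∑ J ∈ I.powerset, f J.card := by
    rw [splits, Finset.sum_filter]
    refine Finset.sum_congr rfl fun J hJ => ?_
    rw [Finset.mem_powerset] at hJ
    have hc := Finset.card_sdiff_of_subset hJ
    have : (J.Nonempty ∧ (I \ J).Nonempty) ↔ (0 < J.card ∧ J.card < k + 2) := by
      rw [← Finset.card_pos, ← Finset.card_pos, hc, hk]; omega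
    simp only [f, this, hc, hk]
  rw [h1, Finset.sum_powerset_apply_card, hk, Finset.sum_range_succ', Finset.sum_range_succ]
  simp only [f]
  simp only [lt_irrefl, false_and, and_false, if_false, smul_zero, add_zero]
  rw [treeCount, show k + 2 - 1 = k + 1 by omega, catalan_succ', Finset.mul_sum,
    Finset.Nat.sum_antidiagonal_eq_sum_range_succ_mk]
  refine Finset.sum_congr rfl fun j hj => ?_
  rw [Finset.mem_range] at hj
  rw [if_pos ⟨by omega, by omega⟩, treeCount, treeCount, smul_eq_mul,
    show k + 2 - (j + 1) - 1 = k - j by omega, show j + 1 - 1 = j by omega]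
  have := Nat.choose_mul_factorial_mul_factorial (show j + 1 ≤ k + 2 by omega)
  rw [← this]; ring

end TreeCount

/-! ### Moments of the number of connected items. -/

section Moments

variable {V : Type*} {H : V → V → Prop} {p : ℝ}

/-- The number of the items of `S` which are connected to `i`. -/
noncomputable def hits (H : V → V → Prop) (ω : Set V) (S : Finset V) (i : V) : ℝ :=
  ∑ x ∈ S, ind (Conn H ω i x)

lemma hits_nonneg (ω : Set V) (S : Finset V) (i : V) : 0 ≤ hits H ω S i :=
  Finset.sum_nonneg fun _ _ => ind_nonneg _

variable [DecidableEq V]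

lemma EF_hits (F S : Finset V) (i : V) :
    EF p F (fun ω => hits H ↑ω S i) = ∑ x ∈ S, tau H p F i x := by
  simp only [hits, EF_sum]; rfl

lemma prod_ind {ℓ : Type*} (I : Finset ℓ) (A : ℓ → Prop) :
    ∏ l ∈ I, ind (A l) = ind (∀ l ∈ I, A l) := by
  classical
  induction I using Finset.induction_on with
  | empty => simp [ind]
  | insert a I ha ih => rw [Finset.prod_insert ha, ih, ← ind_and]; simp

/-- The joint moments of the numbers of items connected to `i`. -/
noncomputable def moment (H : V → V → Prop) (p : ℝ) (F : Finset V) {ℓ : Type*} (S : ℓ → Finset V)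
    (I : Finset ℓ) (i : V) : ℝ :=
  EF p F fun ω => ∏ l ∈ I, hits H ↑ω (S l) i

lemma moment_nonneg (hp0 : 0 ≤ p) (hp1 : p ≤ 1) (F : Finset V) {ℓ : Type*} (S : ℓ → Finset V)
    (I : Finset ℓ) (i : V) : 0 ≤ moment H p F S I i :=
  EF_nonneg hp0 hp1 fun _ _ => Finset.prod_nonneg fun _ _ => hits_nonneg _ _ _

/-- The product of hits expands into tuples of targets, to each of which the tree-graph inequality
applies. For a fixed `J` and `b` the sum over the tuples factorises again, into the moments of two
independent copies. -/
lemma moment_le_sum (hH : ∀ ⦃a b⦄, H a b → H b a) (hp0 : 0 < p) (hp1 : p ≤ 1) (F : Finset V)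
    {ℓ : Type*} [DecidableEq ℓ] (S : ℓ → Finset V) (I : Finset ℓ) (hI : 1 < I.card) (i : V) :
    moment H p F S I i ≤ ∑ J ∈ splits I, ∑ b ∈ F, (p ^ 2)⁻¹ *
      (tau H p F i b * (moment H p F S J b * moment H p F S (I \ J) b)) := by
  -- The value `i` outside `I` is a default which is never used.
  let X : ((l : ℓ) → l ∈ I → V) → ℓ → V := fun y l => if h : l ∈ I then y l h else i
  have hX : ∀ h : ℓ → V → ℝ, ∏ l ∈ I, ∑ a ∈ S l, h l a =
      ∑ y ∈ I.pi S, ∏ l ∈ I, h l (X y l) := by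
    intro h
    rw [Finset.prod_sum]
    refine Finset.sum_congr rfl fun y _ => ?_
    rw [← Finset.prod_attach I]
    exact Finset.prod_congr rfl fun l _ => by simp [X]
  have h1 : moment H p F S I i = ∑ y ∈ I.pi S, tauMulti H p F I (X y) i := by
    simp only [moment, hits, hX, EF_sum, prod_ind]
    rfl
  have h2 : ∀ J ∈ splits I, ∀ b, ∑ y ∈ I.pi S,
      tauMulti H p F J (X y) b * tauMulti H p F (I \ J) (X y) b =
      moment H p F S J b * moment H p F S (I \ J) b := by
    intro J hJ b
    have hJI : J ⊆ I := by
      rw [splits, Finset.mem_filter, Finset.mem_powerset] at hJ; exact hJ.1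
    have hprod : ∀ f g : ℓ → ℝ, (∏ l ∈ J, f l) * ∏ l ∈ I \ J, g l =
        ∏ l ∈ I, if l ∈ J then f l else g l := by
      intro f g
      rw [← Finset.prod_sdiff hJI, mul_comm]
      congr 1
      · exact Finset.prod_congr rfl fun l hl => by rw [if_neg (Finset.mem_sdiff.1 hl).2]
      · exact Finset.prod_congr rfl fun l hl => by rw [if_pos hl]
    have hcomb : ∀ ω ω' : Finset V,
        (∏ l ∈ J, hits H ↑ω (S l) b) * ∏ l ∈ I \ J, hits H ↑ω' (S l) b =
        ∑ y ∈ I.pi S, ind (∀ l ∈ J, Conn H ↑ω b (X y l)) *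
          ind (∀ l ∈ I \ J, Conn H ↑ω' b (X y l)) := by
      intro ω ω'
      rw [hprod]
      have : ∀ l ∈ I, (if l ∈ J then hits H ↑ω (S l) b else hits H ↑ω' (S l) b) =
          ∑ a ∈ S l, if l ∈ J then ind (Conn H ↑ω b a) else ind (Conn H ↑ω' b a) := by
        intro l _
        split_ifs <;> rfl
      rw [Finset.prod_congr rfl this, hX]
      refine Finset.sum_congr rfl fun y _ => ?_
      rw [← prod_ind, ← prod_ind, hprod]
    simp only [moment, EF_mul_EF, hcomb, EF_sum, tauMulti, PF]
  rw [h1]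
  calc _ ≤ ∑ y ∈ I.pi S, ∑ J ∈ splits I, ∑ b ∈ F, (p ^ 2)⁻¹ * (tau H p F i b *
        (tauMulti H p F J (X y) b * tauMulti H p F (I \ J) (X y) b)) :=
        Finset.sum_le_sum fun y _ => tauMulti_le hH hp0 hp1 F I hI _ i
    _ = _ := by
      rw [Finset.sum_comm]
      refine Finset.sum_congr rfl fun J hJ => ?_
      rw [Finset.sum_comm]
      refine Finset.sum_congr rfl fun b _ => ?_
      rw [← Finset.mul_sum, ← Finset.mul_sum, h2 J hJ b]

/-- The bound for the joint moments of the numbers of items connected to `i`. -/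
lemma moment_le (hH : ∀ ⦃a b⦄, H a b → H b a) (hp0 : 0 < p) (hp1 : p ≤ 1) (F : Finset V)
    {ℓ : Type*} [DecidableEq ℓ] (S : ℓ → Finset V) (K : ℓ → ℝ) (ψ : V → ℝ) (Λ : ℝ)
    (hK : ∀ l, 0 ≤ K l) (hΛ : 0 ≤ Λ)
    (hconv : ∀ i, ∑ b ∈ F, tau H p F i b * ψ b ^ 2 ≤ Λ * ψ i)
    (hS : ∀ l i, ∑ x ∈ S l, tau H p F i x ≤ K l * ψ i) (I : Finset ℓ) (hI : I.Nonempty) (i : V) :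
    moment H p F S I i ≤
      treeCount I.card * (∏ l ∈ I, K l) * (Λ / p ^ 2) ^ (I.card - 1) * ψ i := by
  -- The two subtrees at `b` contribute `ψ b ^ 2`, and the convolution hypothesis turns this back
  -- into `Λ * ψ i`: the form of the bound is stable under branching.
  induction hn : I.card using Nat.strong_induction_on generalizing I i with
  | _ n ih =>
  have hnpos : 0 < n := hn ▸ Finset.card_pos.2 hI
  rcases Nat.lt_or_ge 1 n with hn1 | hn1
  swap
  · obtain rfl : n = 1 := by omega
    obtain ⟨l, rfl⟩ := Finset.card_eq_one.1 hn
    simp only [moment, Finset.prod_singleton, EF_hits, treeCount_one, Nat.cast_one, one_mul,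
      Nat.sub_self, pow_zero, mul_one]
    exact hS l i
  set lam := Λ / p ^ 2 with hlam
  have hlam0 : 0 ≤ lam := by positivity
  calc moment H p F S I i ≤ ∑ J ∈ splits I, ∑ b ∈ F, (p ^ 2)⁻¹ *
      (tau H p F i b * (moment H p F S J b * moment H p F S (I \ J) b)) :=
        moment_le_sum hH hp0 hp1 F S I (by omega) i
    _ ≤ ∑ J ∈ splits I, ∑ b ∈ F, (p ^ 2)⁻¹ * (tau H p F i b *
      (((treeCount J.card * treeCount (I \ J).card : ℕ) : ℝ) * (∏ l ∈ I, K l) * lam ^ (n - 2) *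
        ψ b ^ 2)) := by
        refine Finset.sum_le_sum fun J hJ => Finset.sum_le_sum fun b _ => ?_
        simp only [splits, Finset.mem_filter, Finset.mem_powerset] at hJ
        obtain ⟨hJI, hJ1, hJ2⟩ := hJ
        have hc := Finset.card_sdiff_of_subset hJI
        have c1 := Finset.card_pos.2 hJ1
        have c2 := Finset.card_pos.2 hJ2
        have b1 := ih J.card (by omega) J hJ1 b rfl
        have b2 := ih (I \ J).card (by omega) (I \ J) hJ2 b rfl
        have hmul := mul_le_mul b1 b2 (moment_nonneg hp0.le hp1 F S _ b)
          ((moment_nonneg hp0.le hp1 F S _ b).trans b1)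
        have heq : (treeCount J.card * (∏ l ∈ J, K l) * lam ^ (J.card - 1) * ψ b) *
            (treeCount (I \ J).card * (∏ l ∈ I \ J, K l) * lam ^ ((I \ J).card - 1) * ψ b) =
            ((treeCount J.card * treeCount (I \ J).card : ℕ) : ℝ) * (∏ l ∈ I, K l) *
              lam ^ (n - 2) * ψ b ^ 2 := by
          rw [← Finset.prod_sdiff hJI,
            show n - 2 = (J.card - 1) + ((I \ J).card - 1) by omega, pow_add]
          push_cast; ring
        rw [heq] at hmul
        exact mul_le_mul_of_nonneg_left (mul_le_mul_of_nonneg_left hmul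
          (tau_nonneg hp0.le hp1 _ _ _)) (by positivity)
    _ = (∑ J ∈ splits I, ((treeCount J.card * treeCount (I \ J).card : ℕ) : ℝ)) *
        ((p ^ 2)⁻¹ * (∏ l ∈ I, K l) * lam ^ (n - 2) * ∑ b ∈ F, tau H p F i b * ψ b ^ 2) := by
        rw [Finset.sum_mul]
        refine Finset.sum_congr rfl fun J _ => ?_
        rw [Finset.mul_sum, Finset.mul_sum]
        exact Finset.sum_congr rfl fun b _ => by ring
    _ ≤ (∑ J ∈ splits I, ((treeCount J.card * treeCount (I \ J).card : ℕ) : ℝ)) *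
        ((p ^ 2)⁻¹ * (∏ l ∈ I, K l) * lam ^ (n - 2) * (Λ * ψ i)) := by
        have : 0 ≤ ∏ l ∈ I, K l := Finset.prod_nonneg fun l _ => hK l
        gcongr
        exact hconv i
    _ = _ := by
        rw [← Nat.cast_sum, sum_splits_treeCount I (by omega), hn,
          show n - 1 = (n - 2) + 1 by omega, pow_succ, hlam]
        ring

end Moments


/-! ### Sums and convolutions of inverse powers. -/

section PowerSums

/-- Bernoulli's inequality for (k / (k + 1))^α; a discrete derivative of the inverse power. -/
lemma one_div_pow_le_succ (α k : ℕ) (hk : 1 ≤ k) :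
    1 / (k : ℝ) ^ α ≤ 1 / ((k + 1 : ℕ) : ℝ) ^ α + α / (k : ℝ) ^ (α + 1) := by
  have hk0 : (0 : ℝ) < k := by exact_mod_cast hk
  have h := one_add_mul_le_pow (a := -(1 / ((k : ℝ) + 1))) (by
    have : 1 / ((k : ℝ) + 1) ≤ 1 := by rw [div_le_one (by positivity)]; linarith
    linarith) α
  have h1 : (1 : ℝ) + -(1 / ((k : ℝ) + 1)) = k / (k + 1) := by field_simp; ring
  rw [h1, div_pow] at h
  have h2 : (α : ℝ) * (1 / ((k : ℝ) + 1)) ≤ α * (1 / k) := by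
    gcongr; linarith
  have h3 : 1 ≤ (k : ℝ) ^ α / (k + 1) ^ α + α * (1 / k) := by linarith
  calc 1 / (k : ℝ) ^ α ≤ ((k : ℝ) ^ α / (k + 1) ^ α + α * (1 / k)) / (k : ℝ) ^ α := by gcongr
    _ = _ := by push_cast; field_simp; ring

lemma one_div_pow_le_sum (α n R : ℕ) (hn : 1 ≤ n) (hR : n ≤ R) :
    1 / (n : ℝ) ^ α ≤ 1 / (R : ℝ) ^ α + ∑ k ∈ Finset.Ico n R, (α : ℝ) / (k : ℝ) ^ (α + 1) := by
  induction R, hR using Nat.le_induction with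
  | base => simp
  | succ R hR ih =>
    rw [Finset.sum_Ico_succ_top hR]
    linarith [one_div_pow_le_succ α R (hn.trans hR)]

variable {V : Type*}

/-- The number of elements of `S` with label at most `k` is at most `g * k ^ m`. -/
def GrowthLE (S : Finset V) (n : V → ℕ) (g : ℝ) (m : ℕ) : Prop :=
  (∀ j ∈ S, 1 ≤ n j) ∧ ∀ k : ℕ, 1 ≤ k → ((S.filter fun j => n j ≤ k).card : ℝ) ≤ g * (k : ℝ) ^ m

variable {S : Finset V} {n : V → ℕ} {g : ℝ} {m : ℕ}

lemma GrowthLE.nonneg (h : GrowthLE S n g m) : 0 ≤ g := by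
  have := h.2 1 le_rfl
  simp only [Nat.cast_one, one_pow, mul_one] at this
  exact (Nat.cast_nonneg _).trans this

lemma GrowthLE.subset (h : GrowthLE S n g m) {S' : Finset V} (hS : S' ⊆ S) :
    GrowthLE S' n g m :=
  ⟨fun j hj => h.1 j (hS hj), fun k hk => (by
    exact_mod_cast Finset.card_le_card (Finset.filter_subset_filter _ hS) : _ ≤ _).trans (h.2 k hk)⟩

/-- The layer-cake bound for a sum of inverse powers. -/
lemma GrowthLE.sum_le (h : GrowthLE S n g m) (α r R : ℕ) (hr : 1 ≤ r) (hrR : r ≤ R)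
    (hlow : ∀ j ∈ S, r ≤ n j) (hup : ∀ j ∈ S, n j ≤ R) :
    ∑ j ∈ S, 1 / (n j : ℝ) ^ α ≤
      g * (R : ℝ) ^ m / (R : ℝ) ^ α +
        ∑ k ∈ Finset.Ico r R, (α : ℝ) * (g * (k : ℝ) ^ m) / (k : ℝ) ^ (α + 1) := by
  calc ∑ j ∈ S, 1 / (n j : ℝ) ^ α
      ≤ ∑ j ∈ S, (1 / (R : ℝ) ^ α +
        ∑ k ∈ Finset.Ico r R, if n j ≤ k then (α : ℝ) / (k : ℝ) ^ (α + 1) else 0) := by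
        refine Finset.sum_le_sum fun j hj => ?_
        refine (one_div_pow_le_sum α (n j) R (h.1 j hj) (hup j hj)).trans (le_of_eq ?_)
        congr 1
        rw [← Finset.sum_filter]
        refine Finset.sum_congr ?_ fun _ _ => rfl
        ext k
        simp only [Finset.mem_Ico, Finset.mem_filter]
        have := hlow j hj
        omega
    _ = (S.card : ℝ) / (R : ℝ) ^ α + ∑ k ∈ Finset.Ico r R,
        (α : ℝ) * ((S.filter fun j => n j ≤ k).card : ℝ) / (k : ℝ) ^ (α + 1) := by
        rw [Finset.sum_add_distrib, Finset.sum_comm]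
        congr 1
        · rw [Finset.sum_const, nsmul_eq_mul, mul_one_div]
        · refine Finset.sum_congr rfl fun k _ => ?_
          rw [← Finset.sum_filter, Finset.sum_const, nsmul_eq_mul]; ring
    _ ≤ _ := by
        have hR := h.2 R (hr.trans hrR)
        rw [Finset.filter_true_of_mem hup] at hR
        gcongr with k hk
        rw [Finset.mem_Ico] at hk
        exact h.2 k (hr.trans hk.1)

/-- The growth k^m wins over the decay, so the largest scale `r` dominates. -/
lemma GrowthLE.sum_near_le (h : GrowthLE S n g m) (α r : ℕ) (hα : α < m) (hr : 1 ≤ r)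
    (hup : ∀ j ∈ S, n j ≤ r) :
    ∑ j ∈ S, 1 / (n j : ℝ) ^ α ≤ g * (1 + α) * (r : ℝ) ^ (m - α) := by
  have hg := h.nonneg
  have hr0 : (0 : ℝ) < r := by exact_mod_cast hr
  obtain ⟨c, rfl⟩ : ∃ c, m = α + 1 + c := ⟨m - α - 1, by omega⟩
  refine (h.sum_le α 1 r le_rfl hr h.1 hup).trans ?_
  have h1 : ∑ k ∈ Finset.Ico 1 r, (α : ℝ) * (g * (k : ℝ) ^ (α + 1 + c)) / (k : ℝ) ^ (α + 1) ≤
      ∑ k ∈ Finset.Ico 1 r, (α : ℝ) * g * (r : ℝ) ^ c := by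
    refine Finset.sum_le_sum fun k hk => ?_
    rw [Finset.mem_Ico] at hk
    have hk0 : (0 : ℝ) < k := by exact_mod_cast hk.1
    have hkr : (k : ℝ) ≤ r := by exact_mod_cast hk.2.le
    calc _ = (α : ℝ) * g * (k : ℝ) ^ c := by rw [pow_add]; field_simp
      _ ≤ _ := by gcongr
  have h2 : ∑ k ∈ Finset.Ico 1 r, (α : ℝ) * g * (r : ℝ) ^ c ≤ α * g * (r : ℝ) ^ (c + 1) := by
    rw [Finset.sum_const, nsmul_eq_mul, Nat.card_Ico, pow_succ]
    have : ((r - 1 : ℕ) : ℝ) ≤ r := by exact_mod_cast Nat.sub_le _ _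
    calc _ ≤ (r : ℝ) * (α * g * (r : ℝ) ^ c) := by gcongr
      _ = _ := by ring
  have h3 : g * (r : ℝ) ^ (α + 1 + c) / (r : ℝ) ^ α = g * (r : ℝ) ^ (c + 1) := by
    rw [show α + 1 + c = α + (c + 1) by omega, pow_add]; field_simp
  rw [h3, show α + 1 + c - α = c + 1 by omega]
  linarith [h1.trans h2]

/-- The decay wins by at least one integer power, so the smallest scale `r` dominates and the
comparison series is that of the inverse squares. -/
lemma GrowthLE.sum_far_le (h : GrowthLE S n g m) (β r : ℕ) (hβ : m < β) (hr : 1 ≤ r)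
    (hlow : ∀ j ∈ S, r ≤ n j) :
    ∑ j ∈ S, 1 / (n j : ℝ) ^ β ≤ g * (1 + 2 * β) / (r : ℝ) ^ (β - m) := by
  have hg := h.nonneg
  have hr0 : (0 : ℝ) < r := by exact_mod_cast hr
  obtain ⟨c, rfl⟩ : ∃ c, β = m + 1 + c := ⟨β - m - 1, by omega⟩
  -- A top level exists because `S` is finite; the final bound does not depend on it.
  let R := max r (S.sup n)
  have hrR : r ≤ R := le_max_left _ _
  have hrR' : (r : ℝ) ≤ R := by exact_mod_cast hrR
  have hR0 : (0 : ℝ) < R := hr0.trans_le hrR'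
  refine (h.sum_le _ r R hr hrR hlow fun j hj =>
    (Finset.le_sup (f := n) hj).trans (le_max_right _ _)).trans ?_
  rw [show m + 1 + c - m = c + 1 by omega]
  set β := m + 1 + c with hβdef
  have h3 : g * (R : ℝ) ^ m / (R : ℝ) ^ β ≤ g / (r : ℝ) ^ (c + 1) := by
    rw [hβdef, show m + 1 + c = m + (c + 1) by omega, pow_add]
    calc _ = g / (R : ℝ) ^ (c + 1) := by field_simp
      _ ≤ _ := by gcongr
  have h1 : ∑ k ∈ Finset.Ico r R, (β : ℝ) * (g * (k : ℝ) ^ m) / (k : ℝ) ^ (β + 1) ≤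
      ∑ k ∈ Finset.Ico r R, (β : ℝ) * g / (r : ℝ) ^ c * ((k : ℝ) ^ 2)⁻¹ := by
    refine Finset.sum_le_sum fun k hk => ?_
    rw [Finset.mem_Ico] at hk
    have hkr : (r : ℝ) ≤ k := by exact_mod_cast hk.1
    have hk0 : (0 : ℝ) < k := hr0.trans_le hkr
    calc _ = (β : ℝ) * g / (k : ℝ) ^ c * ((k : ℝ) ^ 2)⁻¹ := by
          rw [show β + 1 = m + c + 2 by omega, pow_add, pow_add]; field_simp
      _ ≤ _ := by gcongr
  have h2 : ∑ k ∈ Finset.Ico r R, ((k : ℝ) ^ 2)⁻¹ ≤ 2 / r := by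
    have := sum_Ioo_inv_sq_le (α := ℝ) (r - 1) R
    have hset : Finset.Ioo (r - 1) R = Finset.Ico r R := by
      ext k; simp only [Finset.mem_Ioo, Finset.mem_Ico]; omega
    rw [hset] at this
    have hc : ((r - 1 : ℕ) : ℝ) + 1 = r := by
      rw [Nat.cast_sub hr]; simp
    rwa [hc] at this
  rw [← Finset.mul_sum] at h1
  have h4 : (β : ℝ) * g / (r : ℝ) ^ c * ∑ k ∈ Finset.Ico r R, ((k : ℝ) ^ 2)⁻¹ ≤
      (β : ℝ) * g / (r : ℝ) ^ c * (2 / r) := by gcongr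
  have h5 : (β : ℝ) * g / (r : ℝ) ^ c * (2 / r) = 2 * β * g / (r : ℝ) ^ (c + 1) := by
    rw [pow_succ]; field_simp
  have h6 : g * (1 + 2 * (β : ℝ)) / (r : ℝ) ^ (c + 1) =
      g / (r : ℝ) ^ (c + 1) + 2 * β * g / (r : ℝ) ^ (c + 1) := by ring
  rw [h6]
  linarith

lemma inv_pow_le_of_le_two_mul {a r : ℕ} (e : ℕ) (hr : 1 ≤ r) (h : r ≤ 2 * a) :
    1 / (a : ℝ) ^ e ≤ (2 / (r : ℝ)) ^ e := by
  have hr0 : (0 : ℝ) < r := by exact_mod_cast hr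
  have h' : (r : ℝ) ≤ 2 * a := by exact_mod_cast h
  have ha : (0 : ℝ) < a := by linarith
  rw [← one_div_pow]
  gcongr ?_ ^ e
  rw [div_le_div_iff₀ ha hr0]; linarith

/-- The convolution of two inverse powers. -/
lemma sum_convolution_le {a b : V → ℕ} (ha : GrowthLE S a g m) (hb : GrowthLE S b g m) (α β : ℕ)
    (hα : α < m) (hβ : β < m) (hm : m < α + β) (r : ℕ) (hr : 1 ≤ r)
    (hab : ∀ j ∈ S, r ≤ a j + b j) :
    ∑ j ∈ S, 1 / (a j : ℝ) ^ α * (1 / (b j : ℝ) ^ β) ≤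
      g * (2 ^ β * (1 + α) + 2 ^ α * (1 + β) + 2 * (1 + 2 * (α + β))) /
        (r : ℝ) ^ (α + β - m) := by
  have hr0 : (0 : ℝ) < r := by exact_mod_cast hr
  -- By symmetry one may restrict to a ≤ b, where b ≥ r/2. For a ≤ r the factor in b is bounded by
  -- its value at r/2; for a > r it is bounded by the same power of a, and the exponents add up to
  -- more than `m`.
  have key : ∀ (a b : V → ℕ) (_ : GrowthLE S a g m) (α β : ℕ) (_ : α < m) (_ : β < m)
      (_ : m < α + β) (_ : ∀ j ∈ S, r ≤ a j + b j),
      ∑ j ∈ S.filter (fun j => a j ≤ b j), 1 / (a j : ℝ) ^ α * (1 / (b j : ℝ) ^ β) ≤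
      g * (2 ^ β * (1 + α) + (1 + 2 * (α + β))) / (r : ℝ) ^ (α + β - m) := by
    intro a b ha α β hα hβ hm hab
    set S' := S.filter (fun j => a j ≤ b j) with hS'
    have hsub : S' ⊆ S := Finset.filter_subset _ _
    have hpt : ∀ j ∈ S', 1 / (a j : ℝ) ^ α * (1 / (b j : ℝ) ^ β) ≤
        (2 / (r : ℝ)) ^ β * (if a j ≤ r then 1 / (a j : ℝ) ^ α else 0) +
          (if r ≤ a j then 1 / (a j : ℝ) ^ (α + β) else 0) := by
      intro j hj
      have hjS := hsub hj
      rw [hS', Finset.mem_filter] at hj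
      have ha1 : (0 : ℝ) < a j := by exact_mod_cast ha.1 j hjS
      have hab1 : (a j : ℝ) ≤ b j := by exact_mod_cast hj.2
      by_cases hc : a j ≤ r
      · rw [if_pos hc]
        have : 1 / (b j : ℝ) ^ β ≤ (2 / (r : ℝ)) ^ β :=
          inv_pow_le_of_le_two_mul β hr (by have := hab j hjS; omega)
        have h0 : (0 : ℝ) ≤ if r ≤ a j then 1 / (a j : ℝ) ^ (α + β) else 0 := by
          split_ifs <;> positivity
        have h1 : (0 : ℝ) ≤ 1 / (a j : ℝ) ^ α := by positivity
        nlinarith [mul_le_mul_of_nonneg_left this h1]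
      · rw [if_neg hc, if_pos (by omega), mul_zero, zero_add, pow_add, one_div_mul_one_div]
        gcongr
    refine (Finset.sum_le_sum hpt).trans ?_
    rw [Finset.sum_add_distrib, ← Finset.mul_sum, ← Finset.sum_filter, ← Finset.sum_filter]
    have n1 := (ha.subset ((Finset.filter_subset (fun j => a j ≤ r) S').trans hsub)).sum_near_le
      α r hα hr (fun j hj => (Finset.mem_filter.1 hj).2)
    have n2 := (ha.subset ((Finset.filter_subset (fun j => r ≤ a j) S').trans hsub)).sum_far_le
      (α + β) r hm hr (fun j hj => (Finset.mem_filter.1 hj).2)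
    have n3 : (2 / (r : ℝ)) ^ β * (g * (1 + α) * (r : ℝ) ^ (m - α)) =
        g * (2 ^ β * (1 + α)) / (r : ℝ) ^ (α + β - m) := by
      obtain ⟨c, rfl⟩ : ∃ c, m = α + c := ⟨m - α, by omega⟩
      obtain ⟨e, rfl⟩ : ∃ e, β = c + e := ⟨β - c, by omega⟩
      rw [show α + (c + e) - (α + c) = e by omega, show α + c - α = c by omega, div_pow, pow_add,
        pow_add]
      field_simp
    have n4 := mul_le_mul_of_nonneg_left n1 (by positivity : (0 : ℝ) ≤ (2 / (r : ℝ)) ^ β)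
    rw [n3] at n4
    push_cast at n2
    calc _ ≤ _ := add_le_add n4 n2
      _ = _ := by ring
  have k1 := key a b ha α β hα hβ hm hab
  have k2 := key b a hb β α hβ hα (by omega) (fun j hj => by have := hab j hj; omega)
  calc _ ≤ ∑ j ∈ S.filter (fun j => a j ≤ b j), 1 / (a j : ℝ) ^ α * (1 / (b j : ℝ) ^ β) +
        ∑ j ∈ S.filter (fun j => b j ≤ a j), 1 / (b j : ℝ) ^ β * (1 / (a j : ℝ) ^ α) := by
        rw [Finset.sum_filter, Finset.sum_filter, ← Finset.sum_add_distrib]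
        refine Finset.sum_le_sum fun j _ => ?_
        have : (0 : ℝ) ≤ 1 / (a j : ℝ) ^ α * (1 / (b j : ℝ) ^ β) := by positivity
        rcases le_total (a j) (b j) with h | h
        · rw [if_pos h]
          split_ifs
          · linarith [mul_comm (1 / (a j : ℝ) ^ α) (1 / (b j : ℝ) ^ β)]
          · linarith
        · rw [if_pos h]
          split_ifs
          · linarith [mul_comm (1 / (a j : ℝ) ^ α) (1 / (b j : ℝ) ^ β)]
          · linarith [mul_comm (1 / (a j : ℝ) ^ α) (1 / (b j : ℝ) ^ β)]
    _ ≤ _ := add_le_add k1 k2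
    _ = _ := by rw [add_comm β α]; ring

/-- The convolution of an inverse power with the square of the profile `q ^ (-e)`, where the labels
`q` are at least `L`. -/
lemma sum_profile_le {a q : V → ℕ} {d : ℕ} (hd : 6 < d) (ha : GrowthLE S a g d)
    (hq : GrowthLE S q g d) (L Q : ℕ) (hL : 1 ≤ L) (hLQ : L ≤ Q) (hLq : ∀ j ∈ S, L ≤ q j)
    (hQ : ∀ j ∈ S, Q ≤ a j + q j) :
    ∑ j ∈ S, 1 / (a j : ℝ) ^ (d - 2) * (1 / (q j : ℝ) ^ (2 * (d - 2))) ≤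
      g * (4 ^ d * (10 * d)) / ((L : ℝ) ^ (d - 4) * (Q : ℝ) ^ (d - 2)) := by
  obtain ⟨c, rfl⟩ : ∃ c, d = c + 4 := ⟨d - 4, by omega⟩
  rw [show c + 4 - 2 = c + 2 by omega, show c + 4 - 4 = c by omega]
  have hg := hq.nonneg
  have hL0 : (0 : ℝ) < L := by exact_mod_cast hL
  have hLQ' : (L : ℝ) ≤ Q := by exact_mod_cast hLQ
  have hQ0 : (0 : ℝ) < Q := hL0.trans_le hLQ'
  have hQ1 : 1 ≤ Q := hL.trans hLQ
  -- The larger of a and q is at least Q/2. The three terms cover q ≤ a, then a ≤ q with a ≤ Q, and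
  -- finally a ≤ q with a > Q, where q is replaced by a. The first is summed over the labels q ≥ L,
  -- the others over the labels a.
  have hpt : ∀ j ∈ S, 1 / (a j : ℝ) ^ (c + 2) * (1 / (q j : ℝ) ^ (2 * (c + 2))) ≤
      (2 / (Q : ℝ)) ^ (c + 2) * (1 / (q j : ℝ) ^ (2 * (c + 2))) +
      ((2 / (Q : ℝ)) ^ (2 * (c + 2)) * (if a j ≤ Q then 1 / (a j : ℝ) ^ (c + 2) else 0) +
        if Q ≤ a j then 1 / (a j : ℝ) ^ (3 * (c + 2)) else 0) := by
    intro j hj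
    have ha1 : (0 : ℝ) < a j := by exact_mod_cast ha.1 j hj
    have hq1 : (0 : ℝ) < q j := by exact_mod_cast hq.1 j hj
    have hQj := hQ j hj
    have h0 : (0 : ℝ) ≤ if Q ≤ a j then 1 / (a j : ℝ) ^ (3 * (c + 2)) else 0 := by
      split_ifs <;> positivity
    have h1 : (0 : ℝ) ≤ if a j ≤ Q then 1 / (a j : ℝ) ^ (c + 2) else 0 := by
      split_ifs <;> positivity
    rcases le_total (q j) (a j) with h | h
    · have : 1 / (a j : ℝ) ^ (c + 2) ≤ (2 / (Q : ℝ)) ^ (c + 2) :=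
        inv_pow_le_of_le_two_mul _ hQ1 (by omega)
      have h2 := mul_le_mul_of_nonneg_right this
        (by positivity : (0 : ℝ) ≤ 1 / (q j : ℝ) ^ (2 * (c + 2)))
      have h3 : 0 ≤ (2 / (Q : ℝ)) ^ (2 * (c + 2)) *
        (if a j ≤ Q then 1 / (a j : ℝ) ^ (c + 2) else 0) := by positivity
      linarith
    · have h3 : 0 ≤ (2 / (Q : ℝ)) ^ (c + 2) * (1 / (q j : ℝ) ^ (2 * (c + 2))) := by positivity
      by_cases hc : a j ≤ Q
      · rw [if_pos hc]
        have : 1 / (q j : ℝ) ^ (2 * (c + 2)) ≤ (2 / (Q : ℝ)) ^ (2 * (c + 2)) :=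
          inv_pow_le_of_le_two_mul _ hQ1 (by omega)
        have h2 := mul_le_mul_of_nonneg_left this
          (by positivity : (0 : ℝ) ≤ 1 / (a j : ℝ) ^ (c + 2))
        linarith
      · have hsplit : (a j : ℝ) ^ (3 * (c + 2)) = (a j : ℝ) ^ (c + 2) * (a j : ℝ) ^ (2 * (c + 2)) := by
          rw [← pow_add]; congr 1; ring
        rw [if_neg hc, if_pos (by omega), mul_zero, zero_add, one_div_mul_one_div, hsplit]
        have haq : (a j : ℝ) ≤ q j := by exact_mod_cast h
        have : 1 / ((a j : ℝ) ^ (c + 2) * (q j : ℝ) ^ (2 * (c + 2))) ≤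
          1 / ((a j : ℝ) ^ (c + 2) * (a j : ℝ) ^ (2 * (c + 2))) := by gcongr
        linarith
  refine (Finset.sum_le_sum hpt).trans ?_
  rw [Finset.sum_add_distrib, Finset.sum_add_distrib, ← Finset.mul_sum, ← Finset.mul_sum,
    ← Finset.sum_filter, ← Finset.sum_filter]
  have n1 := hq.sum_far_le (2 * (c + 2)) L (by omega) hL hLq
  have n2 := (ha.subset (Finset.filter_subset (fun j => a j ≤ Q) S)).sum_near_le
    (c + 2) Q (by omega) hQ1 (fun j hj => (Finset.mem_filter.1 hj).2)
  have n3 := (ha.subset (Finset.filter_subset (fun j => Q ≤ a j) S)).sum_far_le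
    (3 * (c + 2)) Q (by omega) hQ1 (fun j hj => (Finset.mem_filter.1 hj).2)
  rw [show 2 * (c + 2) - (c + 4) = c by omega] at n1
  rw [show c + 4 - (c + 2) = 2 by omega] at n2
  rw [show 3 * (c + 2) - (c + 4) = c + (c + 2) by omega] at n3
  have m1 := mul_le_mul_of_nonneg_left n1 (by positivity : (0 : ℝ) ≤ (2 / (Q : ℝ)) ^ (c + 2))
  have m2 := mul_le_mul_of_nonneg_left n2
    (by positivity : (0 : ℝ) ≤ (2 / (Q : ℝ)) ^ (2 * (c + 2)))
  have hD : (0 : ℝ) < (L : ℝ) ^ c * (Q : ℝ) ^ (c + 2) := by positivity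
  have e1 : (2 / (Q : ℝ)) ^ (c + 2) * (g * (1 + 2 * ((2 * (c + 2) : ℕ) : ℝ)) / (L : ℝ) ^ c) =
      g * (2 ^ (c + 2) * (1 + 2 * ((2 * (c + 2) : ℕ) : ℝ))) / ((L : ℝ) ^ c * (Q : ℝ) ^ (c + 2)) := by
    rw [div_pow]; field_simp
  have e2 : (2 / (Q : ℝ)) ^ (2 * (c + 2)) * (g * (1 + ((c + 2 : ℕ) : ℝ)) * (Q : ℝ) ^ 2) ≤
      g * (4 ^ (c + 2) * (1 + ((c + 2 : ℕ) : ℝ))) / ((L : ℝ) ^ c * (Q : ℝ) ^ (c + 2)) := by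
    have : (2 / (Q : ℝ)) ^ (2 * (c + 2)) * (g * (1 + ((c + 2 : ℕ) : ℝ)) * (Q : ℝ) ^ 2) =
      g * (4 ^ (c + 2) * (1 + ((c + 2 : ℕ) : ℝ))) / ((Q : ℝ) ^ c * (Q : ℝ) ^ (c + 2)) := by
      rw [pow_mul, div_pow, div_pow, show (2 : ℝ) ^ 2 = 4 by norm_num, ← pow_mul,
        show 2 * (c + 2) = c + (c + 2) + 2 by ring, pow_add, pow_add]
      field_simp
      ring
    rw [this]
    gcongr
  have e3 : g * (1 + 2 * ((3 * (c + 2) : ℕ) : ℝ)) / (Q : ℝ) ^ (c + (c + 2)) ≤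
      g * (1 + 2 * ((3 * (c + 2) : ℕ) : ℝ)) / ((L : ℝ) ^ c * (Q : ℝ) ^ (c + 2)) := by
    rw [pow_add]; gcongr
  rw [e1] at m1
  refine (add_le_add m1 (add_le_add (m2.trans e2) (n3.trans e3))).trans ?_
  rw [← add_div, ← add_div, ← mul_add, ← mul_add]
  gcongr
  have p1 : (2 : ℝ) ^ (c + 2) ≤ 4 ^ (c + 2) := by gcongr; norm_num
  have p2 : (1 : ℝ) ≤ 4 ^ (c + 2) := one_le_pow₀ (by norm_num)
  push_cast
  have hc0 : (0 : ℝ) ≤ c := Nat.cast_nonneg c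
  have hpow : (4 : ℝ) ^ (c + 4) = 16 * 4 ^ (c + 2) := by rw [pow_add, pow_add]; ring
  rw [hpow]
  nlinarith [mul_le_mul_of_nonneg_right p1 (by positivity : (0 : ℝ) ≤ 1 + 2 * (2 * ((c : ℝ) + 2))),
    mul_le_mul_of_nonneg_right p2 (by positivity : (0 : ℝ) ≤ 1 + 2 * (3 * ((c : ℝ) + 2))),
    mul_nonneg hc0 (zero_le_one.trans p2)]

end PowerSums


/-! ### The kernel, its sums over balls, and the triangle diagram. -/

section Geometry

variable {V : Type*}

/-- The geometry of the items: an adjacency relation `H` and a pseudo-metric `ρ` of polynomial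
growth, with respect to which adjacent items are close. -/
structure ItemGeometry (H : V → V → Prop) (ρ : V → V → ℕ) (d : ℕ) (g : ℝ) : Prop where
  adj_symm : ∀ ⦃a b⦄, H a b → H b a
  dist_self : ∀ a, ρ a a = 0
  dist_comm : ∀ a b, ρ a b = ρ b a
  dist_triangle : ∀ a b c, ρ a c ≤ ρ a b + ρ b c
  dist_le_of_adj : ∀ a b, H a b → ρ a b ≤ 2
  card_le : ∀ (a : V) (k : ℕ) (S : Finset V), (∀ b ∈ S, ρ a b ≤ k) →
    (S.card : ℝ) ≤ g * ((k : ℝ) + 1) ^ d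

/-- The power law `(1 + ρ) ^ (-(d - 2))`. -/
noncomputable def kernel (ρ : V → V → ℕ) (d : ℕ) (i j : V) : ℝ :=
  1 / ((ρ i j + 1 : ℕ) : ℝ) ^ (d - 2)

/-- The decay of the mean number of connections from `i` to the ball of radius `L` around `o`. -/
noncomputable def profile (ρ : V → V → ℕ) (d : ℕ) (o : V) (L : ℕ) (i : V) : ℝ :=
  ((L : ℝ) / ((L + ρ o i : ℕ) : ℝ)) ^ (d - 2)

variable {H : V → V → Prop} {ρ : V → V → ℕ} {d : ℕ} {g : ℝ}

lemma kernel_nonneg (i j : V) : 0 ≤ kernel ρ d i j := by unfold kernel; positivity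

lemma profile_le_one (o : V) (L : ℕ) (i : V) : profile ρ d o L i ≤ 1 := by
  unfold profile
  refine pow_le_one₀ (by positivity) (div_le_one_of_le₀ ?_ (by positivity))
  exact_mod_cast Nat.le_add_right _ _

lemma ItemGeometry.kernel_comm (hG : ItemGeometry H ρ d g) (i j : V) :
    kernel ρ d i j = kernel ρ d j i := by
  unfold kernel; rw [hG.dist_comm]

lemma ItemGeometry.growthLE (hG : ItemGeometry H ρ d g) (i : V) (S : Finset V) :
    GrowthLE S (fun j => ρ i j + 1) g d := by
  refine ⟨fun j _ => Nat.le_add_left _ _, fun k hk => ?_⟩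
  have h := hG.card_le i (k - 1) (S.filter fun j => ρ i j + 1 ≤ k) fun b hb => by
    have := (Finset.mem_filter.1 hb).2
    omega
  have hc : ((k - 1 : ℕ) : ℝ) + 1 = k := by rw [Nat.cast_sub hk]; simp
  rwa [hc] at h

lemma ItemGeometry.growthLE_shift (hG : ItemGeometry H ρ d g) (o : V) (S : Finset V) (L : ℕ)
    (hL : 1 ≤ L) : GrowthLE S (fun j => L + ρ o j) g d := by
  refine ⟨fun j _ => hL.trans (Nat.le_add_right _ _), fun k hk => ?_⟩
  have h := (hG.growthLE o S).2 k hk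
  refine le_trans ?_ h
  exact_mod_cast Finset.card_le_card fun j hj => by
    rw [Finset.mem_filter] at hj ⊢
    refine ⟨hj.1, ?_⟩
    have := hj.2
    dsimp only at this ⊢
    omega

lemma ItemGeometry.nonneg (hG : ItemGeometry H ρ d g) (o : V) : 0 ≤ g :=
  (hG.growthLE o ∅).nonneg

/-- Supplies the constant `Λ` of `moment_le`: a branching point costs L^2, and the profile
reproduces itself because its square is summable outside the ball. -/
lemma ItemGeometry.sum_kernel_profile_le (hG : ItemGeometry H ρ d g) (hd : 6 < d) (F : Finset V)
    (o : V) (L : ℕ) (hL : 1 ≤ L) (i : V) :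
    ∑ b ∈ F, kernel ρ d i b * profile ρ d o L b ^ 2 ≤
      g * (4 ^ d * (10 * d)) * (L : ℝ) ^ 2 * profile ρ d o L i := by
  have hL0 : (0 : ℝ) < L := by exact_mod_cast hL
  have h := sum_profile_le hd (hG.growthLE i F) (hG.growthLE_shift o F L hL) L (L + ρ o i) hL
    (by omega) (fun j _ => by omega) (fun j _ => by
      have := hG.dist_triangle o j i
      rw [hG.dist_comm j i] at this
      omega)
  have hq : (0 : ℝ) < ((L + ρ o i : ℕ) : ℝ) := by exact_mod_cast (by omega : 0 < L + ρ o i)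
  calc _ = (L : ℝ) ^ (2 * (d - 2)) * ∑ j ∈ F, 1 / ((ρ i j + 1 : ℕ) : ℝ) ^ (d - 2) *
        (1 / ((L + ρ o j : ℕ) : ℝ) ^ (2 * (d - 2))) := by
        rw [Finset.mul_sum]
        refine Finset.sum_congr rfl fun b _ => ?_
        rw [kernel, profile, ← pow_mul, div_pow, mul_comm (d - 2) 2]; ring
    _ ≤ _ := mul_le_mul_of_nonneg_left h (by positivity)
    _ = _ := by
        obtain ⟨c, rfl⟩ : ∃ c, d = c + 4 := ⟨d - 4, by omega⟩
        rw [show c + 4 - 2 = c + 2 by omega, show c + 4 - 4 = c by omega, profile,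
          show c + 4 - 2 = c + 2 by omega, div_pow, show 2 * (c + 2) = c + (c + 2) + 2 by ring,
          pow_add, pow_add]
        field_simp

/-- Supplies the constants `K` of `moment_le`: an end of a tree in a set of dimension d - 2 + a
costs L^a. -/
lemma ItemGeometry.sum_kernel_le (hG : ItemGeometry H ρ d g) (hd : 6 < d) (S : Finset V) (a : ℕ)
    (ha : 1 ≤ a) (gS : ℝ) (o : V) (L : ℕ) (hL : 1 ≤ L) (hball : ∀ x ∈ S, ρ o x ≤ L)
    (hS : ∀ i, GrowthLE S (fun j => ρ i j + 1) gS (d - 2 + a)) (i : V) :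
    ∑ x ∈ S, kernel ρ d i x ≤
      gS * (4 ^ d * (d * 5 ^ a + 2 ^ a)) * (L : ℝ) ^ a * profile ρ d o L i := by
  have hL0 : (0 : ℝ) < L := by exact_mod_cast hL
  have hg := (hS o).nonneg
  have hq : (0 : ℝ) < ((L + ρ o i : ℕ) : ℝ) := by exact_mod_cast (by omega : 0 < L + ρ o i)
  obtain ⟨e, rfl⟩ : ∃ e, d = e + 2 := ⟨d - 2, by omega⟩
  rw [profile]
  simp only [kernel]
  rw [show e + 2 - 2 = e by omega] at *
  -- Up to distance 3L from `o` the profile is bounded below, and `S` lies within 5L of `i`. Beyond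
  -- that, every item of `S` is about as far from `i` as `o` is.
  by_cases hc : L + ρ o i ≤ 4 * L
  · have h := (hS i).sum_near_le e (5 * L) (by omega) (by omega) fun x hx => by
      have h1 := hball x hx
      have h2 := hG.dist_triangle i o x
      have h3 := hG.dist_comm i o
      change ρ i x + 1 ≤ 5 * L
      omega
    rw [show e + a - e = a by omega] at h
    refine h.trans ?_
    have hp : 1 / (4 : ℝ) ^ e ≤ ((L : ℝ) / ((L + ρ o i : ℕ) : ℝ)) ^ e := by
      rw [← one_div_pow]
      refine pow_le_pow_left₀ (by norm_num) ?_ e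
      rw [div_le_div_iff₀ (by norm_num) hq]
      have : ((L + ρ o i : ℕ) : ℝ) ≤ 4 * L := by exact_mod_cast hc
      linarith
    have hmain : gS * (1 + (e : ℝ)) * ((5 * L : ℕ) : ℝ) ^ a ≤
        gS * (4 ^ (e + 2) * ((e + 2 : ℕ) * 5 ^ a + 2 ^ a)) * (L : ℝ) ^ a * (1 / (4 : ℝ) ^ e) := by
      have : gS * (4 ^ (e + 2) * ((e + 2 : ℕ) * 5 ^ a + 2 ^ a)) * (L : ℝ) ^ a * (1 / (4 : ℝ) ^ e) =
          gS * (16 * ((e + 2 : ℕ) * 5 ^ a + 2 ^ a)) * (L : ℝ) ^ a := by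
        rw [pow_add]; field_simp; ring
      rw [this]
      push_cast
      rw [mul_pow]
      have h5 : (0 : ℝ) < 5 ^ a := by positivity
      have h2 : (0 : ℝ) < 2 ^ a := by positivity
      have he : (0 : ℝ) ≤ e := Nat.cast_nonneg e
      have hx : (1 + (e : ℝ)) * 5 ^ a ≤ 16 * (((e : ℝ) + 2) * 5 ^ a + 2 ^ a) := by nlinarith
      calc gS * (1 + (e : ℝ)) * (5 ^ a * (L : ℝ) ^ a) = gS * ((1 + (e : ℝ)) * 5 ^ a) * (L : ℝ) ^ a := by
            ring
        _ ≤ _ := by gcongr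
    refine hmain.trans ?_
    gcongr
  · have hterm : ∀ x ∈ S, 1 / ((ρ i x + 1 : ℕ) : ℝ) ^ e ≤ (2 / ((L + ρ o i : ℕ) : ℝ)) ^ e := by
      intro x hx
      refine inv_pow_le_of_le_two_mul e (by omega) ?_
      have h1 := hball x hx
      have h2 := hG.dist_triangle o x i
      have h3 := hG.dist_comm x i
      omega
    have hcard : (S.card : ℝ) ≤ gS * (2 * (L : ℝ)) ^ (e + a) := by
      have := (hS o).2 (L + 1) (by omega)
      rw [Finset.filter_true_of_mem fun x hx => Nat.succ_le_succ (hball x hx)] at this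
      refine this.trans ?_
      have h1 : (1 : ℝ) ≤ L := by exact_mod_cast hL
      push_cast
      gcongr
      linarith
    calc _ ≤ ∑ x ∈ S, (2 / ((L + ρ o i : ℕ) : ℝ)) ^ e := Finset.sum_le_sum hterm
      _ = S.card * (2 / ((L + ρ o i : ℕ) : ℝ)) ^ e := by rw [Finset.sum_const, nsmul_eq_mul]
      _ ≤ gS * (2 * (L : ℝ)) ^ (e + a) * (2 / ((L + ρ o i : ℕ) : ℝ)) ^ e := by gcongr
      _ = gS * (4 ^ e * 2 ^ a) * (L : ℝ) ^ a * ((L : ℝ) / ((L + ρ o i : ℕ) : ℝ)) ^ e := by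
          rw [mul_pow, div_pow, div_pow, pow_add, pow_add, show (4 : ℝ) = 2 * 2 by norm_num,
            mul_pow]
          ring
      _ ≤ _ := by
          gcongr
          · norm_num
          · omega
          · have : (0 : ℝ) ≤ ((e + 2 : ℕ) : ℝ) * 5 ^ a := by positivity
            linarith

lemma ItemGeometry.kernel_le_of_near (hG : ItemGeometry H ρ d g) {a a' : V} (h : ρ a a' ≤ 2)
    (b : V) : kernel ρ d b a' ≤ 3 ^ (d - 2) * kernel ρ d b a := by
  unfold kernel
  have h1 : ρ b a + 1 ≤ 3 * (ρ b a' + 1) := by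
    have := hG.dist_triangle b a' a
    have := hG.dist_comm a a'
    omega
  have h2 : ((ρ b a + 1 : ℕ) : ℝ) ≤ 3 * ((ρ b a' + 1 : ℕ) : ℝ) := by exact_mod_cast h1
  have h3 : (0 : ℝ) < ((ρ b a + 1 : ℕ) : ℝ) := by positivity
  have h4 : (0 : ℝ) < ((ρ b a' + 1 : ℕ) : ℝ) := by positivity
  rw [mul_one_div, div_le_div_iff₀ (by positivity) (by positivity), one_mul, ← mul_pow]
  exact pow_le_pow_left₀ h3.le h2 _

/-- The constant in the bound for the open triangle diagram. -/
noncomputable def triangleConst (d : ℕ) : ℝ := (4 ^ d * (10 * d)) ^ 2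

/-- The open triangle diagram vanishes at large distances. -/
lemma ItemGeometry.triangle_le (hG : ItemGeometry H ρ d g) (hd : 6 < d) (F : Finset V) (u v : V) :
    ∑ a ∈ F, ∑ b ∈ F, kernel ρ d u b * kernel ρ d b a * kernel ρ d a v ≤
      g ^ 2 * triangleConst d / ((ρ u v + 1 : ℕ) : ℝ) := by
  have hg := hG.nonneg u
  obtain ⟨c, rfl⟩ : ∃ c, d = c + 6 := ⟨d - 6, by omega⟩
  simp only [kernel, triangleConst]
  rw [show c + 6 - 2 = c + 4 by omega]
  have hconst : ∀ α β : ℕ, α ≤ c + 4 → β ≤ c + 4 →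
      (2 : ℝ) ^ β * (1 + α) + 2 ^ α * (1 + β) + 2 * (1 + 2 * (α + β)) ≤
        4 ^ (c + 6) * (10 * ((c + 6 : ℕ) : ℝ)) := by
    intro α β h1 h2
    have h1' : (α : ℝ) ≤ c + 4 := by exact_mod_cast h1
    have h2' : (β : ℝ) ≤ c + 4 := by exact_mod_cast h2
    have hc : (0 : ℝ) ≤ c := Nat.cast_nonneg c
    have hp : (1 : ℝ) ≤ 2 ^ (c + 4) := one_le_pow₀ (by norm_num)
    have h3 : (2 : ℝ) ^ β ≤ 2 ^ (c + 4) := pow_le_pow_right₀ (by norm_num) h2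
    have h4 : (2 : ℝ) ^ α ≤ 2 ^ (c + 4) := pow_le_pow_right₀ (by norm_num) h1
    have h5 : (2 : ℝ) ^ (c + 4) ≤ 4 ^ (c + 6) :=
      (pow_le_pow_left₀ (by norm_num) (by norm_num) _).trans
        (pow_le_pow_right₀ (by norm_num) (by omega))
    push_cast
    calc _ ≤ (2 : ℝ) ^ (c + 4) * (1 + (c + 4)) + 2 ^ (c + 4) * (1 + (c + 4)) +
          2 ^ (c + 4) * (2 * (1 + 2 * ((c + 4) + (c + 4)))) := by
          refine add_le_add (add_le_add ?_ ?_) ?_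
          · gcongr
          · gcongr
          · nlinarith
      _ = 2 ^ (c + 4) * (10 * c + 44) := by ring
      _ ≤ 4 ^ (c + 6) * (10 * c + 44) := by gcongr
      _ ≤ _ := by gcongr; linarith
  set K : ℝ := 4 ^ (c + 6) * (10 * ((c + 6 : ℕ) : ℝ)) with hK
  have hK0 : 0 ≤ K := by positivity
  -- Two kernels of exponent d - 2 convolve to the exponent d - 4; the third one leaves d - 6, which
  -- is positive exactly because d > 6.
  have inner : ∀ a, ∑ b ∈ F, 1 / ((ρ u b + 1 : ℕ) : ℝ) ^ (c + 4) * (1 / ((ρ b a + 1 : ℕ) : ℝ) ^ (c + 4)) ≤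
      g * K * (1 / ((ρ u a + 1 : ℕ) : ℝ) ^ (c + 2)) := by
    intro a
    have h := sum_convolution_le (hG.growthLE u F) (hG.growthLE a F) (c + 4) (c + 4) (by omega)
      (by omega) (by omega) (ρ u a + 1) (by omega) fun j _ => by
        have := hG.dist_triangle u j a
        have := hG.dist_comm j a
        omega
    rw [show c + 4 + (c + 4) - (c + 6) = c + 2 by omega] at h
    simp only [hG.dist_comm _ a] at h ⊢
    refine h.trans ?_
    rw [mul_one_div]
    gcongr
    exact hconst _ _ le_rfl le_rfl
  calc _ = ∑ a ∈ F, (∑ b ∈ F, 1 / ((ρ u b + 1 : ℕ) : ℝ) ^ (c + 4) *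
        (1 / ((ρ b a + 1 : ℕ) : ℝ) ^ (c + 4))) * (1 / ((ρ a v + 1 : ℕ) : ℝ) ^ (c + 4)) := by
        simp only [Finset.sum_mul]
    _ ≤ ∑ a ∈ F, g * K * (1 / ((ρ u a + 1 : ℕ) : ℝ) ^ (c + 2)) *
        (1 / ((ρ a v + 1 : ℕ) : ℝ) ^ (c + 4)) := by
        refine Finset.sum_le_sum fun a _ => ?_
        have := inner a
        gcongr
    _ = g * K * ∑ a ∈ F, 1 / ((ρ u a + 1 : ℕ) : ℝ) ^ (c + 2) *
        (1 / ((ρ v a + 1 : ℕ) : ℝ) ^ (c + 4)) := by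
        rw [Finset.mul_sum]
        exact Finset.sum_congr rfl fun a _ => by rw [hG.dist_comm a v]; ring
    _ ≤ g * K * (g * K / ((ρ u v + 1 : ℕ) : ℝ)) := by
        have h := sum_convolution_le (hG.growthLE u F) (hG.growthLE v F) (c + 2) (c + 4) (by omega)
          (by omega) (by omega) (ρ u v + 1) (by omega) fun j _ => by
            have := hG.dist_triangle u j v
            have := hG.dist_comm j v
            omega
        gcongr
        refine h.trans ?_
        have hn : (0 : ℝ) < ((ρ u v + 1 : ℕ) : ℝ) := by positivity
        have hn1 : (1 : ℝ) ≤ ((ρ u v + 1 : ℕ) : ℝ) := by exact_mod_cast Nat.le_add_left _ _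
        -- The exponent is c = d - 6 ≥ 1, of which only the first power is kept.
        have hle : ((ρ u v + 1 : ℕ) : ℝ) ≤ ((ρ u v + 1 : ℕ) : ℝ) ^ (c + 2 + (c + 4) - (c + 6)) :=
          le_self_pow₀ hn1 (by omega)
        gcongr
        exact hconst _ _ (by omega) le_rfl
    _ = _ := by ring

end Geometry


/-! ### Exploring clusters; three connections in distinct clusters. -/

section Exploration

variable {V : Type*} [DecidableEq V] {H : V → V → Prop} {p : ℝ} {F : Finset V}

/-- Replacing a configuration by an independent copy outside of an explored set does not change
the law. -/
lemma EF_exploration (X : Finset V → Finset V)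
    (hX : ∀ ω ⊆ F, ∀ ω' ⊆ F, ω' ∩ X ω = ω ∩ X ω → X ω' = X ω) (f : Finset V → ℝ) :
    EF p F f = EF p F fun ω₁ => EF p F fun ω₂ => f ((ω₁ ∩ X ω₁) ∪ (ω₂ \ X ω₁)) := by
  have h1 : EF p F f = EF p F fun ω₁ => EF p F fun _ => f ω₁ := by simp only [EF_const]
  rw [h1]
  have hexp : ∀ h : Finset V → Finset V → ℝ, (EF p F fun ω₁ => EF p F fun ω₂ => h ω₁ ω₂) =
      ∑ x ∈ F.powerset ×ˢ F.powerset, weight p F x.1 * weight p F x.2 * h x.1 x.2 := by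
    intro h
    rw [Finset.sum_product]
    simp only [EF, Finset.mul_sum, mul_assoc]
  rw [hexp, hexp]
  -- The two copies are exchanged off the explored set. This set is determined by what it reveals,
  -- so `Ψ` is an involution; it keeps the total number of open items, hence the product weight.
  let Ψ : Finset V × Finset V → Finset V × Finset V := fun x =>
    ((x.1 ∩ X x.1) ∪ (x.2 \ X x.1), (x.2 ∩ X x.1) ∪ (x.1 \ X x.1))
  have hmem : ∀ x ∈ F.powerset ×ˢ F.powerset, Ψ x ∈ F.powerset ×ˢ F.powerset := by
    intro x hx
    simp only [Finset.mem_product, Finset.mem_powerset] at hx ⊢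
    exact ⟨Finset.union_subset (Finset.inter_subset_left.trans hx.1)
      (Finset.sdiff_subset.trans hx.2), Finset.union_subset (Finset.inter_subset_left.trans hx.2)
      (Finset.sdiff_subset.trans hx.1)⟩
  have hX' : ∀ x ∈ F.powerset ×ˢ F.powerset, X (Ψ x).1 = X x.1 := by
    intro x hx
    have hm := hmem x hx
    simp only [Finset.mem_product, Finset.mem_powerset] at hx hm
    refine hX _ hx.1 _ hm.1 ?_
    ext y; simp only [Ψ, Finset.mem_inter, Finset.mem_union, Finset.mem_sdiff]; tauto
  have hinv : ∀ x ∈ F.powerset ×ˢ F.powerset, Ψ (Ψ x) = x := by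
    intro x hx
    have h := hX' x hx
    refine Prod.ext ?_ ?_
    · ext y
      change y ∈ ((Ψ x).1 ∩ X (Ψ x).1) ∪ ((Ψ x).2 \ X (Ψ x).1) ↔ y ∈ x.1
      rw [h]
      simp only [Ψ, Finset.mem_inter, Finset.mem_union, Finset.mem_sdiff]; tauto
    · ext y
      change y ∈ ((Ψ x).2 ∩ X (Ψ x).1) ∪ ((Ψ x).1 \ X (Ψ x).1) ↔ y ∈ x.2
      rw [h]
      simp only [Ψ, Finset.mem_inter, Finset.mem_union, Finset.mem_sdiff]; tauto
  have hw : ∀ x ∈ F.powerset ×ˢ F.powerset,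
      weight p F (Ψ x).1 * weight p F (Ψ x).2 = weight p F x.1 * weight p F x.2 := by
    intro x hx
    have hm := hmem x hx
    simp only [Finset.mem_product, Finset.mem_powerset] at hx hm
    have hcard : ∀ S T X : Finset V, ((S ∩ X) ∪ (T \ X)).card = (S ∩ X).card + (T \ X).card :=
      fun S T X => Finset.card_union_of_disjoint (by
        rw [Finset.disjoint_left]; intro y; simp; tauto)
    have c1 := Finset.card_inter_add_card_sdiff x.1 (X x.1)
    have c2 := Finset.card_inter_add_card_sdiff x.2 (X x.1)
    have c3 : (Ψ x).1.card = _ := hcard x.1 x.2 (X x.1)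
    have c4 : (Ψ x).2.card = _ := hcard x.2 x.1 (X x.1)
    have e1 := Finset.card_le_card hx.1
    have e2 := Finset.card_le_card hx.2
    have e3 := Finset.card_le_card hm.1
    have e4 := Finset.card_le_card hm.2
    have key : ∀ S T : Finset V, S ⊆ F → T ⊆ F → weight p F S * weight p F T =
        p ^ (S.card + T.card) * (1 - p) ^ (F.card - S.card + (F.card - T.card)) := by
      intro S T hS hT
      rw [weight, weight, Finset.card_sdiff_of_subset hS, Finset.card_sdiff_of_subset hT, pow_add,
        pow_add]; ring
    rw [key _ _ hm.1 hm.2, key _ _ hx.1 hx.2]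
    congr 2 <;> omega
  symm
  refine Finset.sum_bij' (fun x _ => Ψ x) (fun x _ => Ψ x) hmem hmem hinv hinv ?_
  intro x hx
  rw [hw x hx]

open Classical in
/-- The items which are explored together with the cluster of `u`: the cluster, its neighbours,
and `u` itself. -/
noncomputable def explored (H : V → V → Prop) (F : Finset V) (ω : Set V) (u : V) : Finset V :=
  F.filter fun a => a = u ∨ ∃ b, (b = a ∨ H b a) ∧ Conn H ω u b

lemma mem_explored {ω : Set V} {u a : V} : a ∈ explored H F ω u ↔
    a ∈ F ∧ (a = u ∨ ∃ b, (b = a ∨ H b a) ∧ Conn H ω u b) := by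
  classical
  simp [explored]

lemma explored_mono {ω ω' : Set V} (h : ω ⊆ ω') (u : V) :
    explored H F ω u ⊆ explored H F ω' u := by
  intro a ha
  rw [mem_explored] at ha ⊢
  exact ⟨ha.1, ha.2.imp id fun ⟨b, hb, hc⟩ => ⟨b, hb, hc.mono h⟩⟩

/-- The hypothesis of `EF_exploration`: the neighbours of the cluster are explored too, so its outer
boundary is revealed as closed. The item `u` is included for the case that it is closed and its
cluster is empty. -/
lemma explored_eq {ω ω' : Finset V} (hω : ω ⊆ F) (hω' : ω' ⊆ F) (u : V)
    (h : ω' ∩ explored H F ↑ω u = ω ∩ explored H F ↑ω u) :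
    explored H F ↑ω' u = explored H F ↑ω u := by
  have hiff : ∀ a, a ∈ explored H F ↑ω u → (a ∈ ω' ↔ a ∈ ω) := by
    intro a ha
    have := Finset.ext_iff.1 h a
    simpa [ha] using this
  have h1 : ∀ b, Conn H (ω : Set V) u b → Conn H (ω' : Set V) u b := by
    intro b hb
    refine hb.within_of_subset fun a ha => ?_
    have haω : a ∈ ω := by simpa using ha.right_mem
    exact Finset.mem_coe.2 ((hiff a (mem_explored.2 ⟨hω haω, Or.inr ⟨a, Or.inl rfl, ha⟩⟩)).2 haω)
  have h2 : ∀ b, Conn H (ω' : Set V) u b → Conn H (ω : Set V) u b := by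
    intro b hb
    refine hb.induction (.refl ?_) ?_
    · have hu : u ∈ ω' := by simpa using hb.left_mem
      exact Finset.mem_coe.2 ((hiff u (mem_explored.2 ⟨hω' hu, Or.inl rfl⟩)).1 hu)
    · intro a b _ ha hab hbω
      have hb' : b ∈ ω' := by simpa using hbω
      exact ha.tail hab (Finset.mem_coe.2 ((hiff b (mem_explored.2
        ⟨hω' hb', Or.inr ⟨a, Or.inr hab, ha⟩⟩)).1 hb'))
  ext a
  rw [mem_explored, mem_explored]
  refine and_congr_right fun _ => or_congr Iff.rfl (exists_congr fun b => and_congr_right fun _ =>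
    ⟨h2 b, h1 b⟩)

/-- The items `u`, `v`, `w` are connected to `x`, `y`, `z`, respectively, in distinct clusters. -/
def Separated (H : V → V → Prop) (ω : Set V) (u v w x y z : V) : Prop :=
  (Conn H ω u x ∧ Conn H ω v y ∧ Conn H ω w z) ∧
    ¬ Conn H ω u v ∧ ¬ Conn H ω u w ∧ ¬ Conn H ω v w

/-- A connection from `v` to `y` which splits at `a`. -/
def Via (H : V → V → Prop) (a v y : V) (ω : Finset V) : Prop :=
  ∃ S ⊆ ω, ∃ T ⊆ ω, S ∩ T = {a} ∧ Conn H (S : Set V) v a ∧ Conn H (T : Set V) a y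

/-- The bound for the probability that a connection from `v` to `y` meets the cluster of `u`. -/
noncomputable def meetBound (H : V → V → Prop) (p : ℝ) (F : Finset V) (u x v y : V) : ℝ :=
  ∑ a ∈ F, (PF p F fun ω => Conn H (ω : Set V) u x ∧ a ∈ explored H F ↑ω u) *
    PF p F (Via H a v y)

/-- The composite configuration takes the explored cluster of `u` from `ω₁`, that of `v` off `X₁`
from `ω₂`, and the rest from `ω₃`. Explored items which are open belong to the explored cluster, so
the clusters of `u` and `v` in the composite cannot grow beyond those found in the copies. -/
lemma separated_of_copies (hH : ∀ ⦃a b⦄, H a b → H b a) {ω₁ ω₂ ω₃ : Finset V} (h₁ : ω₁ ⊆ F)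
    (h₂ : ω₂ ⊆ F) (h₃ : ω₃ ⊆ F) {u v w x y z : V} {X₁ X₂ : Finset V}
    (hX₁ : X₁ = explored H F ↑ω₁ u) (hX₂ : X₂ = explored H F ↑(ω₂ \ X₁) v)
    (hux : Conn H (ω₁ : Set V) u x) (hvy : Conn H (↑(ω₂ \ X₁) : Set V) v y)
    (hwz : Conn H (↑(ω₃ \ (X₁ ∪ X₂)) : Set V) w z) :
    Separated H ↑((ω₁ ∩ X₁) ∪ (((ω₂ ∩ X₂) ∪ (ω₃ \ X₂)) \ X₁)) u v w x y z := by
  set ω := (ω₁ ∩ X₁) ∪ (((ω₂ ∩ X₂) ∪ (ω₃ \ X₂)) \ X₁) with hω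
  have hωmem : ∀ a, a ∈ ω ↔ (a ∈ ω₁ ∧ a ∈ X₁) ∨
      (((a ∈ ω₂ ∧ a ∈ X₂) ∨ (a ∈ ω₃ ∧ a ∉ X₂)) ∧ a ∉ X₁) := by
    intro a; simp only [hω, Finset.mem_union, Finset.mem_inter, Finset.mem_sdiff]
  have hωF : ∀ a ∈ ω, a ∈ F := by
    intro a ha
    rcases (hωmem a).1 ha with h | ⟨h | h, -⟩
    exacts [h₁ h.1, h₂ h.1, h₃ h.1]
  have hv : v ∈ ω₂ ∧ v ∉ X₁ := by simpa using hvy.left_mem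
  have hw : w ∈ ω₃ ∧ w ∉ X₁ ∧ w ∉ X₂ := by simpa using hwz.left_mem
  have hclX₁ : ∀ a, Conn H (ω₁ : Set V) u a → a ∈ X₁ := fun a ha => by
    rw [hX₁, mem_explored]
    exact ⟨h₁ (by simpa using ha.right_mem), Or.inr ⟨a, Or.inl rfl, ha⟩⟩
  have hclX₂ : ∀ a, Conn H (↑(ω₂ \ X₁) : Set V) v a → a ∈ X₂ := fun a ha => by
    have : a ∈ ω₂ ∧ a ∉ X₁ := by simpa using ha.right_mem
    rw [hX₂, mem_explored]
    exact ⟨h₂ this.1, Or.inr ⟨a, Or.inl rfl, ha⟩⟩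
  -- an open item of `X₁` belongs to the cluster of `u`
  have hX₁cl : ∀ a ∈ ω₁, a ∈ X₁ → Conn H (ω₁ : Set V) u a := by
    intro a ha haX
    rw [hX₁, mem_explored] at haX
    rcases haX.2 with rfl | ⟨b, rfl | hba, hb⟩
    · exact .refl (by simpa using ha)
    · exact hb
    · exact hb.tail hba (by simpa using ha)
  have hu' : ∀ b, Conn H (ω : Set V) u b → Conn H (ω₁ : Set V) u b := by
    intro b hb
    refine hb.induction (.refl hux.left_mem) ?_
    intro a b _ ha hab hbω
    have hbω : b ∈ ω := by simpa using hbω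
    have hbX : b ∈ X₁ := by
      rw [hX₁, mem_explored]; exact ⟨hωF b hbω, Or.inr ⟨a, Or.inr hab, ha⟩⟩
    rcases (hωmem b).1 hbω with h | h
    · exact ha.tail hab (by simpa using h.1)
    · exact absurd hbX h.2
  have hv' : ∀ b, Conn H (ω : Set V) v b → Conn H (↑(ω₂ \ X₁) : Set V) v b := by
    intro b hb
    refine hb.induction (.refl hvy.left_mem) ?_
    intro a b _ ha hab hbω
    have hbω : b ∈ ω := by simpa using hbω
    have haX₁ : a ∉ X₁ := by
      have : a ∈ ω₂ ∧ a ∉ X₁ := by simpa using ha.right_mem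
      exact this.2
    rcases (hωmem b).1 hbω with h | ⟨h, hbX₁⟩
    · refine absurd ?_ haX₁
      have haF : a ∈ F := by
        have : a ∈ ω₂ ∧ a ∉ X₁ := by simpa using ha.right_mem
        exact h₂ this.1
      rw [hX₁, mem_explored]
      exact ⟨haF, Or.inr ⟨b, Or.inr (hH hab), hX₁cl b h.1 h.2⟩⟩
    · have hbX₂ : b ∈ X₂ := by
        rw [hX₂, mem_explored]; exact ⟨hωF b hbω, Or.inr ⟨a, Or.inr hab, ha⟩⟩
      refine ha.tail hab ?_
      rcases h with h | h
      · simpa using ⟨h.1, hbX₁⟩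
      · exact absurd hbX₂ h.2
  refine ⟨⟨?_, ?_, ?_⟩, ?_, ?_, ?_⟩
  · refine hux.within_of_subset fun a ha => ?_
    exact Finset.mem_coe.2 ((hωmem a).2 (Or.inl ⟨by simpa using ha.right_mem, hclX₁ a ha⟩))
  · refine hvy.within_of_subset fun a ha => ?_
    have : a ∈ ω₂ ∧ a ∉ X₁ := by simpa using ha.right_mem
    exact Finset.mem_coe.2 ((hωmem a).2 (Or.inr ⟨Or.inl ⟨this.1, hclX₂ a ha⟩, this.2⟩))
  · refine hwz.mono fun a ha => ?_
    have : a ∈ ω₃ ∧ a ∉ X₁ ∧ a ∉ X₂ := by simpa using ha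
    exact Finset.mem_coe.2 ((hωmem a).2 (Or.inr ⟨Or.inr ⟨this.1, this.2.2⟩, this.2.1⟩))
  · exact fun h => hv.2 (hclX₁ v (hu' v h))
  · exact fun h => hw.2.1 (hclX₁ w (hu' w h))
  · exact fun h => hw.2.2 (hclX₂ w (hv' w h))

/-- The lower bound for three connections in distinct clusters. -/
lemma separated_ge (hH : ∀ ⦃a b⦄, H a b → H b a) (hp0 : 0 ≤ p) (hp1 : p ≤ 1) (F : Finset V)
    (u v w x y z : V) :
    tau H p F u x * (tau H p F v y * tau H p F w z) ≤
      PF p F (fun ω => Separated H ↑ω u v w x y z) +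
      (meetBound H p F u x v y * tau H p F w z + (meetBound H p F u x w z * tau H p F v y +
        tau H p F u x * meetBound H p F v y w z)) := by
  let A₁ : Finset V → ℝ := fun ω => ind (Conn H (ω : Set V) u x)
  let A₂ : Finset V → ℝ := fun ω => ind (Conn H (ω : Set V) v y)
  let A₃ : Finset V → ℝ := fun ω => ind (Conn H (ω : Set V) w z)
  let X₁ : Finset V → Finset V := fun ω => explored H F ↑ω u
  let X₂ : Finset V → Finset V → Finset V := fun ω₁ ω₂ => explored H F ↑(ω₂ \ X₁ ω₁) v
  let M : V → V → V → Finset V → ℝ := fun a u x ω =>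
    ind (Conn H (ω : Set V) u x ∧ a ∈ explored H F ↑ω u)
  let W : V → V → V → Finset V → ℝ := fun a v y ω => ind (Via H a v y ω)
  -- Two successive explorations replace one configuration by the composite of three independent
  -- copies.
  have hsep : PF p F (fun ω => Separated H ↑ω u v w x y z) =
      EF p F fun ω₁ => EF p F fun ω₂ => EF p F fun ω₃ =>
        ind (Separated H ↑((ω₁ ∩ X₁ ω₁) ∪
          (((ω₂ ∩ X₂ ω₁ ω₂) ∪ (ω₃ \ X₂ ω₁ ω₂)) \ X₁ ω₁)) u v w x y z) := by
    rw [PF, EF_exploration X₁ fun ω hω ω' hω' h => explored_eq hω hω' u h]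
    refine EF_congr fun ω₁ _ => ?_
    rw [EF_exploration (X₂ ω₁)]
    intro ω hω ω' hω' h
    refine explored_eq (Finset.sdiff_subset.trans hω) (Finset.sdiff_subset.trans hω') v ?_
    ext a
    have := Finset.ext_iff.1 h a
    simp only [Finset.mem_inter, Finset.mem_sdiff, X₂] at this ⊢
    tauto
  -- If the three connections exist in their own copies, then either the composite is separated or a
  -- later connection is broken by an earlier explored set, and then it splits at an item of that
  -- set.
  have hpt : ∀ ω₁ ⊆ F, ∀ ω₂ ⊆ F, ∀ ω₃ ⊆ F, A₁ ω₁ * (A₂ ω₂ * A₃ ω₃) ≤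
      ind (Separated H ↑((ω₁ ∩ X₁ ω₁) ∪
          (((ω₂ ∩ X₂ ω₁ ω₂) ∪ (ω₃ \ X₂ ω₁ ω₂)) \ X₁ ω₁)) u v w x y z) +
      ((∑ a ∈ F, M a u x ω₁ * W a v y ω₂) * A₃ ω₃ +
        ((∑ a ∈ F, M a u x ω₁ * W a w z ω₃) * A₂ ω₂ +
          A₁ ω₁ * ∑ a ∈ F, M a v y ω₂ * W a w z ω₃)) := by
    intro ω₁ h₁ ω₂ h₂ ω₃ h₃
    have hnn : ∀ (u x v y : V) (ω ω' : Finset V), 0 ≤ ∑ a ∈ F, M a u x ω * W a v y ω' :=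
      fun u x v y ω ω' => Finset.sum_nonneg fun a _ => mul_nonneg (ind_nonneg _) (ind_nonneg _)
    have hone : ∀ (u x v y : V) (ω ω' : Finset V), Conn H (ω : Set V) u x → ∀ a,
        a ∈ explored H F ↑ω u → Via H a v y ω' → 1 ≤ ∑ a ∈ F, M a u x ω * W a v y ω' := by
      intro u x v y ω ω' hux a ha hvia
      have haF : a ∈ F := (mem_explored.1 ha).1
      refine le_trans (le_of_eq ?_) (Finset.single_le_sum
        (f := fun a => M a u x ω * W a v y ω')
        (fun a _ => mul_nonneg (ind_nonneg _) (ind_nonneg _)) haF)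
      simp only [M, W]
      rw [ind_of_true ⟨hux, ha⟩, ind_of_true hvia, one_mul]
    have n1 := hnn u x v y ω₁ ω₂
    have n2 := hnn u x w z ω₁ ω₃
    have n3 := hnn v y w z ω₂ ω₃
    have a1 : 0 ≤ A₁ ω₁ := ind_nonneg _
    have a2 : 0 ≤ A₂ ω₂ := ind_nonneg _
    have a3 : 0 ≤ A₃ ω₃ := ind_nonneg _
    have m1 := mul_nonneg n1 a3
    have m2 := mul_nonneg n2 a2
    have m3 := mul_nonneg a1 n3
    have m0 := ind_nonneg (Separated H ↑((ω₁ ∩ X₁ ω₁) ∪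
      (((ω₂ ∩ X₂ ω₁ ω₂) ∪ (ω₃ \ X₂ ω₁ ω₂)) \ X₁ ω₁)) u v w x y z)
    by_cases hux : Conn H (ω₁ : Set V) u x
    swap
    · have : A₁ ω₁ = 0 := ind_of_false hux
      rw [this, zero_mul]; rw [this] at m3; linarith
    by_cases hvy : Conn H (ω₂ : Set V) v y
    swap
    · have : A₂ ω₂ = 0 := ind_of_false hvy
      rw [this, zero_mul, mul_zero]; rw [this] at m2; linarith
    by_cases hwz : Conn H (ω₃ : Set V) w z
    swap
    · have : A₃ ω₃ = 0 := ind_of_false hwz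
      rw [this, mul_zero, mul_zero]; rw [this] at m1; linarith
    have e1 : A₁ ω₁ = 1 := ind_of_true hux
    have e2 : A₂ ω₂ = 1 := ind_of_true hvy
    have e3 : A₃ ω₃ = 1 := ind_of_true hwz
    rw [e1, e2, e3]
    simp only [mul_one, one_mul]
    by_cases hvy' : Conn H (↑(ω₂ \ X₁ ω₁) : Set V) v y
    swap
    · obtain ⟨a, ha, S, hS, T, hT, h⟩ := hvy.exists_split hH hvy'
      have := hone u x v y ω₁ ω₂ hux a ha ⟨S, hS, T, hT, h⟩
      linarith
    by_cases hwz' : Conn H (↑(ω₃ \ (X₁ ω₁ ∪ X₂ ω₁ ω₂)) : Set V) w z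
    swap
    · obtain ⟨a, ha, S, hS, T, hT, h⟩ := hwz.exists_split hH hwz'
      rcases Finset.mem_union.1 ha with ha | ha
      · have := hone u x w z ω₁ ω₃ hux a ha ⟨S, hS, T, hT, h⟩
        linarith
      -- The exploration off `X₁` reveals no more than the exploration in all of `ω₂`, so the
      -- dependence on `ω₁` may be dropped.
      · have := hone v y w z ω₂ ω₃ hvy a
          (explored_mono (by simp) v ha) ⟨S, hS, T, hT, h⟩
        linarith
    rw [ind_of_true (separated_of_copies hH h₁ h₂ h₃ rfl rfl hux hvy' hwz')]
    linarith
  have hint := EF_mono hp0 hp1 (F := F) fun ω₁ h₁ => EF_mono hp0 hp1 (F := F) fun ω₂ h₂ =>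
    EF_mono hp0 hp1 (F := F) fun ω₃ h₃ => hpt ω₁ h₁ ω₂ h₂ ω₃ h₃
  simp only [EF_add, EF_mul_left, EF_mul_right, EF_sum] at hint
  rw [← hsep] at hint
  exact hint

end Exploration


/-! ### Diagrams for a connection which meets another cluster. -/

section MeetBound

variable {V : Type*} [DecidableEq V] {H : V → V → Prop} {ρ : V → V → ℕ} {d : ℕ} {g p C : ℝ}

/-- The tree-graph inequality for two targets; its two ordered splits give the factor 2. -/
lemma PF_conn_two_le (hH : ∀ ⦃a b⦄, H a b → H b a) (hp0 : 0 < p) (hp1 : p ≤ 1) (F : Finset V)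
    (u x a : V) :
    PF p F (fun ω => Conn H (ω : Set V) u x ∧ Conn H (ω : Set V) u a) ≤
      2 * (p ^ 2)⁻¹ * ∑ b ∈ F, tau H p F u b * tau H p F b x * tau H p F b a := by
  have h := tauMulti_le hH hp0 hp1 F (Finset.univ : Finset Bool) (by simp)
    (fun l => if l then x else a) u
  have hs : splits (Finset.univ : Finset Bool) = {{true}, {false}} := by decide
  have ht : (Finset.univ : Finset Bool) \ {true} = {false} := by decide
  have hf : (Finset.univ : Finset Bool) \ {false} = {true} := by decide
  rw [hs, Finset.sum_pair (by decide), ht, hf] at h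
  simp only [tauMulti, Finset.mem_singleton, forall_eq, Finset.mem_univ, true_implies,
    Bool.forall_bool, if_true, Bool.false_eq_true, if_false] at h
  calc _ = PF p F fun ω => Conn H (ω : Set V) u a ∧ Conn H (ω : Set V) u x :=
        PF_congr fun _ _ => and_comm
    _ ≤ _ := h
    _ = _ := by
      rw [two_mul, add_mul, Finset.mul_sum]
      congr 1 <;> exact Finset.sum_congr rfl fun b _ => by simp only [tau]; ring

/-- The constant in the bound for the probability that a connection meets a cluster. -/
noncomputable def meetConst (d : ℕ) (g p C : ℝ) : ℝ :=
  g * 3 ^ d * (2 * (p ^ 2)⁻¹ * (C ^ 3 * 3 ^ (d - 2))) * (p⁻¹ * C ^ 2)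

/-- When `u` is connected to `x`, an explored item is equal or adjacent to an item of the cluster.
There are boundedly many candidates for the latter, and moving to one changes the kernel by at most
`3 ^ (d - 2)`. -/
lemma PF_explored_le (hG : ItemGeometry H ρ d g) (hp0 : 0 < p) (hp1 : p ≤ 1) (hC : 0 ≤ C)
    (F : Finset V) (hτ : ∀ i j, tau H p F i j ≤ C * kernel ρ d i j) (u x a : V) :
    (PF p F fun ω => Conn H (ω : Set V) u x ∧ a ∈ explored H F ↑ω u) ≤
      g * 3 ^ d * (2 * (p ^ 2)⁻¹ * (C ^ 3 * 3 ^ (d - 2))) *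
        ∑ b ∈ F, kernel ρ d u b * kernel ρ d b x * kernel ρ d b a := by
  classical
  have hg := hG.nonneg u
  let N : Finset V := F.filter fun a' => a' = a ∨ H a' a
  have hN : ∀ a' ∈ N, ρ a a' ≤ 2 := by
    intro a' ha'
    rcases (Finset.mem_filter.1 ha').2 with rfl | h
    · rw [hG.dist_self]; omega
    · rw [hG.dist_comm]; exact hG.dist_le_of_adj _ _ h
  have hNc : (N.card : ℝ) ≤ g * 3 ^ d := by
    have := hG.card_le a 2 N hN
    norm_num at this
    exact this
  calc _ ≤ PF p F fun ω => ∃ a' ∈ N, Conn H (ω : Set V) u x ∧ Conn H (ω : Set V) u a' := by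
        refine PF_mono hp0.le hp1 fun ω hω => ?_
        rintro ⟨hux, ha⟩
        have hmem : ∀ b, Conn H (ω : Set V) u b → b ∈ F := fun b hb =>
          hω (by simpa using hb.right_mem)
        rcases (mem_explored.1 ha).2 with rfl | ⟨b, hb, hc⟩
        · exact ⟨a, Finset.mem_filter.2 ⟨(mem_explored.1 ha).1, Or.inl rfl⟩, hux, .refl hux.left_mem⟩
        · exact ⟨b, Finset.mem_filter.2 ⟨hmem b hc, hb⟩, hux, hc⟩
    _ ≤ ∑ a' ∈ N, PF p F fun ω => Conn H (ω : Set V) u x ∧ Conn H (ω : Set V) u a' :=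
        PF_exists_le hp0.le hp1 _ _
    _ ≤ ∑ a' ∈ N, 2 * (p ^ 2)⁻¹ * (C ^ 3 * 3 ^ (d - 2)) *
        ∑ b ∈ F, kernel ρ d u b * kernel ρ d b x * kernel ρ d b a := by
        refine Finset.sum_le_sum fun a' ha' => ?_
        refine (PF_conn_two_le hG.adj_symm hp0 hp1 F u x a').trans ?_
        rw [mul_assoc, mul_assoc, mul_assoc, Finset.mul_sum, Finset.mul_sum, Finset.mul_sum,
          Finset.mul_sum, Finset.mul_sum]
        refine Finset.sum_le_sum fun b _ => ?_
        have t1 := hτ u b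
        have t2 := hτ b x
        have t3 : tau H p F b a' ≤ C * (3 ^ (d - 2) * kernel ρ d b a) :=
          (hτ b a').trans (mul_le_mul_of_nonneg_left (hG.kernel_le_of_near (hN a' ha') b) hC)
        have k1 : 0 ≤ kernel ρ d u b := kernel_nonneg _ _
        have k2 : 0 ≤ kernel ρ d b x := kernel_nonneg _ _
        have k3 : 0 ≤ kernel ρ d b a := kernel_nonneg _ _
        have s1 : 0 ≤ tau H p F u b := tau_nonneg hp0.le hp1 _ _ _
        have s2 : 0 ≤ tau H p F b x := tau_nonneg hp0.le hp1 _ _ _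
        have s3 : 0 ≤ tau H p F b a' := tau_nonneg hp0.le hp1 _ _ _
        calc 2 * ((p ^ 2)⁻¹ * (tau H p F u b * tau H p F b x * tau H p F b a'))
            ≤ 2 * ((p ^ 2)⁻¹ * ((C * kernel ρ d u b) * (C * kernel ρ d b x) *
              (C * (3 ^ (d - 2) * kernel ρ d b a)))) := by gcongr
          _ = _ := by ring
    _ ≤ _ := by
        rw [Finset.sum_const, nsmul_eq_mul, ← mul_assoc]
        have : 0 ≤ ∑ b ∈ F, kernel ρ d u b * kernel ρ d b x * kernel ρ d b a :=
          Finset.sum_nonneg fun b _ => mul_nonneg (mul_nonneg (kernel_nonneg _ _)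
            (kernel_nonneg _ _)) (kernel_nonneg _ _)
        gcongr

lemma meetBound_nonneg (hp0 : 0 ≤ p) (hp1 : p ≤ 1) (F : Finset V) (u x v y : V) :
    0 ≤ meetBound H p F u x v y :=
  Finset.sum_nonneg fun _ _ => mul_nonneg (PF_nonneg hp0 hp1 _) (PF_nonneg hp0 hp1 _)

/-- The diagram consists of the lines u–b, b–x, b–a, v–a, a–y. Summing over `x` and `y` removes the
two outer lines, and what is left is the open triangle u–b–a–v. -/
lemma sum_meetBound_le (hG : ItemGeometry H ρ d g) (hd : 6 < d) (hp0 : 0 < p) (hp1 : p ≤ 1)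
    (hC : 0 ≤ C) (F : Finset V) (hτ : ∀ i j, tau H p F i j ≤ C * kernel ρ d i j)
    (A B : Finset V) (κA κB : ℝ) (hA : ∀ i, ∑ x ∈ A, kernel ρ d i x ≤ κA)
    (hB : ∀ i, ∑ x ∈ B, kernel ρ d i x ≤ κB) (u v : V) :
    ∑ x ∈ A, ∑ y ∈ B, meetBound H p F u x v y ≤
      meetConst d g p C * (κA * κB) * (g ^ 2 * triangleConst d / ((ρ u v + 1 : ℕ) : ℝ)) := by
  have hg := hG.nonneg u
  have hM : 0 ≤ meetConst d g p C := by unfold meetConst; positivity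
  have hvia : ∀ a y, PF p F (Via H a v y) ≤
      p⁻¹ * C ^ 2 * (kernel ρ d a v * kernel ρ d a y) := by
    intro a y
    have h := bk_sharing hp0.le hp1 (F := F) a (increasing_conn (H := H) v a)
      (increasing_conn (H := H) a y)
    change p * PF p F (Via H a v y) ≤ tau H p F v a * tau H p F a y at h
    have t1 := hτ v a
    have t2 := hτ a y
    have s2 : 0 ≤ tau H p F a y := tau_nonneg hp0.le hp1 _ _ _
    have k1 : 0 ≤ kernel ρ d v a := kernel_nonneg _ _
    have : p * PF p F (Via H a v y) ≤ (C * kernel ρ d v a) * (C * kernel ρ d a y) :=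
      h.trans (by gcongr)
    calc PF p F (Via H a v y) = p⁻¹ * (p * PF p F (Via H a v y)) := by field_simp
      _ ≤ p⁻¹ * ((C * kernel ρ d v a) * (C * kernel ρ d a y)) := by gcongr
      _ = _ := by rw [hG.kernel_comm v a]; ring
  have hκA : 0 ≤ κA := (Finset.sum_nonneg fun _ _ => kernel_nonneg _ _).trans (hA u)
  calc ∑ x ∈ A, ∑ y ∈ B, meetBound H p F u x v y
      ≤ ∑ x ∈ A, ∑ y ∈ B, ∑ a ∈ F, ∑ b ∈ F, meetConst d g p C *
        ((kernel ρ d u b * kernel ρ d b a * kernel ρ d a v) *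
          (kernel ρ d b x * kernel ρ d a y)) := by
        refine Finset.sum_le_sum fun x _ => Finset.sum_le_sum fun y _ =>
          Finset.sum_le_sum fun a _ => ?_
        refine (mul_le_mul (PF_explored_le hG hp0 hp1 hC F hτ u x a) (hvia a y)
          (PF_nonneg hp0.le hp1 _) ?_).trans (le_of_eq ?_)
        · exact (PF_nonneg hp0.le hp1 _).trans (PF_explored_le hG hp0 hp1 hC F hτ u x a)
        · rw [← Finset.mul_sum, meetConst]
          have : ∑ b ∈ F, kernel ρ d u b * kernel ρ d b a * kernel ρ d a v *
              (kernel ρ d b x * kernel ρ d a y) =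
              (∑ b ∈ F, kernel ρ d u b * kernel ρ d b x * kernel ρ d b a) *
                (kernel ρ d a v * kernel ρ d a y) := by
            rw [Finset.sum_mul]
            exact Finset.sum_congr rfl fun b _ => by ring
          rw [this]; ring
    _ = ∑ a ∈ F, ∑ b ∈ F, meetConst d g p C *
        ((kernel ρ d u b * kernel ρ d b a * kernel ρ d a v) *
          ((∑ x ∈ A, kernel ρ d b x) * ∑ y ∈ B, kernel ρ d a y)) := by
        have h1 : ∀ x ∈ A, ∀ y ∈ B, ∑ a ∈ F, ∑ b ∈ F, meetConst d g p C *
            ((kernel ρ d u b * kernel ρ d b a * kernel ρ d a v) *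
              (kernel ρ d b x * kernel ρ d a y)) = ∑ q ∈ F ×ˢ F, meetConst d g p C *
            ((kernel ρ d u q.2 * kernel ρ d q.2 q.1 * kernel ρ d q.1 v) *
              (kernel ρ d q.2 x * kernel ρ d q.1 y)) := fun x _ y _ => by
          rw [Finset.sum_product]
        rw [Finset.sum_congr rfl fun x hx => Finset.sum_congr rfl fun y hy => h1 x hx y hy]
        simp_rw [Finset.sum_comm (s := B)]
        rw [Finset.sum_comm, Finset.sum_product]
        refine Finset.sum_congr rfl fun a _ => Finset.sum_congr rfl fun b _ => ?_
        rw [Finset.sum_mul_sum, Finset.mul_sum, Finset.mul_sum]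
        refine Finset.sum_congr rfl fun x _ => ?_
        rw [Finset.mul_sum, Finset.mul_sum]
    _ ≤ ∑ a ∈ F, ∑ b ∈ F, meetConst d g p C * (κA * κB) *
        (kernel ρ d u b * kernel ρ d b a * kernel ρ d a v) := by
        refine Finset.sum_le_sum fun a _ => Finset.sum_le_sum fun b _ => ?_
        have k : 0 ≤ kernel ρ d u b * kernel ρ d b a * kernel ρ d a v :=
          mul_nonneg (mul_nonneg (kernel_nonneg _ _) (kernel_nonneg _ _)) (kernel_nonneg _ _)
        have m : (∑ x ∈ A, kernel ρ d b x) * ∑ y ∈ B, kernel ρ d a y ≤ κA * κB :=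
          mul_le_mul (hA b) (hB a) (Finset.sum_nonneg fun _ _ => kernel_nonneg _ _) hκA
        calc _ ≤ meetConst d g p C *
              ((kernel ρ d u b * kernel ρ d b a * kernel ρ d a v) * (κA * κB)) := by gcongr
          _ = _ := by ring
    _ = meetConst d g p C * (κA * κB) *
        ∑ a ∈ F, ∑ b ∈ F, kernel ρ d u b * kernel ρ d b a * kernel ρ d a v := by
        simp only [Finset.mul_sum]
    _ ≤ _ := by
        have hκB : 0 ≤ κB := (Finset.sum_nonneg fun _ _ => kernel_nonneg _ _).trans (hB u)
        exact mul_le_mul_of_nonneg_left (hG.triangle_le hd F u v) (by positivity)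

end MeetBound

/-! ### Joining three clusters at a junction. -/

section Gluing

variable {V : Type*} [DecidableEq V] {H : V → V → Prop} {p : ℝ} {F : Finset V}

/-- Two items which do not meet `B` off `B'`, but are connected to `B'`, are connected to `B'`
off `B`. -/
lemma Conn.exists_off {ω B B' : Finset V} {x u : V} (hBB : Disjoint B B')
    (hx : ∀ b ∈ B, ¬ Conn H (↑(ω \ B') : Set V) x b) (hu : u ∈ B')
    (h : Conn H (ω : Set V) x u) : ∃ b ∈ B', Conn H (↑(ω \ B) : Set V) x b := by
  -- Until the path first enters `B'` it avoids `B'`, hence also `B` by `hx`.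
  have key : ∀ j, Conn H (ω : Set V) x j →
      (∃ b ∈ B', Conn H (↑(ω \ B) : Set V) x b) ∨
        (Conn H (↑(ω \ B') : Set V) x j ∧ Conn H (↑(ω \ B) : Set V) x j) := by
    intro j hj
    refine hj.induction ?_ ?_
    · have hxω : x ∈ ω := by simpa using h.left_mem
      by_cases hxB' : x ∈ B'
      · refine Or.inl ⟨x, hxB', .refl ?_⟩
        simpa using ⟨hxω, Finset.disjoint_right.1 hBB hxB'⟩
      · have h1 : Conn H (↑(ω \ B') : Set V) x x := .refl (by simpa using ⟨hxω, hxB'⟩)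
        refine Or.inr ⟨h1, .refl ?_⟩
        simpa using ⟨hxω, fun hxB => hx x hxB h1⟩
    · rintro a b - (h1 | ⟨h1, h2⟩) hab hbω
      · exact Or.inl h1
      have hbω : b ∈ ω := by simpa using hbω
      by_cases hbB' : b ∈ B'
      · refine Or.inl ⟨b, hbB', h2.tail hab ?_⟩
        simpa using ⟨hbω, Finset.disjoint_right.1 hBB hbB'⟩
      · have h3 : Conn H (↑(ω \ B') : Set V) x b := h1.tail hab (by simpa using ⟨hbω, hbB'⟩)
        refine Or.inr ⟨h3, h2.tail hab ?_⟩
        simpa using ⟨hbω, fun hbB => hx b hbB h3⟩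
  rcases key u h with h | ⟨h, -⟩
  · exact h
  · have : u ∈ ω ∧ u ∉ B' := by simpa using h.right_mem
    exact absurd hu this.2

/-- The set `B` is open, and the configuration is separated for some choice of the states of the
items of `B`. -/
def Glued (H : V → V → Prop) (B : Finset V) (u v w x y z : V) (ω : Finset V) : Prop :=
  (∃ ω₀ : Finset V, ω₀ \ B = ω \ B ∧ Separated H (ω₀ : Set V) u v w x y z) ∧ B ⊆ ω

lemma Glued.exists_subset {B : Finset V} {u v w x y z : V} {ω : Finset V}
    (h : Glued H B u v w x y z ω) :
    ∃ ω₀ ⊆ ω, ω \ B ⊆ ω₀ ∧ Separated H (ω₀ : Set V) u v w x y z := by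
  obtain ⟨⟨ω₀, h0, hsep⟩, hB⟩ := h
  refine ⟨ω₀, fun a ha => ?_, h0 ▸ Finset.sdiff_subset, hsep⟩
  by_cases haB : a ∈ B
  · exact hB haB
  · exact (Finset.mem_sdiff.1 (h0 ▸ Finset.mem_sdiff.2 ⟨ha, haB⟩ : a ∈ ω \ B)).1

lemma Glued.conn (hH : ∀ ⦃a b⦄, H a b → H b a) {B : Finset V} {u v w x y z : V} {ω : Finset V}
    (hu : u ∈ B) (hv : v ∈ B) (hw : w ∈ B)
    (hB : ∀ a ∈ B, ∀ b ∈ B, Conn H (B : Set V) a b) (h : Glued H B u v w x y z ω) :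
    Conn H (ω : Set V) x y ∧ Conn H (ω : Set V) x z := by
  obtain ⟨ω₀, h0, -, ⟨h1, h2, h3⟩, -⟩ := h.exists_subset
  have hc := Finset.coe_subset.2 h0
  have hBω := Finset.coe_subset.2 h.2
  have e1 := (h1.mono hc).symm hH
  exact ⟨(e1.trans ((hB u hu v hv).mono hBω)).trans (h2.mono hc),
    (e1.trans ((hB u hu w hw).mono hBω)).trans (h3.mono hc)⟩

/-- A pigeonhole argument, for which two targets would not suffice. At most one of `x`, `y`, `z`
reaches `B` off `B'`, since two of them would be joined in the configuration separated for `B'`. The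
remaining two then reach `B'` off `B`, and are joined in the configuration separated for `B`. -/
lemma Glued.not_of_disjoint (hH : ∀ ⦃a b⦄, H a b → H b a) {B B' : Finset V}
    {u v w u' v' w' x y z : V} {ω : Finset V} (hBB : Disjoint B B')
    (hu' : u' ∈ B') (hv' : v' ∈ B') (hw' : w' ∈ B')
    (hB : ∀ a ∈ B, ∀ b ∈ B, Conn H (B : Set V) a b)
    (hB' : ∀ a ∈ B', ∀ b ∈ B', Conn H (B' : Set V) a b)
    (h : Glued H B u v w x y z ω) : ¬ Glued H B' u' v' w' x y z ω := by
  intro h'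
  obtain ⟨ω₀, -, hsub, ⟨hux, hvy, hwz⟩, nuv, nuw, nvw⟩ := h.exists_subset
  obtain ⟨ω₀', hsub'', hsub', ⟨hux', hvy', hwz'⟩, nuv', nuw', nvw'⟩ := h'.exists_subset
  have hBω : (B : Set V) ⊆ ↑(ω \ B') := fun a ha => by
    have ha : a ∈ B := by simpa using ha
    simpa using ⟨h.2 ha, Finset.disjoint_left.1 hBB ha⟩
  have hBω' : (B' : Set V) ⊆ ↑(ω \ B) := fun a ha => by
    have ha : a ∈ B' := by simpa using ha
    simpa using ⟨h'.2 ha, Finset.disjoint_right.1 hBB ha⟩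
  -- two of the three items cannot both be connected to `B` off `B'`
  have two : ∀ s t : V, ¬ Conn H (ω₀' : Set V) s t →
      (∀ b ∈ B, ¬ Conn H (↑(ω \ B') : Set V) s b) ∨
      (∀ b ∈ B, ¬ Conn H (↑(ω \ B') : Set V) t b) := by
    intro s t hst
    by_contra! hcon
    obtain ⟨⟨b, hb, hsb⟩, c, hc, htc⟩ := hcon
    exact hst (((hsb.trans ((hB b hb c hc).mono hBω)).trans (htc.symm hH)).mono
      (Finset.coe_subset.2 hsub'))
  -- but two items not connected to `B` off `B'` are connected off `B`
  have join : ∀ s t a b : V, a ∈ B' → b ∈ B' → Conn H (ω : Set V) a s → Conn H (ω : Set V) b t →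
      (∀ b ∈ B, ¬ Conn H (↑(ω \ B') : Set V) s b) →
      (∀ b ∈ B, ¬ Conn H (↑(ω \ B') : Set V) t b) → Conn H (ω₀ : Set V) s t := by
    intro s t a b ha hb has hbt hs ht
    obtain ⟨c, hc, hsc⟩ := (has.symm hH).exists_off hBB hs ha
    obtain ⟨e, he, hte⟩ := (hbt.symm hH).exists_off hBB ht hb
    exact ((hsc.trans ((hB' c hc e he).mono hBω')).trans (hte.symm hH)).mono
      (Finset.coe_subset.2 hsub)
  have hc := Finset.coe_subset.2 hsub''
  have nxy : ¬ Conn H (ω₀' : Set V) x y := fun h => nuv' ((hux'.trans h).trans (hvy'.symm hH))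
  have nxz : ¬ Conn H (ω₀' : Set V) x z := fun h => nuw' ((hux'.trans h).trans (hwz'.symm hH))
  have nyz : ¬ Conn H (ω₀' : Set V) y z := fun h => nvw' ((hvy'.trans h).trans (hwz'.symm hH))
  have mxy : ¬ Conn H (ω₀ : Set V) x y := fun h => nuv ((hux.trans h).trans (hvy.symm hH))
  have mxz : ¬ Conn H (ω₀ : Set V) x z := fun h => nuw ((hux.trans h).trans (hwz.symm hH))
  have myz : ¬ Conn H (ω₀ : Set V) y z := fun h => nvw ((hvy.trans h).trans (hwz.symm hH))
  have jxy := join x y u' v' hu' hv' (hux'.mono hc) (hvy'.mono hc)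
  have jxz := join x z u' w' hu' hw' (hux'.mono hc) (hwz'.mono hc)
  have jyz := join y z v' w' hv' hw' (hvy'.mono hc) (hwz'.mono hc)
  have txy := two x y nxy
  have txz := two x z nxz
  have tyz := two y z nyz
  rcases txy with h1 | h1
  · rcases tyz with h2 | h2
    · exact mxy (jxy h1 h2)
    · exact mxz (jxz h1 h2)
  · rcases txz with h2 | h2
    · exact mxy (jxy h2 h1)
    · exact myz (jyz h1 h2)

/-- A separated configuration becomes connected by opening a connected set of items; this can
happen for at most one of a family of disjoint sets. -/
lemma sum_separated_le (hH : ∀ ⦃a b⦄, H a b → H b a) (hp0 : 0 ≤ p) (hp1 : p ≤ 1) {ι : Type*}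
    (U : Finset ι) (B : ι → Finset V) (u v w : ι → V) (n : ℕ) (hn : ∀ s ∈ U, (B s).card ≤ n)
    (hBF : ∀ s ∈ U, B s ⊆ F) (hu : ∀ s ∈ U, u s ∈ B s) (hv : ∀ s ∈ U, v s ∈ B s)
    (hw : ∀ s ∈ U, w s ∈ B s) (hB : ∀ s ∈ U, ∀ a ∈ B s, ∀ b ∈ B s, Conn H (B s : Set V) a b)
    (hdisj : ∀ s ∈ U, ∀ t ∈ U, s ≠ t → Disjoint (B s) (B t)) (x y z : V) :
    p ^ n * ∑ s ∈ U, PF p F (fun ω => Separated H (ω : Set V) (u s) (v s) (w s) x y z) ≤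
      PF p F fun ω => Conn H (ω : Set V) x y ∧ Conn H (ω : Set V) x z := by
  -- Separation for some choice of the states in `B s` does not depend on these states, so opening
  -- `B s` costs exactly `p ^ (B s).card`.
  have h1 : ∀ s ∈ U, p ^ n * PF p F (fun ω => Separated H (ω : Set V) (u s) (v s) (w s) x y z) ≤
      PF p F (Glued H (B s) (u s) (v s) (w s) x y z) := by
    intro s hs
    have := PF_and_subset (p := p) (hBF s hs) fun ω => ∃ ω₀ : Finset V, ω₀ \ B s = ω \ B s ∧
      Separated H (ω₀ : Set V) (u s) (v s) (w s) x y z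
    change PF p F (Glued H (B s) (u s) (v s) (w s) x y z) = _ at this
    rw [this]
    refine mul_le_mul (pow_le_pow_of_le_one hp0 hp1 (hn s hs))
      (PF_mono hp0 hp1 fun ω _ h => ⟨ω, ?_, h⟩) (PF_nonneg hp0 hp1 _) (pow_nonneg hp0 _)
    ext a; simp only [Finset.mem_sdiff, Finset.mem_union]; tauto
  rw [Finset.mul_sum]
  refine (Finset.sum_le_sum h1).trans ?_
  simp only [PF, ← EF_sum]
  refine EF_mono hp0 hp1 fun ω _ => ?_
  -- At most one index is glued, so the sum of the indicators is at most one.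
  by_cases hex : ∃ s ∈ U, Glued H (B s) (u s) (v s) (w s) x y z ω
  · obtain ⟨s, hs, hgl⟩ := hex
    rw [ind_of_true (hgl.conn hH (hu s hs) (hv s hs) (hw s hs) (hB s hs)),
      Finset.sum_eq_single_of_mem s hs, ind_of_true hgl]
    intro t ht hts
    exact ind_of_false (hgl.not_of_disjoint hH (hdisj s hs t ht hts.symm) (hu t ht) (hv t ht)
      (hw t ht) (hB s hs) (hB t ht))
  · refine le_trans (le_of_eq ?_) (ind_nonneg _)
    refine Finset.sum_eq_zero fun s hs => ind_of_false fun h => hex ⟨s, hs, h⟩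

end Gluing

/-! ### The mean number of connected triples. -/

section ThreePoint

variable {V : Type*} [DecidableEq V] {H : V → V → Prop} {ρ : V → V → ℕ} {d : ℕ} {g p C : ℝ}

/-- The lower bound for the number of connected triples. -/
lemma sum_three_point_ge (hG : ItemGeometry H ρ d g) (hd : 6 < d) (hp0 : 0 < p) (hp1 : p ≤ 1)
    (hC : 0 ≤ C) (F : Finset V) (hτ : ∀ i j, tau H p F i j ≤ C * kernel ρ d i j)
    (A B D : Finset V) (κA κB κD t : ℝ) (hA : ∀ i, ∑ x ∈ A, kernel ρ d i x ≤ κA)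
    (hB : ∀ i, ∑ x ∈ B, kernel ρ d i x ≤ κB) (hD : ∀ i, ∑ x ∈ D, kernel ρ d i x ≤ κD)
    (ht : 0 ≤ t) {ι : Type*} (U : Finset ι) (N : ι → Finset V) (u v w : ι → V) (n R : ℕ)
    (hn : ∀ s ∈ U, (N s).card ≤ n)
    (hNF : ∀ s ∈ U, N s ⊆ F) (hu : ∀ s ∈ U, u s ∈ N s) (hv : ∀ s ∈ U, v s ∈ N s)
    (hw : ∀ s ∈ U, w s ∈ N s) (hN : ∀ s ∈ U, ∀ a ∈ N s, ∀ b ∈ N s, Conn H (N s : Set V) a b)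
    (hdisj : ∀ s ∈ U, ∀ t ∈ U, s ≠ t → Disjoint (N s) (N t))
    (huv : ∀ s ∈ U, R ≤ ρ (u s) (v s)) (huw : ∀ s ∈ U, R ≤ ρ (u s) (w s))
    (hvw : ∀ s ∈ U, R ≤ ρ (v s) (w s)) (htu : ∀ s ∈ U, ∀ x ∈ A, t ≤ tau H p F (u s) x)
    (htv : ∀ s ∈ U, ∀ x ∈ B, t ≤ tau H p F (v s) x)
    (htw : ∀ s ∈ U, ∀ x ∈ D, t ≤ tau H p F (w s) x) :
    p ^ n * (U.card * (A.card * B.card * D.card * t ^ 3 -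
      3 * (C * meetConst d g p C * (κA * κB * κD) * (g ^ 2 * triangleConst d / ((R + 1 : ℕ) : ℝ))))) ≤
      ∑ x ∈ A, ∑ y ∈ B, ∑ z ∈ D,
        PF p F fun ω => Conn H (ω : Set V) x y ∧ Conn H (ω : Set V) x z := by
  have hp0' := hp0.le
  have hstep : p ^ n * ∑ s ∈ U, ∑ x ∈ A, ∑ y ∈ B, ∑ z ∈ D,
      PF p F (fun ω => Separated H (ω : Set V) (u s) (v s) (w s) x y z) ≤
      ∑ x ∈ A, ∑ y ∈ B, ∑ z ∈ D,
        PF p F fun ω => Conn H (ω : Set V) x y ∧ Conn H (ω : Set V) x z := by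
    have h1 : ∑ s ∈ U, ∑ x ∈ A, ∑ y ∈ B, ∑ z ∈ D,
        PF p F (fun ω => Separated H (ω : Set V) (u s) (v s) (w s) x y z) =
        ∑ x ∈ A, ∑ y ∈ B, ∑ z ∈ D, ∑ s ∈ U,
          PF p F (fun ω => Separated H (ω : Set V) (u s) (v s) (w s) x y z) := by
      rw [Finset.sum_comm]
      refine Finset.sum_congr rfl fun x _ => ?_
      rw [Finset.sum_comm]
      refine Finset.sum_congr rfl fun y _ => ?_
      rw [Finset.sum_comm]
    rw [h1]
    simp only [Finset.mul_sum (a := p ^ n)]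
    refine Finset.sum_le_sum fun x _ => Finset.sum_le_sum fun y _ => Finset.sum_le_sum fun z _ => ?_
    rw [← Finset.mul_sum]
    exact sum_separated_le hG.adj_symm hp0' hp1 U N u v w n hn hNF hu hv hw hN hdisj x y z
  -- It remains to treat a single junction: the product of the two-point functions is at least `t ^
  -- 3`, and each of the three pairs of connections contributes one meeting error.
  refine le_trans (mul_le_mul_of_nonneg_left ?_ (pow_nonneg hp0' n)) hstep
  rw [← nsmul_eq_mul]
  refine Finset.card_nsmul_le_sum _ _ _ fun s hs => ?_
  have hg := hG.nonneg (u s)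
  have hM : 0 ≤ meetConst d g p C := by unfold meetConst; positivity
  have hT : 0 ≤ triangleConst d := by unfold triangleConst; positivity
  have hκ : ∀ (S : Finset V) (κ : ℝ), (∀ i, ∑ x ∈ S, kernel ρ d i x ≤ κ) → 0 ≤ κ :=
    fun S κ h => (Finset.sum_nonneg fun _ _ => kernel_nonneg _ _).trans (h (u s))
  have hκA := hκ A κA hA
  have hκB := hκ B κB hB
  have hκD := hκ D κD hD
  set Q : ℝ := g ^ 2 * triangleConst d / ((R + 1 : ℕ) : ℝ) with hQ
  have hQ0 : 0 ≤ Q := by positivity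
  have hmeet : ∀ (A B : Finset V) (κA κB : ℝ) (_ : ∀ i, ∑ x ∈ A, kernel ρ d i x ≤ κA)
      (_ : ∀ i, ∑ x ∈ B, kernel ρ d i x ≤ κB) (u v : V), R ≤ ρ u v →
      ∑ x ∈ A, ∑ y ∈ B, meetBound H p F u x v y ≤ meetConst d g p C * (κA * κB) * Q := by
    intro A B κA κB hA hB u v huv
    refine (sum_meetBound_le hG hd hp0 hp1 hC F hτ A B κA κB hA hB u v).trans ?_
    have h1 := hκ A κA hA
    have h2 := hκ B κB hB
    have : ((R + 1 : ℕ) : ℝ) ≤ ((ρ u v + 1 : ℕ) : ℝ) := by exact_mod_cast Nat.succ_le_succ huv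
    rw [hQ]
    gcongr
  have hsum : ∀ (S : Finset V) (κ : ℝ), (∀ i, ∑ x ∈ S, kernel ρ d i x ≤ κ) → ∀ i,
      ∑ x ∈ S, tau H p F i x ≤ C * κ := by
    intro S κ h i
    calc _ ≤ ∑ x ∈ S, C * kernel ρ d i x := Finset.sum_le_sum fun x _ => hτ i x
      _ = C * ∑ x ∈ S, kernel ρ d i x := by rw [Finset.mul_sum]
      _ ≤ _ := by gcongr; exact h i
  have hmain : (A.card : ℝ) * B.card * D.card * t ^ 3 ≤ ∑ x ∈ A, ∑ y ∈ B, ∑ z ∈ D,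
      tau H p F (u s) x * (tau H p F (v s) y * tau H p F (w s) z) := by
    calc (A.card : ℝ) * B.card * D.card * t ^ 3 = ∑ x ∈ A, ∑ y ∈ B, ∑ z ∈ D, t * (t * t) := by
          simp only [Finset.sum_const, nsmul_eq_mul]; ring
      _ ≤ _ := by
          refine Finset.sum_le_sum fun x hx => Finset.sum_le_sum fun y hy =>
            Finset.sum_le_sum fun z hz => ?_
          have h1 := htu s hs x hx
          have h2 := htv s hs y hy
          have h3 := htw s hs z hz
          have : 0 ≤ tau H p F (u s) x := tau_nonneg hp0' hp1 _ _ _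
          have : 0 ≤ tau H p F (v s) y := tau_nonneg hp0' hp1 _ _ _
          gcongr
  have hall : ∑ x ∈ A, ∑ y ∈ B, ∑ z ∈ D,
      tau H p F (u s) x * (tau H p F (v s) y * tau H p F (w s) z) ≤ ∑ x ∈ A, ∑ y ∈ B, ∑ z ∈ D,
      (PF p F (fun ω => Separated H (ω : Set V) (u s) (v s) (w s) x y z) +
      (meetBound H p F (u s) x (v s) y * tau H p F (w s) z +
        (meetBound H p F (u s) x (w s) z * tau H p F (v s) y +
        tau H p F (u s) x * meetBound H p F (v s) y (w s) z))) :=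
    Finset.sum_le_sum fun x _ => Finset.sum_le_sum fun y _ => Finset.sum_le_sum fun z _ =>
      separated_ge hG.adj_symm hp0' hp1 F _ _ _ _ _ _
  simp only [Finset.sum_add_distrib] at hall
  have hmnn : ∀ a b c e, 0 ≤ meetBound H p F a b c e := meetBound_nonneg hp0' hp1 F
  have b1 : ∑ x ∈ A, ∑ y ∈ B, ∑ z ∈ D, meetBound H p F (u s) x (v s) y * tau H p F (w s) z ≤
      C * meetConst d g p C * (κA * κB * κD) * Q := by
    calc _ = (∑ x ∈ A, ∑ y ∈ B, meetBound H p F (u s) x (v s) y) *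
          ∑ z ∈ D, tau H p F (w s) z := by
          simp only [← Finset.mul_sum, ← Finset.sum_mul]
      _ ≤ (meetConst d g p C * (κA * κB) * Q) * (C * κD) :=
          mul_le_mul (hmeet A B κA κB hA hB _ _ (huv s hs)) (hsum D κD hD _)
            (Finset.sum_nonneg fun _ _ => tau_nonneg hp0' hp1 _ _ _) (by positivity)
      _ = _ := by ring
  have b2 : ∑ x ∈ A, ∑ y ∈ B, ∑ z ∈ D, meetBound H p F (u s) x (w s) z * tau H p F (v s) y ≤
      C * meetConst d g p C * (κA * κB * κD) * Q := by
    calc _ = (∑ x ∈ A, ∑ z ∈ D, meetBound H p F (u s) x (w s) z) *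
          ∑ y ∈ B, tau H p F (v s) y := by
          rw [Finset.sum_mul]
          refine Finset.sum_congr rfl fun x _ => ?_
          rw [Finset.sum_mul_sum, Finset.sum_comm]
      _ ≤ (meetConst d g p C * (κA * κD) * Q) * (C * κB) :=
          mul_le_mul (hmeet A D κA κD hA hD _ _ (huw s hs)) (hsum B κB hB _)
            (Finset.sum_nonneg fun _ _ => tau_nonneg hp0' hp1 _ _ _) (by positivity)
      _ = _ := by ring
  have b3 : ∑ x ∈ A, ∑ y ∈ B, ∑ z ∈ D, tau H p F (u s) x * meetBound H p F (v s) y (w s) z ≤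
      C * meetConst d g p C * (κA * κB * κD) * Q := by
    calc _ = (∑ x ∈ A, tau H p F (u s) x) *
          ∑ y ∈ B, ∑ z ∈ D, meetBound H p F (v s) y (w s) z := by
          simp only [← Finset.mul_sum, ← Finset.sum_mul]
      _ ≤ (C * κA) * (meetConst d g p C * (κB * κD) * Q) :=
          mul_le_mul (hsum A κA hA _) (hmeet B D κB κD hB hD _ _ (hvw s hs))
            (Finset.sum_nonneg fun _ _ => Finset.sum_nonneg fun _ _ => hmnn _ _ _ _)
            (by positivity)
      _ = _ := by ring
  linarith

end ThreePoint


/-! ### First and second moment bounds for large and small clusters. -/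

section Tails

variable {V : Type*} [DecidableEq V] {H : V → V → Prop} {p : ℝ}

/-- The moment bound for the probability of a large cluster. -/
lemma PF_exists_large_le (hH : ∀ ⦃a b⦄, H a b → H b a) (hp0 : 0 < p) (hp1 : p ≤ 1) (F : Finset V)
    (S : Finset V) (K : ℝ) (ψ : V → ℝ) (Λ : ℝ) (hK : 0 ≤ K) (hψ1 : ∀ i, ψ i ≤ 1) (hΛ : 0 ≤ Λ)
    (hconv : ∀ i, ∑ b ∈ F, tau H p F i b * ψ b ^ 2 ≤ Λ * ψ i)
    (hS : ∀ i, ∑ x ∈ S, tau H p F i x ≤ K * ψ i) (k : ℕ) (hk : 1 ≤ k) (t : ℝ) (ht : 0 < t) :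
    (PF p F fun ω => ∃ e ∈ S, t ≤ hits H ↑ω S e) ≤
      S.card * (treeCount k * K ^ k * (Λ / p ^ 2) ^ (k - 1) / t ^ k) := by
  have hex := PF_exists_le hp0.le hp1 (F := F) S
    fun (e : V) (ω : Finset V) => t ≤ hits H (ω : Set V) S e
  refine hex.trans ?_
  refine (Finset.sum_le_sum (g := fun _ => treeCount k * K ^ k * (Λ / p ^ 2) ^ (k - 1) / t ^ k)
    fun e _ => ?_).trans (le_of_eq (by rw [Finset.sum_const, nsmul_eq_mul]))
  have hm := moment_le hH hp0 hp1 F (fun _ : Fin k => S) (fun _ => K) ψ Λ (fun _ => hK) hΛ hconv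
    (fun _ => hS) Finset.univ (by rw [← Finset.card_pos, Finset.card_univ, Fintype.card_fin]; exact hk) e
  simp only [Finset.card_univ, Fintype.card_fin, Finset.prod_const] at hm
  have hc : 0 ≤ (treeCount k : ℝ) * K ^ k * (Λ / p ^ 2) ^ (k - 1) := by positivity
  calc (PF p F fun ω => t ≤ hits H ↑ω S e) ≤ PF p F fun ω => t ^ k ≤ hits H ↑ω S e ^ k :=
        PF_mono hp0.le hp1 fun ω _ h => pow_le_pow_left₀ ht.le h k
    _ ≤ EF p F (fun ω => hits H ↑ω S e ^ k) / t ^ k :=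
        PF_le_EF_div hp0.le hp1 (fun ω _ => pow_nonneg (hits_nonneg _ _ _) k) (by positivity)
    _ ≤ _ := by
        gcongr
        have : EF p F (fun ω => hits H ↑ω S e ^ k) =
            moment H p F (fun _ : Fin k => S) Finset.univ e := by
          simp [moment]
        rw [this]
        exact hm.trans (mul_le_of_le_one_right hc (hψ1 e))

/-- The number of connected triples. -/
noncomputable def triples (H : V → V → Prop) (A B D : Finset V) (ω : Set V) : ℝ :=
  ∑ x ∈ A, ∑ y ∈ B, ∑ z ∈ D, ind (Conn H ω x y ∧ Conn H ω x z)

/-- The number of connected pairs. -/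
noncomputable def pairs (H : V → V → Prop) (A B : Finset V) (ω : Set V) : ℝ :=
  ∑ x ∈ A, ∑ y ∈ B, ind (Conn H ω x y)

lemma EF_triples (F A B D : Finset V) : EF p F (fun ω => triples H A B D ↑ω) =
    ∑ x ∈ A, ∑ y ∈ B, ∑ z ∈ D,
      PF p F fun ω => Conn H (ω : Set V) x y ∧ Conn H (ω : Set V) x z := by
  simp only [triples, EF_sum]; rfl

lemma EF_pairs (F A B : Finset V) : EF p F (fun ω => pairs H A B ↑ω) =
    ∑ x ∈ A, ∑ y ∈ B, tau H p F x y := by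
  simp only [pairs, EF_sum]; rfl

/-- The sets which occur in the square of the number of triples. -/
def squareFamily (A B D : Finset V) : Fin 5 → Finset V := ![B, D, A, B, D]

/-- The variance of the number of connected triples. -/
lemma EF_triples_sq_le (hH : ∀ ⦃a b⦄, H a b → H b a) (hp0 : 0 ≤ p) (hp1 : p ≤ 1) (F : Finset V)
    (A B D : Finset V) : EF p F (fun ω => triples H A B D ↑ω ^ 2) ≤
    EF p F (fun ω => triples H A B D ↑ω) ^ 2 +
      ∑ x ∈ A, moment H p F (squareFamily A B D) Finset.univ x := by
  classical
  let E : V × V × V → Finset V → Prop := fun t ω =>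
    Conn H (ω : Set V) t.1 t.2.1 ∧ Conn H (ω : Set V) t.1 t.2.2
  have hE : ∀ t, Increasing (E t) := fun t S T hST h =>
    ⟨h.1.mono (Finset.coe_subset.2 hST), h.2.mono (Finset.coe_subset.2 hST)⟩
  let Dis : V × V × V → V × V × V → Finset V → Prop := fun t t' ω =>
    ∃ S ⊆ ω, ∃ T ⊆ ω, Disjoint S T ∧ E t S ∧ E t' T
  let I : Finset (V × V × V) := A ×ˢ B ×ˢ D
  have htri : ∀ ω : Finset V, triples H A B D ↑ω = ∑ t ∈ I, ind (E t ω) := by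
    intro ω
    simp only [I, Finset.sum_product, triples, E]
  -- Two triples in different clusters occur disjointly, and the van den Berg–Kesten inequality
  -- bounds them by the squared mean. Otherwise the first item is connected to five others, which
  -- gives the fifth moment.
  have hpt : ∀ ω : Finset V, triples H A B D ↑ω ^ 2 ≤ (∑ t ∈ I, ∑ t' ∈ I, ind (Dis t t' ω)) +
      ∑ x ∈ A, ∏ l, hits H ↑ω (squareFamily A B D l) x := by
    intro ω
    have h1 : ∑ x ∈ A, ∏ l, hits H ↑ω (squareFamily A B D l) x =
        ∑ t ∈ I, ∑ t' ∈ I, ind (E t ω) * (ind (Conn H (ω : Set V) t.1 t'.1) *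
          (ind (Conn H (ω : Set V) t.1 t'.2.1) * ind (Conn H (ω : Set V) t.1 t'.2.2))) := by
      simp only [I, Finset.sum_product, E, ind_and]
      refine Finset.sum_congr rfl fun x _ => ?_
      simp only [Fin.prod_univ_five, squareFamily, hits, Matrix.cons_val]
      simp only [← Finset.mul_sum, ← Finset.sum_mul]
      ring
    rw [h1, htri, sq, Finset.sum_mul_sum, ← Finset.sum_add_distrib]
    refine Finset.sum_le_sum fun t _ => ?_
    rw [← Finset.sum_add_distrib]
    refine Finset.sum_le_sum fun t' _ => ?_
    by_cases ht : E t ω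
    swap
    · rw [ind_of_false ht, zero_mul, zero_mul, add_zero]; exact ind_nonneg _
    by_cases ht' : E t' ω
    swap
    · rw [ind_of_false ht', mul_zero]
      exact add_nonneg (ind_nonneg _) (mul_nonneg (ind_nonneg _) (mul_nonneg (ind_nonneg _)
        (mul_nonneg (ind_nonneg _) (ind_nonneg _))))
    rw [ind_of_true ht, ind_of_true ht']
    by_cases hc : Conn H (ω : Set V) t.1 t'.1
    · rw [ind_of_true hc, ind_of_true (hc.trans ht'.1), ind_of_true (hc.trans ht'.2)]
      linarith [ind_nonneg (Dis t t' ω)]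
    · have hdis : Dis t t' ω := by
        let K : V → Finset V := fun x => ω.filter fun b => Conn H (ω : Set V) x b
        have hK : ∀ x y, Conn H (ω : Set V) x y → Conn H (K x : Set V) x y := fun x y h =>
          h.within_of_subset fun a ha => by
            simpa [K] using ⟨by simpa using ha.right_mem, ha⟩
        refine ⟨K t.1, Finset.filter_subset _ _, K t'.1, Finset.filter_subset _ _, ?_,
          ⟨hK _ _ ht.1, hK _ _ ht.2⟩, ⟨hK _ _ ht'.1, hK _ _ ht'.2⟩⟩
        rw [Finset.disjoint_left]
        intro a ha ha'
        exact hc ((Finset.mem_filter.1 ha).2.trans ((Finset.mem_filter.1 ha').2.symm hH))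
      rw [ind_of_true hdis]
      have := mul_nonneg (ind_nonneg (Conn H (ω : Set V) t.1 t'.1))
        (mul_nonneg (ind_nonneg (Conn H (ω : Set V) t.1 t'.2.1))
          (ind_nonneg (Conn H (ω : Set V) t.1 t'.2.2)))
      linarith
  refine (EF_mono hp0 hp1 fun ω _ => hpt ω).trans ?_
  simp only [htri, EF_add, EF_sum]
  refine add_le_add ?_ le_rfl
  rw [sq, Finset.sum_mul_sum]
  exact Finset.sum_le_sum fun t _ => Finset.sum_le_sum fun t' _ =>
    bk_inequality hp0 hp1 F (hE t) (hE t')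

/-- The bound for the probability that all clusters which connect `A` and `B` are small. -/
lemma PF_all_small_le (hH : ∀ ⦃a b⦄, H a b → H b a) (hp0 : 0 ≤ p) (hp1 : p ≤ 1) (F : Finset V)
    (A B D : Finset V) (hZ : 0 < EF p F fun ω => triples H A B D ↑ω) (t : ℝ) (ht : 0 < t) :
    (PF p F fun ω => ∀ x ∈ A, ∀ y ∈ B, Conn H (ω : Set V) x y → hits H ↑ω D x < t) ≤
      4 * (∑ x ∈ A, moment H p F (squareFamily A B D) Finset.univ x) /
        (EF p F fun ω => triples H A B D ↑ω) ^ 2 +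
      2 * t * (∑ x ∈ A, ∑ y ∈ B, tau H p F x y) / EF p F fun ω => triples H A B D ↑ω := by
  set m := EF p F fun ω => triples H A B D ↑ω with hm
  -- When all hits are below `t`, the triples number at most `t` times the pairs: either there are
  -- few triples (Chebyshev) or many pairs (Markov).
  have h1 : (PF p F fun ω => ∀ x ∈ A, ∀ y ∈ B, Conn H (ω : Set V) x y → hits H ↑ω D x < t) ≤
      PF p F fun ω => triples H A B D ↑ω ≤ m / 2 ∨ m / (2 * t) ≤ pairs H A B ↑ω := by
    refine PF_mono hp0 hp1 fun ω _ h => ?_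
    by_contra! hcon
    obtain ⟨c1, c2⟩ := hcon
    have h2 : triples H A B D ↑ω ≤ t * pairs H A B ↑ω := by
      simp only [triples, pairs, Finset.mul_sum]
      refine Finset.sum_le_sum fun x hx => Finset.sum_le_sum fun y hy => ?_
      simp only [ind_and, ← Finset.mul_sum]
      by_cases hc : Conn H (ω : Set V) x y
      · rw [ind_of_true hc, one_mul, mul_one]; exact (h x hx y hy hc).le
      · rw [ind_of_false hc, zero_mul, mul_zero]
    have h3 : t * pairs H A B ↑ω < t * (m / (2 * t)) := by gcongr
    have h4 : t * (m / (2 * t)) = m / 2 := by field_simp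
    linarith
  refine (h1.trans (PF_or_le hp0 hp1 _ _)).trans (add_le_add ?_ ?_)
  · refine (PF_le_half_le hp0 hp1 (fun ω : Finset V => triples H A B D ↑ω) hZ).trans ?_
    have := EF_triples_sq_le hH hp0 hp1 F A B D
    rw [← hm] at this ⊢
    gcongr
    linarith
  · refine (PF_le_EF_div hp0 hp1 (f := fun ω : Finset V => pairs H A B ↑ω) (fun ω _ =>
      Finset.sum_nonneg fun _ _ => Finset.sum_nonneg fun _ _ => ind_nonneg _)
      (by positivity)).trans (le_of_eq ?_)
    rw [EF_pairs]
    field_simp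

end Tails


/-! ### The two tail bounds at scale `L`. -/

section Scaling

variable {V : Type*} {H : V → V → Prop} {ρ : V → V → ℕ} {d : ℕ} {g p C : ℝ}

/-- A family of subsets of the balls of radius `4 L`, of growth at most `d - 2 + a`. -/
structure Spread (ρ : V → V → ℕ) (d : ℕ) (o : V) (S : ℕ → Finset V) (a : ℕ) (gS : ℝ) : Prop where
  growth : ∀ L i, GrowthLE (S L) (fun j => ρ i j + 1) gS (d - 2 + a)
  ball : ∀ L, 1 ≤ L → ∀ x ∈ S L, ρ o x ≤ 4 * L

/-- The constant in the bound for the mean number of connections to a family of sets. -/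
noncomputable def spreadConst (d a : ℕ) (gS : ℝ) : ℝ :=
  gS * (4 ^ d * (d * 5 ^ a + 2 ^ a)) * 4 ^ a

variable {o : V} {S : ℕ → Finset V} {a : ℕ} {gS : ℝ}

lemma Spread.nonneg (hS : Spread ρ d o S a gS) : 0 ≤ gS := (hS.growth 0 o).nonneg

lemma Spread.const_nonneg (hS : Spread ρ d o S a gS) : 0 ≤ spreadConst d a gS := by
  have := hS.nonneg
  unfold spreadConst; positivity

lemma Spread.sum_kernel_le_profile (hS : Spread ρ d o S a gS) (hG : ItemGeometry H ρ d g)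
    (hd : 6 < d) (ha : 1 ≤ a) (L : ℕ) (hL : 1 ≤ L) (i : V) :
    ∑ x ∈ S L, kernel ρ d i x ≤ spreadConst d a gS * (L : ℝ) ^ a * profile ρ d o (4 * L) i := by
  have h := hG.sum_kernel_le hd (S L) a ha gS o (4 * L) (by omega) (hS.ball L hL) (hS.growth L) i
  refine h.trans (le_of_eq ?_)
  rw [spreadConst]; push_cast; rw [mul_pow]; ring

lemma Spread.sum_kernel_le (hS : Spread ρ d o S a gS) (hG : ItemGeometry H ρ d g)
    (hd : 6 < d) (ha : 1 ≤ a) (L : ℕ) (hL : 1 ≤ L) (i : V) :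
    ∑ x ∈ S L, kernel ρ d i x ≤ spreadConst d a gS * (L : ℝ) ^ a := by
  have := hS.const_nonneg
  exact (hS.sum_kernel_le_profile hG hd ha L hL i).trans
    (mul_le_of_le_one_right (by positivity) (profile_le_one _ _ _))

lemma Spread.card_le (hS : Spread ρ d o S a gS) (L : ℕ) (hL : 1 ≤ L) :
    ((S L).card : ℝ) ≤ gS * 5 ^ (d - 2 + a) * (L : ℝ) ^ (d - 2 + a) := by
  have h := (hS.growth L o).2 (5 * L) (by omega)
  have hg := hS.nonneg
  rw [Finset.filter_true_of_mem fun x hx => by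
    have := hS.ball L hL x hx
    dsimp only
    omega] at h
  refine h.trans (le_of_eq ?_)
  push_cast; rw [mul_pow]; ring

variable [DecidableEq V]

lemma Spread.sum_tau_le (hS : Spread ρ d o S a gS) (hG : ItemGeometry H ρ d g)
    (hd : 6 < d) (ha : 1 ≤ a) (hC : 0 ≤ C) {F : Finset V}
    (hτ : ∀ i j, tau H p F i j ≤ C * kernel ρ d i j) (L : ℕ) (hL : 1 ≤ L) (i : V) :
    ∑ x ∈ S L, tau H p F i x ≤ C * (spreadConst d a gS * (L : ℝ) ^ a) *
      profile ρ d o (4 * L) i := by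
  calc ∑ x ∈ S L, tau H p F i x ≤ ∑ x ∈ S L, C * kernel ρ d i x :=
        Finset.sum_le_sum fun x _ => hτ i x
    _ = C * ∑ x ∈ S L, kernel ρ d i x := by rw [Finset.mul_sum]
    _ ≤ C * (spreadConst d a gS * (L : ℝ) ^ a * profile ρ d o (4 * L) i) :=
        mul_le_mul_of_nonneg_left (hS.sum_kernel_le_profile hG hd ha L hL i) hC
    _ = _ := by ring

/-- The constant in the bound for the branching of connections. -/
noncomputable def branchConst (d : ℕ) (g C : ℝ) : ℝ := C * (g * (4 ^ d * (10 * d)) * 16)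

lemma ItemGeometry.sum_tau_profile_le (hG : ItemGeometry H ρ d g) (hd : 6 < d) (hC : 0 ≤ C)
    {F : Finset V} (hτ : ∀ i j, tau H p F i j ≤ C * kernel ρ d i j) (o : V) (L : ℕ) (hL : 1 ≤ L)
    (i : V) : ∑ b ∈ F, tau H p F i b * profile ρ d o (4 * L) b ^ 2 ≤
      branchConst d g C * (L : ℝ) ^ 2 * profile ρ d o (4 * L) i := by
  calc _ ≤ ∑ b ∈ F, C * (kernel ρ d i b * profile ρ d o (4 * L) b ^ 2) := by
        refine Finset.sum_le_sum fun b _ => ?_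
        rw [← mul_assoc]
        exact mul_le_mul_of_nonneg_right (hτ i b) (sq_nonneg _)
    _ = C * ∑ b ∈ F, kernel ρ d i b * profile ρ d o (4 * L) b ^ 2 := by rw [Finset.mul_sum]
    _ ≤ C * (g * (4 ^ d * (10 * d)) * ((4 * L : ℕ) : ℝ) ^ 2 * profile ρ d o (4 * L) i) :=
        mul_le_mul_of_nonneg_left (hG.sum_kernel_profile_le hd F o (4 * L) (by omega) i) hC
    _ = _ := by rw [branchConst]; push_cast; ring

/-- All clusters have size at most `c * log L * L ^ (2 + a)`, with high probability. -/
lemma Spread.exists_upper_tail (hS : Spread ρ d o S a gS) (hG : ItemGeometry H ρ d g)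
    (hd : 6 < d) (ha : 1 ≤ a) (hp0 : 0 < p) (hp1 : p ≤ 1) (hC : 0 ≤ C)
    (hτ : ∀ (F : Finset V) i j, tau H p F i j ≤ C * kernel ρ d i j) :
    ∃ c K : ℝ, 0 < c ∧ ∀ L : ℕ, 3 ≤ L → ∀ F : Finset V,
      (PF p F fun ω => ∃ e ∈ S L, c * Real.log L * (L : ℝ) ^ (2 + a) ≤ hits H ↑ω (S L) e) ≤
        K / L := by
  have hg := hG.nonneg o
  have hgS := hS.nonneg
  -- The added ones make both constants at least 1, so that `c` is positive and the power k - 1 of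
  -- the branching factor may be raised to k.
  set c₁ := C * spreadConst d a gS + 1 with hc₁
  set c₂ := branchConst d g C / p ^ 2 + 1 with hc₂
  have hbr : 0 ≤ branchConst d g C := by unfold branchConst; positivity
  have hsc := hS.const_nonneg
  have hc₁0 : 1 ≤ c₁ := by rw [hc₁]; nlinarith [mul_nonneg hC hsc]
  have hc₂0 : 1 ≤ c₂ := by rw [hc₂]; linarith [div_nonneg hbr (sq_nonneg p)]
  set m := d - 2 + a with hm
  -- The factor 8 is 4 from `treeCount_le` times 2 from `k ≤ 2 * log L`. The exponential makes the
  -- moment bound at most e^(-(m + 1) k) ≤ L^(-(m + 1)), against at most const · L^m starting items.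
  set c := 8 * (c₁ * c₂) * Real.exp (m + 1) with hc
  have hcpos : 0 < c := by positivity
  refine ⟨c, gS * 5 ^ m, hcpos, fun L hL F => ?_⟩
  have hL0 : (0 : ℝ) < L := by exact_mod_cast (by omega : 0 < L)
  have hL1 : (1 : ℝ) ≤ L := by exact_mod_cast (by omega : 1 ≤ L)
  have hlog : 1 ≤ Real.log L := by
    rw [Real.le_log_iff_exp_le hL0]
    have h3 : (3 : ℝ) ≤ L := by exact_mod_cast hL
    linarith [Real.exp_one_lt_d9]
  set k := ⌈Real.log L⌉₊ with hk
  have hk1 : 1 ≤ k := Nat.one_le_ceil_iff.2 (by linarith)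
  have hkle : (k : ℝ) ≤ 2 * Real.log L := by
    have := Nat.ceil_lt_add_one (show 0 ≤ Real.log L by linarith)
    linarith
  have hkge : Real.log L ≤ k := Nat.le_ceil _
  set t := c * Real.log L * (L : ℝ) ^ (2 + a) with ht
  have htpos : 0 < t := by positivity
  have hconv : ∀ i, ∑ b ∈ F, tau H p F i b * profile ρ d o (4 * L) b ^ 2 ≤
      (branchConst d g C * (L : ℝ) ^ 2) * profile ρ d o (4 * L) i :=
    hG.sum_tau_profile_le hd hC (hτ F) o L (by omega)
  have h := PF_exists_large_le hG.adj_symm hp0 hp1 F (S L)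
    (C * (spreadConst d a gS * (L : ℝ) ^ a)) (profile ρ d o (4 * L))
    (branchConst d g C * (L : ℝ) ^ 2) (by positivity) (profile_le_one _ _) (by positivity)
    hconv (hS.sum_tau_le hG hd ha hC (hτ F) L (by omega)) k hk1 t htpos
  refine h.trans ?_
  have e1 : C * (spreadConst d a gS * (L : ℝ) ^ a) ≤ c₁ * (L : ℝ) ^ a := by
    rw [hc₁]; nlinarith [pow_pos hL0 a]
  have e2 : branchConst d g C * (L : ℝ) ^ 2 / p ^ 2 ≤ c₂ * (L : ℝ) ^ 2 := by
    have : branchConst d g C * (L : ℝ) ^ 2 / p ^ 2 =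
      branchConst d g C / p ^ 2 * (L : ℝ) ^ 2 := by ring
    rw [this, hc₂]; nlinarith [pow_pos hL0 2]
  have e3 : (branchConst d g C * (L : ℝ) ^ 2 / p ^ 2) ^ (k - 1) ≤ (c₂ * (L : ℝ) ^ 2) ^ k := by
    refine (pow_le_pow_left₀ (by positivity) e2 _).trans (pow_le_pow_right₀ ?_ (by omega))
    exact one_le_mul_of_one_le_of_one_le hc₂0 (one_le_pow₀ hL1)
  have e4 : (treeCount k : ℝ) ≤ (4 * k) ^ k := by exact_mod_cast treeCount_le k
  have e5 : treeCount k * (C * (spreadConst d a gS * (L : ℝ) ^ a)) ^ k *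
      (branchConst d g C * (L : ℝ) ^ 2 / p ^ 2) ^ (k - 1) / t ^ k ≤
      Real.exp (-(m + 1) * k) := by
    calc _ ≤ (4 * k) ^ k * (c₁ * (L : ℝ) ^ a) ^ k * (c₂ * (L : ℝ) ^ 2) ^ k / t ^ k := by gcongr
      _ = ((4 * k) * (c₁ * (L : ℝ) ^ a) * (c₂ * (L : ℝ) ^ 2) / t) ^ k := by
          rw [div_pow, mul_pow (4 * (k : ℝ) * (c₁ * (L : ℝ) ^ a)), mul_pow (4 * (k : ℝ))]
      _ ≤ (Real.exp (-(m + 1))) ^ k := by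
          gcongr
          rw [div_le_iff₀ htpos]
          calc (4 * (k : ℝ)) * (c₁ * (L : ℝ) ^ a) * (c₂ * (L : ℝ) ^ 2)
              ≤ (4 * (2 * Real.log L)) * (c₁ * (L : ℝ) ^ a) * (c₂ * (L : ℝ) ^ 2) := by gcongr
            _ = 8 * (c₁ * c₂) * (Real.exp (m + 1) * Real.exp (-(m + 1))) * Real.log L *
                (L : ℝ) ^ (2 + a) := by
                rw [← Real.exp_add, add_neg_cancel, Real.exp_zero, pow_add]; ring
            _ = _ := by rw [ht, hc]; ring
      _ = _ := by rw [← Real.exp_nat_mul]; ring_nf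
  have e6 : Real.exp (-(m + 1) * k) ≤ 1 / (L : ℝ) ^ (m + 1) := by
    have : (L : ℝ) ^ (m + 1) = Real.exp ((m + 1) * Real.log L) := by
      rw [show ((m : ℝ) + 1) * Real.log L = ((m + 1 : ℕ) : ℝ) * Real.log L by push_cast; ring,
        Real.exp_nat_mul, Real.exp_log hL0]
    rw [this, one_div, ← Real.exp_neg]
    apply Real.exp_le_exp.2
    have hm0 : (0 : ℝ) ≤ m := Nat.cast_nonneg m
    nlinarith
  calc _ ≤ (gS * 5 ^ m * (L : ℝ) ^ m) * (1 / (L : ℝ) ^ (m + 1)) := by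
        refine mul_le_mul (hS.card_le L (by omega)) (e5.trans e6) (by positivity) (by positivity)
    _ = _ := by rw [pow_succ]; field_simp

/-- The existence of many disjoint connected sets of items, each with three items at mutual
distance at least `R`, which have the usual probability of being connected to `A`, `B`, `D`. -/
def HasJunctions (H : V → V → Prop) (ρ : V → V → ℕ) (d : ℕ) (p t₀ : ℝ) (A B D : ℕ → Finset V) :
    Prop :=
  ∀ R : ℕ, ∃ (n : ℕ) (cU : ℝ) (L₀ : ℕ), 0 < cU ∧ ∀ L ≥ L₀,
    ∃ (ι : Type) (U : Finset ι) (N : ι → Finset V) (u v w : ι → V) (F₀ : Finset V),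
      cU * (L : ℝ) ^ d ≤ U.card ∧ (∀ s ∈ U, (N s).card ≤ n ∧ N s ⊆ F₀ ∧ u s ∈ N s ∧ v s ∈ N s ∧
        w s ∈ N s ∧ (∀ a ∈ N s, ∀ b ∈ N s, Conn H (N s : Set V) a b) ∧
        R ≤ ρ (u s) (v s) ∧ R ≤ ρ (u s) (w s) ∧ R ≤ ρ (v s) (w s)) ∧
      (∀ s ∈ U, ∀ t ∈ U, s ≠ t → Disjoint (N s) (N t)) ∧
      ∀ F ⊇ F₀, ∀ s ∈ U, (∀ x ∈ A L, t₀ / (L : ℝ) ^ (d - 2) ≤ tau H p F (u s) x) ∧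
        (∀ x ∈ B L, t₀ / (L : ℝ) ^ (d - 2) ≤ tau H p F (v s) x) ∧
        (∀ x ∈ D L, t₀ / (L : ℝ) ^ (d - 2) ≤ tau H p F (w s) x)

set_option maxHeartbeats 1000000 in
/-- Some cluster which connects `A` and `B` has at least `t` items in `D`, with a probability which
is close to `1` if `t` is small compared to `L ^ (2 + a)`. -/
lemma exists_lower_tail {A B D : ℕ → Finset V} {gA : ℝ} (hA : Spread ρ d o A 1 gA)
    (hB : Spread ρ d o B 1 gA) (hD : Spread ρ d o D a gA) (hG : ItemGeometry H ρ d g)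
    (hd : 6 < d) (ha : 1 ≤ a) (hp0 : 0 < p) (hp1 : p ≤ 1) (hC : 0 ≤ C)
    (hτ : ∀ (F : Finset V) i j, tau H p F i j ≤ C * kernel ρ d i j) {t₀ : ℝ} (ht₀ : 0 < t₀)
    (hAc : ∀ L : ℕ, 1 ≤ L → (L : ℝ) ^ (d - 1) ≤ (A L).card)
    (hBc : ∀ L : ℕ, 1 ≤ L → (L : ℝ) ^ (d - 1) ≤ (B L).card)
    (hDc : ∀ L : ℕ, 1 ≤ L → (L : ℝ) ^ (d - 2 + a) ≤ (D L).card)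
    (hJ : HasJunctions H ρ d p t₀ A B D) :
    ∃ (K : ℝ) (L₀ : ℕ), 0 < K ∧ ∀ L ≥ L₀, ∃ F₀ : Finset V, ∀ F ⊇ F₀, ∀ t : ℝ, 0 < t →
      (PF p F fun ω => ∀ x ∈ A L, ∀ y ∈ B L, Conn H (ω : Set V) x y → hits H ↑ω (D L) x < t) ≤
        K / L + K * t / (L : ℝ) ^ (2 + a) := by
  have hg := hG.nonneg o
  have hgA := hA.nonneg
  have hs1 := hA.const_nonneg
  have hsa := hD.const_nonneg
  set σ₁ := spreadConst d 1 gA with hσ₁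
  set σₐ := spreadConst d a gA with hσₐ
  have hT : 0 ≤ triangleConst d := by unfold triangleConst; positivity
  have hM : 0 ≤ meetConst d g p C := by unfold meetConst; positivity
  have hbr : 0 ≤ branchConst d g C := by unfold branchConst; positivity
  set K₁ := 3 * (C * meetConst d g p C * (σ₁ * σ₁ * σₐ) * (g ^ 2 * triangleConst d)) with hK₁
  -- With this `R` the meeting errors take away at most half of the main term. The choice is
  -- possible because `t₀` does not depend on `R`.
  obtain ⟨R, hR⟩ := exists_nat_gt (2 * K₁ / t₀ ^ 3)
  obtain ⟨n, cU, L₀, hcU, hJR⟩ := hJ R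
  set cZ := p ^ n * (cU * (t₀ ^ 3 / 2)) with hcZ
  have hcZ0 : 0 < cZ := by positivity
  set K₂ := gA * 5 ^ (d - 1) * (treeCount 5 * ((C * σ₁) ^ 3 * (C * σₐ) ^ 2) *
    (branchConst d g C / p ^ 2) ^ 4) with hK₂
  set K₃ := gA * 5 ^ (d - 1) * (C * σ₁) with hK₃
  have hK₂0 : 0 ≤ K₂ := by positivity
  have hK₃0 : 0 ≤ K₃ := by positivity
  refine ⟨4 * K₂ / cZ ^ 2 + 2 * K₃ / cZ + 1, max L₀ 1, by positivity, fun L hL => ?_⟩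
  have hL1 : 1 ≤ L := (le_max_right _ _).trans hL
  obtain ⟨ι, U, N, u, v, w, F₀, hU, hN, hdisj, hlow⟩ := hJR L ((le_max_left _ _).trans hL)
  refine ⟨F₀, fun F hF t ht => ?_⟩
  have hLr : (1 : ℝ) ≤ L := by exact_mod_cast hL1
  have hL0 : (0 : ℝ) < L := by linarith
  obtain ⟨e, rfl⟩ : ∃ e, d = e + 2 := ⟨d - 2, by omega⟩
  simp only [show e + 2 - 2 = e by omega, show e + 2 - 1 = e + 1 by omega] at *
  -- the mean number of triples
  have hZ : cZ * (L : ℝ) ^ (e + 2 + (2 + a)) ≤ EF p F fun ω => triples H (A L) (B L) (D L) ↑ω := by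
    rw [EF_triples]
    have h3 := sum_three_point_ge hG hd hp0 hp1 hC F (hτ F) (A L) (B L) (D L) (σ₁ * (L : ℝ) ^ 1)
      (σ₁ * (L : ℝ) ^ 1) (σₐ * (L : ℝ) ^ a) (t₀ / (L : ℝ) ^ e)
      (hA.sum_kernel_le hG hd le_rfl L hL1) (hB.sum_kernel_le hG hd le_rfl L hL1)
      (hD.sum_kernel_le hG hd ha L hL1) (by positivity) U N u v w n R (fun s hs => (hN s hs).1)
      (fun s hs => (hN s hs).2.1.trans hF) (fun s hs => (hN s hs).2.2.1)
      (fun s hs => (hN s hs).2.2.2.1) (fun s hs => (hN s hs).2.2.2.2.1)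
      (fun s hs => (hN s hs).2.2.2.2.2.1) hdisj (fun s hs => (hN s hs).2.2.2.2.2.2.1)
      (fun s hs => (hN s hs).2.2.2.2.2.2.2.1) (fun s hs => (hN s hs).2.2.2.2.2.2.2.2)
      (fun s hs => (hlow F hF s hs).1) (fun s hs => (hlow F hF s hs).2.1)
      (fun s hs => (hlow F hF s hs).2.2)
    refine le_trans ?_ h3
    -- The exponents are 2 (d - 1) + (d - 2 + a) - 3 (d - 2) = 2 + a.
    have i1 : t₀ ^ 3 * (L : ℝ) ^ (2 + a) ≤
        (A L).card * (B L).card * (D L).card * (t₀ / (L : ℝ) ^ e) ^ 3 := by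
      calc t₀ ^ 3 * (L : ℝ) ^ (2 + a) = (L : ℝ) ^ (e + 1) * (L : ℝ) ^ (e + 1) * (L : ℝ) ^ (e + a) *
            (t₀ / (L : ℝ) ^ e) ^ 3 := by
            rw [div_pow]; field_simp; ring
        _ ≤ _ := by
            have := hAc L hL1
            have := hBc L hL1
            have := hDc L hL1
            gcongr
    have i2 : 3 * (C * meetConst (e + 2) g p C *
        (σ₁ * (L : ℝ) ^ 1 * (σ₁ * (L : ℝ) ^ 1) * (σₐ * (L : ℝ) ^ a)) *
        (g ^ 2 * triangleConst (e + 2) / ((R + 1 : ℕ) : ℝ))) ≤ t₀ ^ 3 / 2 * (L : ℝ) ^ (2 + a) := by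
      have hR1 : (0 : ℝ) < ((R + 1 : ℕ) : ℝ) := by positivity
      have : 3 * (C * meetConst (e + 2) g p C *
        (σ₁ * (L : ℝ) ^ 1 * (σ₁ * (L : ℝ) ^ 1) * (σₐ * (L : ℝ) ^ a)) *
        (g ^ 2 * triangleConst (e + 2) / ((R + 1 : ℕ) : ℝ))) =
          K₁ / ((R + 1 : ℕ) : ℝ) * (L : ℝ) ^ (2 + a) := by
        rw [hK₁, pow_add]; ring
      rw [this]
      refine mul_le_mul_of_nonneg_right ?_ (by positivity)
      rw [div_le_iff₀ hR1]
      rw [div_lt_iff₀ (by positivity)] at hR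
      push_cast
      nlinarith [pow_pos ht₀ 3]
    calc cZ * (L : ℝ) ^ (e + 2 + (2 + a)) = p ^ n * (cU * (L : ℝ) ^ (e + 2) *
          (t₀ ^ 3 * (L : ℝ) ^ (2 + a) - t₀ ^ 3 / 2 * (L : ℝ) ^ (2 + a))) := by
          rw [hcZ, pow_add]; ring
      _ ≤ _ := by
          refine mul_le_mul_of_nonneg_left ?_ (by positivity)
          refine mul_le_mul hU (by linarith) ?_ (Nat.cast_nonneg _)
          have : 0 ≤ t₀ ^ 3 / 2 * (L : ℝ) ^ (2 + a) := by positivity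
          linarith
  have hcard : ((A L).card : ℝ) ≤ gA * 5 ^ (e + 1) * (L : ℝ) ^ (e + 1) := by
    have := hA.card_le L hL1
    rwa [show e + 2 - 2 = e by omega] at this
  -- the fluctuations of the number of triples
  have hmom : ∑ x ∈ A L, moment H p F (squareFamily (A L) (B L) (D L)) Finset.univ x ≤
      K₂ * (L : ℝ) ^ (e + 12 + 2 * a) := by
    have hτL := hτ F
    let Kf : Fin 5 → ℝ := ![C * (σ₁ * (L : ℝ) ^ 1), C * (σₐ * (L : ℝ) ^ a), C * (σ₁ * (L : ℝ) ^ 1),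
      C * (σ₁ * (L : ℝ) ^ 1), C * (σₐ * (L : ℝ) ^ a)]
    have b1 : ∀ x, moment H p F (squareFamily (A L) (B L) (D L)) Finset.univ x ≤
        treeCount 5 * ((C * σ₁) ^ 3 * (C * σₐ) ^ 2 * (L : ℝ) ^ (3 + 2 * a)) *
          (branchConst (e + 2) g C * (L : ℝ) ^ 2 / p ^ 2) ^ 4 := by
      intro x
      have h := moment_le hG.adj_symm hp0 hp1 F (squareFamily (A L) (B L) (D L)) Kf
        (profile ρ (e + 2) o (4 * L)) (branchConst (e + 2) g C * (L : ℝ) ^ 2)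
        (by intro l; fin_cases l <;> simp only [Kf] <;> simp <;> positivity)
        (by positivity) (hG.sum_tau_profile_le hd hC hτL o L hL1)
        (by
          have hA' := hA.sum_tau_le hG hd le_rfl hC hτL L hL1
          have hB' := hB.sum_tau_le hG hd le_rfl hC hτL L hL1
          have hD' := hD.sum_tau_le hG hd ha hC hτL L hL1
          intro l
          fin_cases l
          exacts [hB', hD', hA', hB', hD'])
        Finset.univ Finset.univ_nonempty x
      refine h.trans ?_
      have hprod : ∏ l, Kf l = (C * σ₁) ^ 3 * (C * σₐ) ^ 2 * (L : ℝ) ^ (3 + 2 * a) := by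
        simp only [Fin.prod_univ_five, Kf, Matrix.cons_val]
        ring
      rw [hprod, Finset.card_univ, Fintype.card_fin]
      exact mul_le_of_le_one_right (by positivity) (profile_le_one _ _ _)
    calc _ ≤ ∑ x ∈ A L, _ := Finset.sum_le_sum fun x _ => b1 x
      _ = (A L).card * (treeCount 5 * ((C * σ₁) ^ 3 * (C * σₐ) ^ 2 * (L : ℝ) ^ (3 + 2 * a)) *
          (branchConst (e + 2) g C * (L : ℝ) ^ 2 / p ^ 2) ^ 4) := by
          rw [Finset.sum_const, nsmul_eq_mul]
      _ ≤ (gA * 5 ^ (e + 1) * (L : ℝ) ^ (e + 1)) *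
          (treeCount 5 * ((C * σ₁) ^ 3 * (C * σₐ) ^ 2 * (L : ℝ) ^ (3 + 2 * a)) *
          (branchConst (e + 2) g C * (L : ℝ) ^ 2 / p ^ 2) ^ 4) := by gcongr
      _ = _ := by
          rw [hK₂, show e + 12 + 2 * a = (e + 1) + (3 + 2 * a) + 8 by ring, pow_add, pow_add]
          ring
  -- the mean number of pairs
  have hpairs : ∑ x ∈ A L, ∑ y ∈ B L, tau H p F x y ≤ K₃ * (L : ℝ) ^ (e + 2) := by
    calc _ ≤ ∑ x ∈ A L, C * (σ₁ * (L : ℝ) ^ 1) := by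
          refine Finset.sum_le_sum fun x _ => ?_
          exact (hB.sum_tau_le hG hd le_rfl hC (hτ F) L hL1 x).trans
            (mul_le_of_le_one_right (by positivity) (profile_le_one _ _ _))
      _ = (A L).card * (C * (σ₁ * (L : ℝ) ^ 1)) := by rw [Finset.sum_const, nsmul_eq_mul]
      _ ≤ (gA * 5 ^ (e + 1) * (L : ℝ) ^ (e + 1)) * (C * (σ₁ * (L : ℝ) ^ 1)) := by gcongr
      _ = _ := by rw [hK₃]; ring
  set Z := EF p F fun ω => triples H (A L) (B L) (D L) ↑ω with hZdef
  have hZ' : 0 < cZ * (L : ℝ) ^ (e + 2 + (2 + a)) := by positivity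
  have hZ0 : 0 < Z := hZ'.trans_le hZ
  refine (PF_all_small_le hG.adj_symm hp0.le hp1 F (A L) (B L) (D L) hZ0 t ht).trans ?_
  rw [← hZdef]
  have f1 : 4 * (∑ x ∈ A L, moment H p F (squareFamily (A L) (B L) (D L)) Finset.univ x) / Z ^ 2 ≤
      (4 * K₂ / cZ ^ 2) / L := by
    have hM0 : 0 ≤ K₂ * (L : ℝ) ^ (e + 12 + 2 * a) := by positivity
    calc _ ≤ 4 * (K₂ * (L : ℝ) ^ (e + 12 + 2 * a)) / (cZ * (L : ℝ) ^ (e + 2 + (2 + a))) ^ 2 := by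
          gcongr
      _ = (4 * K₂ / cZ ^ 2) * ((L : ℝ) ^ (e + 12 + 2 * a) / (L : ℝ) ^ (2 * (e + 2 + (2 + a)))) := by
          rw [mul_pow, ← pow_mul]; ring
      _ ≤ (4 * K₂ / cZ ^ 2) * (1 / L) := by
          refine mul_le_mul_of_nonneg_left ?_ (by positivity)
          -- The ratio is L^(6 - d), which is at most 1/L since d > 6.
          rw [div_le_div_iff₀ (by positivity) hL0, one_mul, ← pow_succ]
          exact pow_le_pow_right₀ hLr (by omega)
      _ = _ := by ring
  have f2 : 2 * t * (∑ x ∈ A L, ∑ y ∈ B L, tau H p F x y) / Z ≤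
      (2 * K₃ / cZ) * t / (L : ℝ) ^ (2 + a) := by
    calc _ ≤ 2 * t * (K₃ * (L : ℝ) ^ (e + 2)) / (cZ * (L : ℝ) ^ (e + 2 + (2 + a))) := by gcongr
      _ = _ := by rw [pow_add (L : ℝ) (e + 2)]; field_simp
  refine (add_le_add f1 f2).trans ?_
  have q1 : 0 ≤ 4 * K₂ / cZ ^ 2 := by positivity
  have q2 : 0 ≤ 2 * K₃ / cZ := by positivity
  gcongr <;> linarith

end Scaling


/-! ### The law of a configuration in a finite window. -/

section FiniteWindow

variable {ι : Type*} {u : Set ι} {p : unitInterval}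

/-- The elements of the finite window `F` which belong to `ω`. -/
noncomputable def window (F : Finset u) (ω : Set ι) : Finset u :=
  @Finset.filter u (fun v => v.1 ∈ ω) (Classical.decPred _) F

lemma window_subset (F : Finset u) (ω : Set ι) : window F ω ⊆ F := @Finset.filter_subset _ _ (Classical.decPred _) _

lemma mem_window {F : Finset u} {ω : Set ι} {v : u} : v ∈ window F ω ↔ v ∈ F ∧ v.1 ∈ ω := by
  simp [window]

lemma coe_window_subset (F : Finset u) (ω : Set ι) :
    (window F ω : Set u) ⊆ Subtype.val ⁻¹' ω := fun _ hv =>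
  (mem_window.1 (Finset.mem_coe.1 hv)).2

lemma measurableSet_mem_config (a : ι) : MeasurableSet {ω : Set ι | a ∈ ω} :=
  measurableSet_setOfPred.2 (measurable_set_mem a)

lemma window_eq_iff {F S : Finset u} (hS : S ⊆ F) {ω : Set ι} :
    window F ω = S ↔ ∀ v ∈ F, v.1 ∈ ω ↔ v ∈ S := by
  constructor
  · rintro rfl v hv
    simp [mem_window, hv]
  · intro h
    ext v
    rw [mem_window]
    exact ⟨fun hv => (h v hv.1).1 hv.2, fun hv => ⟨hS hv, (h v (hS hv)).2 hv⟩⟩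

lemma measurableSet_window_eq (F S : Finset u) :
    MeasurableSet {ω : Set ι | window F ω = S} := by
  by_cases hS : S ⊆ F
  · simp only [window_eq_iff hS]
    have : {ω : Set ι | ∀ v ∈ F, v.1 ∈ ω ↔ v ∈ S} = ⋂ v ∈ F, {ω : Set ι | v.1 ∈ ω ↔ v ∈ S} := by
      ext; simp
    rw [this]
    refine Finset.measurableSet_biInter _ fun v _ => ?_
    by_cases hv : v ∈ S
    · simpa [hv] using measurableSet_mem_config v.1
    · simp only [hv, iff_false]
      exact (measurableSet_mem_config v.1).compl
  · convert MeasurableSet.empty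
    ext ω
    simp only [Set.mem_ofPred_eq, Set.mem_empty_iff_false, iff_false]
    rintro rfl
    exact hS (window_subset F ω)

variable [DecidableEq u]

open unitInterval in
lemma setBernoulli_real_window_eq {F S : Finset u} (hS : S ⊆ F) :
    (setBernoulli u p).real {ω | window F ω = S} = weight (p : ℝ) F S := by
  classical
  -- Prescribing the window is a cylinder event for the underlying product measure.
  have hpre : (fun q : ι → Prop => {i | q i}) ⁻¹' {ω : Set ι | window F ω = S} =
      Set.pi (F.map (Function.Embedding.subtype _) : Finset ι)
        fun i => {q : Prop | q ↔ i ∈ S.map (Function.Embedding.subtype _)} := by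
    ext q
    simp only [Set.mem_preimage, Set.mem_ofPred_eq, window_eq_iff hS, Set.mem_pi, Finset.coe_map]
    simp only [Set.mem_image, Finset.mem_coe, Finset.mem_map, forall_exists_index, and_imp,
      forall_apply_eq_imp_iff₂, Function.Embedding.coe_subtype, Subtype.val_inj, exists_eq_right]
  have hmeas : ∀ i ∈ F.map (Function.Embedding.subtype _),
      MeasurableSet {q : Prop | q ↔ i ∈ S.map (Function.Embedding.subtype _)} :=
    fun _ _ => .of_discrete
  rw [Measure.real, setBernoulli_apply', hpre, Measure.infinitePi_pi _ hmeas, Finset.prod_map,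
    ENNReal.toReal_prod]
  have hterm : ∀ v ∈ F, ((toNNReal p • Measure.dirac (v.1 ∈ u) + toNNReal (σ p) •
      Measure.dirac False : Measure Prop) {q : Prop | q ↔ v.1 ∈ S.map (Function.Embedding.subtype _)}).toReal =
      if v ∈ S then (p : ℝ) else 1 - p := by
    intro v _
    have hvS : v.1 ∈ S.map (Function.Embedding.subtype _) ↔ v ∈ S := by simp
    have hv : (v.1 ∈ u) = True := by simp
    simp only [hvS, hv]
    by_cases h : v ∈ S
    · simp [h]
    · simp [h]
  refine (Finset.prod_congr rfl hterm).trans ?_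
  rw [Finset.prod_ite, Finset.prod_const, Finset.prod_const, weight]
  congr 3
  · ext v; simp only [Finset.mem_filter]; exact ⟨fun h => h.2, fun h => ⟨hS h, h⟩⟩
  · ext v; simp

end FiniteWindow

/-! ### From finite windows to infinite volume. -/

section Limit

variable {ι : Type*} {u : Set ι} {p : unitInterval}

lemma measurableSet_window (F : Finset u) (A : Finset u → Prop) :
    MeasurableSet {ω : Set ι | A (window F ω)} := by
  have : {ω : Set ι | A (window F ω)} = ⋃ S ∈ {S | S ∈ F.powerset ∧ A S}, {ω | window F ω = S} := by
    ext ω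
    simp [window_subset]
  rw [this]
  exact MeasurableSet.biUnion ((Finset.countable_toSet F.powerset).mono fun S hS => hS.1)
    fun S _ => measurableSet_window_eq F S

lemma setBernoulli_real_window [DecidableEq u] (F : Finset u) (A : Finset u → Prop) :
    (setBernoulli u p).real {ω | A (window F ω)} = PF (p : ℝ) F A := by
  classical
  have : {ω : Set ι | A (window F ω)} = ⋃ S ∈ F.powerset.filter A, {ω | window F ω = S} := by
    ext ω
    simp [window_subset]
  rw [this, measureReal_biUnion_finset]
  · rw [PF, EF, Finset.sum_filter]
    refine Finset.sum_congr rfl fun S hS => ?_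
    rw [setBernoulli_real_window_eq (Finset.mem_powerset.1 hS)]
    split_ifs with h
    · rw [ind_of_true h, mul_one]
    · rw [ind_of_false h, mul_zero]
  · intro S _ T _ hST
    refine Set.disjoint_left.2 fun ω h h' => hST ?_
    exact h.symm.trans h'
  · exact fun S _ => measurableSet_window_eq F S

/-- Events which are eventually determined by finite windows have the limiting probability. -/
lemma tendsto_PF_atTop [Countable ι] [DecidableEq u] {A : Finset u → Prop} {E : Set ι → Prop}
    (h : ∀ ω, ∀ᶠ F in atTop, (A (window F ω) ↔ E ω)) :
    MeasurableSet {ω | E ω} ∧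
    Tendsto (fun F => PF (p : ℝ) F A) atTop (𝓝 ((setBernoulli u p).real {ω | E ω})) := by
  have hm : MeasurableSet {ω | E ω} := by
    refine measurableSet_of_tendsto_indicator (L := atTop) (A := {ω | E ω})
      (As := fun F : Finset u => {ω | A (window F ω)}) (fun F => measurableSet_window F A) ?_
    exact h
  refine ⟨hm, ?_⟩
  have := tendsto_measure_of_tendsto_indicator_of_isFiniteMeasure (L := atTop) (A := {ω | E ω})
    (setBernoulli u p)
    (As := fun F : Finset u => {ω : Set ι | A (window F ω)}) (fun F => measurableSet_window F A) h
  simp only [← setBernoulli_real_window]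
  exact (ENNReal.tendsto_toReal (measure_ne_top _ _)).comp this

variable {H : u → u → Prop}

/-- A connection uses finitely many items, so a large window contains it, and no window creates a
new one. The items of `B` count as open, for later use with forced end items. -/
lemma eventually_conn_window (ω : Set ι) (i j : u) (B : Set u) :
    ∀ᶠ F in atTop, (Conn H (((window F ω : Finset u) : Set u) ∪ B) i j ↔
      Conn H (Subtype.val ⁻¹' ω ∪ B) i j) := by
  classical
  by_cases hc : Conn H (Subtype.val ⁻¹' ω ∪ B) i j
  · obtain ⟨T, hT, hT'⟩ := hc.exists_finset
    filter_upwards [eventually_ge_atTop T] with F hF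
    refine iff_of_true (hT'.mono fun v hv => ?_) hc
    rcases hT hv with h | h
    · exact .inl (Finset.mem_coe.2 (mem_window.2 ⟨hF hv, h⟩))
    · exact .inr h
  · refine .of_forall fun F => iff_of_false (fun h => hc ?_) hc
    exact h.mono (Set.union_subset_union_left _ (coe_window_subset F ω))

end Limit


/-! ### The sup-distance on the lattice. -/

section Lattice

variable {d : ℕ}

/-- The sup-distance of two sites. -/
def supDist (x y : Site d) : ℕ := Finset.univ.sup fun i => (x i - y i).natAbs

lemma supDist_le_iff {x y : Site d} {k : ℕ} : supDist x y ≤ k ↔ ∀ i, |x i - y i| ≤ k := by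
  simp only [supDist, Finset.sup_le_iff, Finset.mem_univ, true_implies]
  exact forall_congr' fun i => by rw [Int.abs_eq_natAbs, Nat.cast_le]

lemma abs_sub_le_supDist (x y : Site d) (i : Fin d) : |x i - y i| ≤ supDist x y :=
  supDist_le_iff.1 le_rfl i

@[simp] lemma supDist_self (x : Site d) : supDist x x = 0 :=
  Nat.le_zero.1 (supDist_le_iff.2 fun i => by simp)

lemma supDist_comm (x y : Site d) : supDist x y = supDist y x := by
  unfold supDist
  exact Finset.sup_congr rfl fun i _ => by omega

lemma supDist_triangle (x y z : Site d) : supDist x z ≤ supDist x y + supDist y z := by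
  refine supDist_le_iff.2 fun i => ?_
  have h1 := abs_sub_le_supDist x y i
  have h2 := abs_sub_le_supDist y z i
  have := abs_sub_le (x i) (y i) (z i)
  push_cast; omega

lemma eq_of_supDist_eq_zero {x y : Site d} (h : supDist x y = 0) : x = y := by
  funext i
  have := abs_sub_le_supDist x y i
  rw [h] at this
  have := abs_nonneg (x i - y i)
  have h0 : |x i - y i| = 0 := by push_cast at *; omega
  have := abs_eq_zero.1 h0
  omega

lemma supDist_le_one_of_adj {x y : Site d} (h : (lattice d).Adj x y) : supDist x y ≤ 1 := by
  refine supDist_le_iff.2 fun i => ?_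
  have h : ∑ i, |x i - y i| = 1 := h
  rw [Nat.cast_one, ← h]
  exact Finset.single_le_sum (f := fun i => |x i - y i|) (fun _ _ => abs_nonneg _) (Finset.mem_univ i)

/-- The sup-norm ball with radius `k` around `x`. -/
noncomputable def ball (x : Site d) (k : ℕ) : Finset (Site d) :=
  Finset.Icc (fun i => x i - k) fun i => x i + k

lemma mem_ball {x y : Site d} {k : ℕ} : y ∈ ball x k ↔ supDist x y ≤ k := by
  rw [ball, Finset.mem_Icc, supDist_le_iff, Pi.le_def, Pi.le_def, ← forall_and]
  exact forall_congr' fun i => by rw [abs_le]; constructor <;> intro h <;> constructor <;> linarith [h.1, h.2]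

lemma card_ball (x : Site d) (k : ℕ) : (ball x k).card = (2 * k + 1) ^ d := by
  rw [ball, Pi.card_Icc]
  simp only [Int.card_Icc]
  rw [Finset.prod_congr rfl (g := fun _ => 2 * k + 1) fun i _ => by omega]
  simp

lemma mem_box {L : ℕ} {x : Site d} : x ∈ box d L ↔ ∀ i, -(L : ℤ) ≤ x i ∧ x i ≤ L := by
  rw [box, Finset.mem_Icc, Pi.le_def, Pi.le_def, ← forall_and]

/-- The unit step in the direction `i`. -/
def step (i : Fin d) (t : ℤ) : Site d := Pi.single i t

lemma adj_add_step (i : Fin d) (x : Site d) : (lattice d).Adj x (x + step i 1) := by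
  change ∑ j, |x j - (x + step i 1) j| = 1
  rw [Finset.sum_eq_single i]
  · simp [step]
  · intro j _ hj; simp [step, hj]
  · simp

lemma supDist_add_step (i : Fin d) (x : Site d) (s t : ℤ) :
    supDist (x + step i s) (x + step i t) = (s - t).natAbs := by
  refine le_antisymm (supDist_le_iff.2 fun j => ?_) ?_
  · by_cases hj : j = i
    · subst hj; simp [step]
    · simp [step, hj]
  · have := abs_sub_le_supDist (x + step i s) (x + step i t) i
    simp only [step, Pi.add_apply, Pi.single_eq_same] at this
    rw [add_sub_add_left_eq_sub] at this
    simp only [step]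
    rw [Int.abs_eq_natAbs] at this
    exact_mod_cast this

lemma supDist_le_euclDist (x y : Site d) : (supDist x y : ℝ) ≤ euclDist x y := by
  have key : ∀ i, ((x i - y i).natAbs : ℝ) ≤ euclDist x y := by
    intro i
    rw [euclDist]
    refine Real.le_sqrt_of_sq_le ?_
    have : (((x i - y i).natAbs : ℝ)) ^ 2 = ((x i : ℝ) - y i) ^ 2 := by
      rw [Nat.cast_natAbs, Int.cast_abs, sq_abs]; push_cast; rfl
    rw [this]
    exact Finset.single_le_sum (f := fun i => ((x i : ℝ) - y i) ^ 2) (fun _ _ => sq_nonneg _)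
      (Finset.mem_univ i)
  rcases Finset.univ.eq_empty_or_nonempty (α := Fin d) with h | h
  · simp [supDist, h, euclDist]
  · obtain ⟨i, _, hi⟩ := Finset.exists_mem_eq_sup Finset.univ h fun i => (x i - y i).natAbs
    rw [supDist, hi]; exact key i

lemma euclDist_le (x y : Site d) : euclDist x y ≤ d * supDist x y := by
  rw [euclDist]
  refine Real.sqrt_le_iff.2 ⟨by positivity, ?_⟩
  have h1 : ∀ i ∈ Finset.univ, ((x i : ℝ) - y i) ^ 2 ≤ (supDist x y : ℝ) ^ 2 := by
    intro i _
    have := abs_sub_le_supDist x y i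
    have h2 : |(x i : ℝ) - y i| ≤ supDist x y := by exact_mod_cast this
    exact sq_le_sq' (by linarith [neg_abs_le ((x i : ℝ) - y i)]) ((le_abs_self _).trans h2)
  refine (Finset.sum_le_sum h1).trans ?_
  rw [Finset.sum_const, Finset.card_univ, Fintype.card_fin, nsmul_eq_mul, mul_pow]
  gcongr
  rcases Nat.eq_zero_or_pos d with h | h
  · simp [h]
  · have : (1 : ℝ) ≤ d := by exact_mod_cast h
    nlinarith

end Lattice

/-! ### Bonds and sites as items; connectedness of sites through items. -/

section Items

variable {M : Model} {d : ℕ}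

/-- The item `v` contains the site `x`. -/
def Incident : {M : Model} → Item M d → Site d → Prop
  | .bond, v, x => x ∈ (show Sym2 (Site d) from v)
  | .site, v, x => v = x

/-- The relation of sites through which open items are linked. -/
def Link (d : ℕ) : Model → Site d → Site d → Prop
  | .bond, x, y => x = y
  | .site, x, y => (lattice d).Adj x y

/-- The graph of the items. -/
def itemAdj (a b : candidates M d) : Prop := ∃ x y, Incident a.1 x ∧ Incident b.1 y ∧ Link d M x y

lemma itemAdj_symm ⦃a b : candidates M d⦄ (h : itemAdj a b) : itemAdj b a := by
  obtain ⟨x, y, hx, hy, h⟩ := h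
  refine ⟨y, x, hy, hx, ?_⟩
  cases M
  · exact Eq.symm h
  · exact SimpleGraph.Adj.symm h

lemma exists_incident (v : candidates M d) : ∃ x, Incident v.1 x := by
  cases M
  · exact ⟨_, Sym2.out_fst_mem v.1⟩
  · exact ⟨v.1, rfl⟩

/-- A site in the item `v`. -/
noncomputable def position (v : candidates M d) : Site d := (exists_incident v).choose

lemma incident_position (v : candidates M d) : Incident v.1 (position v) := (exists_incident v).choose_spec

lemma adj_or_eq_of_incident {v : Sym2 (Site d)} (hv : v ∈ (lattice d).edgeSet) {x y : Site d}
    (hx : x ∈ v) (hy : y ∈ v) : x = y ∨ v = s(x, y) ∧ (lattice d).Adj x y := by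
  by_cases h : x = y
  · exact .inl h
  · have := (Sym2.mem_and_mem_iff h).1 ⟨hx, hy⟩
    subst this
    exact .inr ⟨rfl, hv⟩

lemma supDist_le_one_of_incident (v : candidates M d) {x y : Site d} (hx : Incident v.1 x)
    (hy : Incident v.1 y) : supDist x y ≤ 1 := by
  cases M
  · rcases adj_or_eq_of_incident v.2 hx hy with rfl | h
    · simp
    · exact supDist_le_one_of_adj h.2
  · have : x = y := Eq.trans (Eq.symm hx) hy
    simp [this]

lemma supDist_position_le_of_adj {a b : candidates M d} (h : itemAdj a b) :
    supDist (position a) (position b) ≤ 2 := by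
  obtain ⟨x, y, hx, hy, h⟩ := h
  cases M
  · have h1 := supDist_le_one_of_incident a (incident_position a) hx
    have h2 := supDist_le_one_of_incident b hy (incident_position b)
    obtain rfl : x = y := h
    exact (supDist_triangle _ x _).trans (by omega)
  · have h1 : position a = x := Eq.trans (Eq.symm (incident_position a)) hx
    have h2 : position b = y := Eq.trans (Eq.symm (incident_position b)) hy
    rw [h1, h2]
    exact (supDist_le_one_of_adj h).trans (by omega)

/-- An item at `x` is determined by a site of `ball x 1`: the other end of the bond, or `x` itself.
-/
lemma exists_items_at (x : Site d) : ∃ T : Finset (candidates M d),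
    (∀ v, v ∈ T ↔ Incident v.1 x) ∧ T.card ≤ 3 ^ d := by
  classical
  obtain ⟨f, hf⟩ : ∃ f : Site d → Item M d,
      ∀ v : candidates M d, Incident v.1 x → v.1 ∈ (ball x 1).image f := by
    cases M
    · refine ⟨fun y => s(x, y), fun v hv => ?_⟩
      obtain ⟨y, hy⟩ := (Sym2.mem_iff_exists (z := (show Sym2 (Site d) from v.1))).1 hv
      refine Finset.mem_image.2 ⟨y, ?_, hy.symm⟩
      refine mem_ball.2 (supDist_le_one_of_incident v hv ?_)
      exact Sym2.mem_iff_exists.2 ⟨x, hy.trans Sym2.eq_swap⟩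
    · refine ⟨fun y => y, fun v hv => ?_⟩
      exact Finset.mem_image.2 ⟨x, mem_ball.2 (by simp), Eq.symm hv⟩
  have hfin : {v : candidates M d | Incident v.1 x}.Finite := by
    refine Set.Finite.of_finite_image (f := Subtype.val) ?_ Subtype.val_injective.injOn
    refine ((ball x 1).image f).finite_toSet.subset ?_
    rintro _ ⟨v, hv, rfl⟩
    exact hf v hv
  refine ⟨hfin.toFinset, fun v => by simp, ?_⟩
  calc hfin.toFinset.card = (hfin.toFinset.map (Function.Embedding.subtype _)).card := by simp
    _ ≤ ((ball x 1).image f).card := by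
        refine Finset.card_le_card fun v hv => ?_
        obtain ⟨w, hw, rfl⟩ := Finset.mem_map.1 hv
        exact hf w (by simpa using hw)
    _ ≤ (ball x 1).card := Finset.card_image_le
    _ = 3 ^ d := by rw [card_ball]

/-- The items which contain the site `x`. -/
noncomputable def itemsAt (M : Model) (x : Site d) : Finset (candidates M d) := (exists_items_at x).choose

lemma mem_itemsAt {x : Site d} {v : candidates M d} : v ∈ itemsAt M x ↔ Incident v.1 x :=
  (exists_items_at x).choose_spec.1 v

lemma card_itemsAt_le (x : Site d) : (itemsAt M x).card ≤ 3 ^ d := (exists_items_at x).choose_spec.2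

lemma Connected.symm {ω : Config M d} {x y : Site d} (h : Connected ω x y) : Connected ω y x := by
  cases M
  · exact SimpleGraph.Reachable.symm h
  · exact ⟨h.2.1, h.1, h.2.2.symm⟩

lemma Connected.trans {ω : Config M d} {x y z : Site d} (h : Connected ω x y)
    (h' : Connected ω y z) : Connected ω x z := by
  cases M
  · exact SimpleGraph.Reachable.trans h h'
  · exact ⟨h.1, h'.2.1, h.2.2.trans h'.2.2⟩

lemma connected_of_incident {ω : Config M d} {v : candidates M d} (hv : v.1 ∈ ω) {x y : Site d}
    (hx : Incident v.1 x) (hy : Incident v.1 y) : Connected ω x y := by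
  cases M
  · rcases adj_or_eq_of_incident v.2 hx hy with rfl | ⟨h, h'⟩
    · exact SimpleGraph.Reachable.refl _
    · refine SimpleGraph.Adj.reachable ⟨h', ?_⟩
      exact (SimpleGraph.fromEdgeSet_adj _).2 ⟨h ▸ hv, h'.ne⟩
  · obtain rfl : v.1 = x := hx
    obtain rfl : v.1 = y := hy
    exact ⟨hv, hv, SimpleGraph.Reachable.refl _⟩

lemma connected_of_link {ω : Config M d} {a b : candidates M d} (ha : a.1 ∈ ω) (hb : b.1 ∈ ω)
    {x y : Site d} (hx : Incident a.1 x) (hy : Incident b.1 y) (h : Link d M x y) :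
    Connected ω x y := by
  cases M
  · obtain rfl : x = y := h
    exact SimpleGraph.Reachable.refl _
  · obtain rfl : a.1 = x := hx
    obtain rfl : b.1 = y := hy
    exact ⟨ha, hb, SimpleGraph.Adj.reachable ⟨h, ha, hb⟩⟩

lemma connected_of_conn {ω : Config M d} {a b : candidates M d}
    (h : Conn itemAdj (Subtype.val ⁻¹' ω) a b) {x y : Site d}
    (hx : Incident a.1 x) (hy : Incident b.1 y) : Connected ω x y := by
  have key : b.1 ∈ ω ∧ ∀ y, Incident b.1 y → Connected ω x y := by
    refine h.induction ⟨h.left_mem, fun y hy => connected_of_incident h.left_mem hx hy⟩ ?_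
    rintro b c _ ⟨hb, ih⟩ ⟨z, z', hz, hz', hl⟩ hc
    exact ⟨hc, fun y hy => ((ih z hz).trans (connected_of_link hb hc hz hz' hl)).trans
      (connected_of_incident hc hz' hy)⟩
  exact key.2 y hy

/-- The alternative `x = y` is needed for bonds, where a site is connected to itself without any
open item. -/
lemma exists_conn_of_connected {ω : Config M d} {x y : Site d} (h : Connected ω x y) :
    x = y ∨ ∃ a b : candidates M d, Incident a.1 x ∧ Incident b.1 y ∧
      Conn itemAdj (Subtype.val ⁻¹' ω) a b := by
  cases M
  · replace h : Relation.ReflTransGen (bondGraph ω).Adj x y :=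
      (SimpleGraph.reachable_iff_reflTransGen _ _).1 h
    induction h with
    | refl => exact .inl rfl
    | @tail y z _ hyz ih =>
      right
      have hmem : s(y, z) ∈ (show Set (Sym2 (Site d)) from ω) := ((SimpleGraph.fromEdgeSet_adj _).1 hyz.2).1
      let e : candidates .bond d := ⟨s(y, z), hyz.1⟩
      have hey : Incident e.1 y := Sym2.mem_mk_left y z
      have hez : Incident e.1 z := Sym2.mem_mk_right y z
      have heω : e ∈ (Subtype.val ⁻¹' ω : Set (candidates .bond d)) := hmem
      rcases ih with rfl | ⟨a, b, ha, hb, hab⟩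
      · exact ⟨e, e, hey, hez, .refl heω⟩
      · exact ⟨a, e, ha, hez, hab.tail ⟨y, y, hb, hey, rfl⟩ heω⟩
  · right
    obtain ⟨hx, -, h⟩ := h
    replace h : Relation.ReflTransGen (siteGraph ω).Adj x y :=
      (SimpleGraph.reachable_iff_reflTransGen _ _).1 h
    refine ⟨⟨x, trivial⟩, ⟨y, trivial⟩, rfl, rfl, ?_⟩
    induction h with
    | refl => exact .refl hx
    | @tail y z _ hyz ih => exact ih.tail ⟨y, z, rfl, rfl, hyz.1⟩ hyz.2.2

lemma eq_or_itemAdj_of_incident {a b : candidates M d} {x : Site d} (ha : Incident a.1 x)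
    (hb : Incident b.1 x) : a = b ∨ itemAdj a b := by
  cases M
  · exact .inr ⟨x, x, ha, hb, rfl⟩
  · exact .inl (Subtype.ext (Eq.trans ha (Eq.symm hb)))

variable (i₀ : Fin d)

/-- A canonical item which contains the site `x`. -/
def itemOf (M : Model) (i₀ : Fin d) (x : Site d) : candidates M d :=
  match M with
  | .bond => ⟨s(x, x + step i₀ 1), adj_add_step i₀ x⟩
  | .site => ⟨x, trivial⟩

lemma incident_itemOf (x : Site d) : Incident (itemOf M i₀ x).1 x := by
  cases M
  · exact Sym2.mem_mk_left _ _
  · rfl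

lemma itemOf_injective : Function.Injective (itemOf M i₀) := by
  intro x y h
  cases M
  · have h : s(x, x + step i₀ 1) = s(y, y + step i₀ 1) := congrArg Subtype.val h
    rcases Sym2.eq_iff.1 h with h | ⟨h1, h2⟩
    · exact h.1
    · have e1 := congrFun h1 i₀
      have e2 := congrFun h2 i₀
      simp only [step, Pi.add_apply, Pi.single_eq_same] at e1 e2
      omega
  · exact congrArg Subtype.val h

lemma itemAdj_itemOf (x : Site d) : itemAdj (itemOf M i₀ x) (itemOf M i₀ (x + step i₀ 1)) := by
  cases M
  · exact ⟨x + step i₀ 1, x + step i₀ 1, Sym2.mem_mk_right _ _, Sym2.mem_mk_left _ _, rfl⟩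
  · exact ⟨x, x + step i₀ 1, rfl, rfl, adj_add_step i₀ x⟩

/-- The canonical items at the two ends need not be open; declared open, they attach to the path. -/
lemma conn_itemOf_of_connected {ω : Config M d} {x y : Site d} (h : Connected ω x y) :
    Conn itemAdj (Subtype.val ⁻¹' ω ∪ {itemOf M i₀ x, itemOf M i₀ y}) (itemOf M i₀ x)
      (itemOf M i₀ y) := by
  set B : Set (candidates M d) := {itemOf M i₀ x, itemOf M i₀ y}
  have hx : itemOf M i₀ x ∈ Subtype.val ⁻¹' ω ∪ B := .inr (.inl rfl)
  have hy : itemOf M i₀ y ∈ Subtype.val ⁻¹' ω ∪ B := .inr (.inr rfl)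
  rcases exists_conn_of_connected h with rfl | ⟨a, b, ha, hb, hab⟩
  · exact .refl hx
  · have hab : Conn itemAdj (Subtype.val ⁻¹' ω ∪ B) a b := hab.mono Set.subset_union_left
    have h1 : Conn itemAdj (Subtype.val ⁻¹' ω ∪ B) (itemOf M i₀ x) a := by
      rcases eq_or_itemAdj_of_incident (incident_itemOf i₀ x) ha with h | h
      · rw [← h]; exact .refl hx
      · exact .single hx hab.left_mem h
    have h2 : Conn itemAdj (Subtype.val ⁻¹' ω ∪ B) b (itemOf M i₀ y) := by
      rcases eq_or_itemAdj_of_incident (incident_itemOf i₀ y) hb with h | h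
      · rw [← h]; exact .refl hy
      · exact .single hab.right_mem hy (itemAdj_symm h)
    exact (h1.trans hab).trans h2

instance : Countable (Item M d) := by
  cases M
  · exact inferInstanceAs (Countable (Sym2 (Site d)))
  · exact inferInstanceAs (Countable (Site d))

end Items


/-! ### Growth and size of boxes, faces and boundaries. -/

section Families

variable {M : Model} {d : ℕ}

noncomputable instance : DecidableEq (candidates M d) := Classical.decEq _

/-- The distance of two items. -/
noncomputable def itemDist (a b : candidates M d) : ℕ := supDist (position a) (position b)

/-- The items which contain a site of `T`. -/
noncomputable def itemsIn (M : Model) (T : Finset (Site d)) : Finset (candidates M d) :=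
  T.biUnion (itemsAt M)

lemma mem_itemsIn {T : Finset (Site d)} {v : candidates M d} :
    v ∈ itemsIn M T ↔ ∃ x ∈ T, Incident v.1 x := by
  simp only [itemsIn, Finset.mem_biUnion, mem_itemsAt]

lemma card_itemsIn_le (T : Finset (Site d)) : (itemsIn M T).card ≤ T.card * 3 ^ d :=
  Finset.card_biUnion_le_card_mul _ _ _ fun x _ => card_itemsAt_le x

lemma itemGeometry (M : Model) (d : ℕ) :
    ItemGeometry (itemAdj (M := M) (d := d)) itemDist d (6 ^ d) where
  adj_symm := itemAdj_symm
  dist_self _ := supDist_self _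
  dist_comm _ _ := supDist_comm _ _
  dist_triangle _ _ _ := supDist_triangle _ _ _
  dist_le_of_adj _ _ h := supDist_position_le_of_adj h
  card_le a k S hS := by
    have h1 : S ⊆ itemsIn M (ball (position a) k) := fun v hv =>
      mem_itemsIn.2 ⟨position v, mem_ball.2 (hS v hv), incident_position v⟩
    have h2 := (Finset.card_le_card h1).trans (card_itemsIn_le _)
    rw [card_ball] at h2
    -- There are (2k + 1)^d sites in the ball, with at most 3^d items at each of them.
    calc (S.card : ℝ) ≤ (((2 * k + 1) ^ d * 3 ^ d : ℕ) : ℝ) := by exact_mod_cast h2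
      _ = (3 * (2 * (k : ℝ) + 1)) ^ d := by push_cast; rw [← mul_pow, mul_comm]
      _ ≤ (6 * ((k : ℝ) + 1)) ^ d := pow_le_pow_left₀ (by positivity) (by linarith) d
      _ = _ := mul_pow _ _ _

/-- The sites of an item are at distance at most one from its position, and the shift by one in the
label absorbs this. -/
lemma growthLE_itemsIn {T : Finset (Site d)} {q : ℝ} {m : ℕ}
    (hT : ∀ (x : Site d) (k : ℕ), 1 ≤ k → ((T ∩ ball x k).card : ℝ) ≤ q * (k : ℝ) ^ m)
    (i : candidates M d) :
    GrowthLE (itemsIn M T) (fun j => itemDist i j + 1) (3 ^ d * q) m := by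
  refine ⟨fun _ _ => Nat.le_add_left 1 _, fun k hk => ?_⟩
  have h1 : ((itemsIn M T).filter fun j => itemDist i j + 1 ≤ k) ⊆
      itemsIn M (T ∩ ball (position i) k) := by
    intro v hv
    obtain ⟨hv, hvk⟩ := Finset.mem_filter.1 hv
    obtain ⟨x, hx, hvx⟩ := mem_itemsIn.1 hv
    refine mem_itemsIn.2 ⟨x, Finset.mem_inter.2 ⟨hx, mem_ball.2 ?_⟩, hvx⟩
    have h2 := supDist_le_one_of_incident v (incident_position v) hvx
    have h3 := supDist_triangle (position i) (position v) x
    unfold itemDist at hvk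
    omega
  have h2 : ((((itemsIn M T).filter fun j => itemDist i j + 1 ≤ k).card : ℕ) : ℝ) ≤
      (((T ∩ ball (position i) k).card * 3 ^ d : ℕ) : ℝ) := by
    exact_mod_cast (Finset.card_le_card h1).trans (card_itemsIn_le _)
  refine h2.trans ?_
  push_cast
  calc _ ≤ (q * (k : ℝ) ^ m) * 3 ^ d := by gcongr; exact hT _ k hk
    _ = _ := by ring

lemma box_eq_ball (L : ℕ) : box d L = ball 0 L := by
  rw [box, ball]
  congr 1 <;> funext i <;> simp

lemma spread_itemsIn {i₀ : Fin d} {T : ℕ → Finset (Site d)} {q : ℝ} {a : ℕ}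
    (hT : ∀ (L : ℕ) (x : Site d) (k : ℕ), 1 ≤ k →
      ((T L ∩ ball x k).card : ℝ) ≤ q * (k : ℝ) ^ (d - 2 + a))
    (hTb : ∀ L, T L ⊆ box d L) :
    Spread itemDist d (itemOf M i₀ 0) (fun L => itemsIn M (T L)) a (3 ^ d * q) where
  growth L i := growthLE_itemsIn (hT L) i
  ball L hL v hv := by
    obtain ⟨x, hx, hvx⟩ := mem_itemsIn.1 hv
    have h1 := supDist_le_one_of_incident v hvx (incident_position v)
    have h2 := supDist_le_one_of_incident (itemOf M i₀ 0) (incident_position _) (incident_itemOf i₀ 0)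
    have h3 : supDist 0 x ≤ L := mem_ball.1 (box_eq_ball (d := d) L ▸ hTb L hx)
    have h4 := supDist_triangle (position (itemOf M i₀ 0)) 0 (position v)
    have h5 := supDist_triangle 0 x (position v)
    -- Passing from sites to items adds at most 2 to the radius L, and L + 2 ≤ 4L.
    unfold itemDist
    omega

lemma Spread.subset {V : Type*} {ρ : V → V → ℕ} {o : V} {S S' : ℕ → Finset V} {a : ℕ} {gS : ℝ}
    (hS : Spread ρ d o S a gS) (h : ∀ L, S' L ⊆ S L) : Spread ρ d o S' a gS where
  growth L i := (hS.growth L i).subset (h L)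
  ball L hL x hx := hS.ball L hL x (h L hx)

/-- The sites of a ball in the hyperplane `x i = s`. -/
noncomputable def slab (x : Site d) (k : ℕ) (i : Fin d) (s : ℤ) : Finset (Site d) :=
  Fintype.piFinset fun j => if j = i then {s} else Finset.Icc (x j - k) (x j + k)

lemma mem_slab {x y : Site d} {k : ℕ} {i : Fin d} {s : ℤ} :
    y ∈ slab x k i s ↔ y i = s ∧ ∀ j, j ≠ i → x j - k ≤ y j ∧ y j ≤ x j + k := by
  simp only [slab, Fintype.mem_piFinset]
  constructor
  · intro h
    refine ⟨by simpa using h i, fun j hj => ?_⟩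
    simpa [hj] using h j
  · rintro ⟨h1, h2⟩ j
    by_cases hj : j = i
    · subst hj; simpa using h1
    · simpa [hj] using h2 j hj

lemma card_slab (x : Site d) (k : ℕ) (i : Fin d) (s : ℤ) :
    (slab x k i s).card = (2 * k + 1) ^ (d - 1) := by
  rw [slab, Fintype.card_piFinset]
  rw [Finset.prod_congr rfl (g := fun j => if j = i then 1 else 2 * k + 1) fun j _ => by
    split_ifs
    · simp
    · simp only [Int.card_Icc]; omega]
  rw [Finset.prod_ite, Finset.prod_const_one, one_mul, Finset.prod_const, Finset.filter_ne',
    Finset.card_erase_of_mem (Finset.mem_univ i), Finset.card_univ, Fintype.card_fin]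

lemma slab_subset_box {L : ℕ} {i : Fin d} {s : ℤ} (hs : |s| ≤ L) : slab 0 L i s ⊆ box d L := by
  intro y hy
  obtain ⟨h1, h2⟩ := mem_slab.1 hy
  refine mem_box.2 fun j => ?_
  by_cases hj : j = i
  · subst hj; rw [h1]; exact abs_le.1 hs
  · simpa using h2 j hj

lemma slab_subset_boundary {L : ℕ} {i : Fin d} {s : ℤ} (hs : s = -(L : ℤ) ∨ s = L) :
    slab 0 L i s ⊆ boundary d L := by
  intro y hy
  refine Finset.mem_filter.2 ⟨slab_subset_box ?_ hy, i, ?_⟩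
  · rcases hs with rfl | rfl <;> simp
  · rwa [(mem_slab.1 hy).1]

lemma three_pow_bound (k m : ℕ) (hk : 1 ≤ k) : (2 * (k : ℝ) + 1) ^ m ≤ 3 ^ m * (k : ℝ) ^ m := by
  have : (1 : ℝ) ≤ k := by exact_mod_cast hk
  rw [← mul_pow]
  gcongr; linarith

/-- The factor 2d is not needed here; it makes the constant the same as for the boundary. -/
lemma card_box_inter_ball_le (hd : 6 < d) (L : ℕ) (x : Site d) (k : ℕ) (hk : 1 ≤ k) :
    ((box d L ∩ ball x k).card : ℝ) ≤ (2 * d * 3 ^ d) * (k : ℝ) ^ (d - 2 + 2) := by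
  have h1 : ((box d L ∩ ball x k).card : ℝ) ≤ (((2 * k + 1) ^ d : ℕ) : ℝ) := by
    rw [← card_ball x k]
    exact_mod_cast Finset.card_le_card Finset.inter_subset_right
  have hd1 : (1 : ℝ) ≤ 2 * d := by
    have : (6 : ℝ) < d := by exact_mod_cast hd
    linarith
  rw [show d - 2 + 2 = d by omega]
  push_cast at h1
  refine h1.trans ((three_pow_bound k d hk).trans ?_)
  rw [mul_assoc]
  exact le_mul_of_one_le_left (by positivity) hd1

lemma card_boundary_inter_ball_le (hd : 6 < d) (L : ℕ) (x : Site d) (k : ℕ) (hk : 1 ≤ k) :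
    ((boundary d L ∩ ball x k).card : ℝ) ≤ (2 * d * 3 ^ d) * (k : ℝ) ^ (d - 2 + 1) := by
  have h1 : boundary d L ∩ ball x k ⊆
      Finset.univ.biUnion fun i : Fin d => slab x k i (-L) ∪ slab x k i L := by
    intro y hy
    obtain ⟨hy, hyk⟩ := Finset.mem_inter.1 hy
    obtain ⟨-, i, hi⟩ := Finset.mem_filter.1 hy
    refine Finset.mem_biUnion.2 ⟨i, Finset.mem_univ i, Finset.mem_union.2 ?_⟩
    have : ∀ j, j ≠ i → x j - k ≤ y j ∧ y j ≤ x j + k := fun j _ => by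
      have := Finset.mem_Icc.1 hyk
      exact ⟨this.1 j, this.2 j⟩
    exact hi.imp (fun h => mem_slab.2 ⟨h, this⟩) fun h => mem_slab.2 ⟨h, this⟩
  have h2 : (boundary d L ∩ ball x k).card ≤ d * (2 * (2 * k + 1) ^ (d - 1)) := by
    refine (Finset.card_le_card h1).trans ?_
    refine (Finset.card_biUnion_le_card_mul _ _ (2 * (2 * k + 1) ^ (d - 1)) fun i _ => ?_).trans
      (le_of_eq (by simp))
    refine (Finset.card_union_le _ _).trans (le_of_eq ?_)
    rw [card_slab, card_slab]; ring
  have h3 : ((boundary d L ∩ ball x k).card : ℝ) ≤ d * (2 * (2 * (k : ℝ) + 1) ^ (d - 1)) := by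
    exact_mod_cast h2
  rw [show d - 2 + 1 = d - 1 by omega]
  calc _ ≤ d * (2 * (3 ^ (d - 1) * (k : ℝ) ^ (d - 1))) := by
        refine h3.trans ?_
        gcongr
        exact three_pow_bound k _ hk
    _ ≤ d * (2 * (3 ^ d * (k : ℝ) ^ (d - 1))) := by
        gcongr
        · norm_num
        · omega
    _ = _ := by ring

lemma card_image_itemOf (i₀ : Fin d) (T : Finset (Site d)) :
    (T.image (itemOf M i₀)).card = T.card :=
  Finset.card_image_of_injective _ (itemOf_injective i₀)

lemma image_itemOf_subset (i₀ : Fin d) (T : Finset (Site d)) :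
    T.image (itemOf M i₀) ⊆ itemsIn M T := by
  intro v hv
  obtain ⟨x, hx, rfl⟩ := Finset.mem_image.1 hv
  exact mem_itemsIn.2 ⟨x, hx, incident_itemOf i₀ x⟩

lemma pow_le_card_slab (x : Site d) (L : ℕ) (i : Fin d) (s : ℤ) :
    (L : ℝ) ^ (d - 1) ≤ ((slab x L i s).card : ℝ) := by
  rw [card_slab]
  push_cast
  gcongr; linarith

lemma pow_le_card_box (L : ℕ) : (L : ℝ) ^ d ≤ ((box d L).card : ℝ) := by
  rw [box_eq_ball, card_ball]
  push_cast
  gcongr; linarith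

lemma pow_le_card_boundary (i : Fin d) (L : ℕ) : (L : ℝ) ^ (d - 1) ≤ ((boundary d L).card : ℝ) :=
  (pow_le_card_slab 0 L i L).trans (by exact_mod_cast Finset.card_le_card (slab_subset_boundary (.inr rfl)))

end Families


/-! ### The power law for items, and the construction of the junctions. -/

section TwoPoint

variable {M : Model} {d : ℕ}

instance (p : unitInterval) : IsProbabilityMeasure (law M d p) :=
  inferInstanceAs (IsProbabilityMeasure (setBernoulli (candidates M d) p))

lemma law_real_window (p : unitInterval) (F : Finset (candidates M d))
    (A : Finset (candidates M d) → Prop) :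
    (law M d p).real {ω | A (window F ω)} = PF (p : ℝ) F A :=
  setBernoulli_real_window F A

lemma tau_le_twoPoint (p : unitInterval) (F : Finset (candidates M d)) {i j : candidates M d}
    {x y : Site d} (hx : Incident i.1 x) (hy : Incident j.1 y) :
    tau itemAdj (p : ℝ) F i j ≤ twoPoint M d p x y := by
  rw [tau, ← law_real_window, twoPoint]
  refine measureReal_mono (fun ω hω => ?_)
  exact connected_of_conn (Conn.mono (coe_window_subset F ω) hω) hx hy

lemma rpow_dimension (hd : 6 < d) (x : ℝ) : x ^ ((d : ℝ) - 2 + 0) = x ^ (d - 2) := by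
  rw [← Real.rpow_natCast, Nat.cast_sub (by omega), add_zero, Nat.cast_ofNat]

lemma PowerLaw.exists_tau_le (hd : 6 < d) (h : PowerLaw M d 0) :
    ∃ C : ℝ, 0 ≤ C ∧ ∀ (F : Finset (candidates M d)) i j,
      tau itemAdj (criticalPoint M d : ℝ) F i j ≤ C * kernel itemDist d i j := by
  obtain ⟨C', C, hC', hCC, h⟩ := h
  have hC : 0 < C := hC'.trans_le hCC
  -- The power of 2 replaces the distance n ≥ 1 by n + 1 in the kernel; the added 1 covers distinct
  -- items with the same position, where only the trivial bound is available.
  refine ⟨C * 2 ^ (d - 2) + 1, by positivity, fun F i j => ?_⟩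
  have h1 := tau_le_twoPoint (criticalPoint M d) F (incident_position i) (incident_position j)
  by_cases hij : position i = position j
  · have : kernel itemDist d i j = 1 := by simp [kernel, itemDist, hij]
    rw [this]
    have h2 : twoPoint M d (criticalPoint M d) (position i) (position j) ≤ 1 := measureReal_le_one
    have : 0 ≤ C * 2 ^ (d - 2) := by positivity
    linarith
  · have h2 := (h _ _ hij).2
    rw [rpow_dimension hd] at h2
    have hn : 1 ≤ itemDist i j := by
      by_contra hn
      exact hij (eq_of_supDist_eq_zero (by unfold itemDist at hn; omega))
    have hn' : (1 : ℝ) ≤ itemDist i j := by exact_mod_cast hn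
    have hE : (itemDist i j : ℝ) ≤ euclDist (position i) (position j) := supDist_le_euclDist _ _
    have hk := kernel_nonneg (ρ := itemDist) (d := d) i j
    calc _ ≤ _ := h1
      _ ≤ _ := h2
      _ ≤ C / ((itemDist i j + 1 : ℝ) / 2) ^ (d - 2) := by
          gcongr
          linarith
      _ = C * 2 ^ (d - 2) * kernel itemDist d i j := by
          rw [kernel, div_pow]; push_cast; field_simp
      _ ≤ _ := by gcongr; linarith

lemma ne_add_step (i : Fin d) (x : Site d) : x ≠ x + step i 1 := (adj_add_step i x).ne

/-- At density 0 neighbours are almost surely not connected, against the lower bound of the power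
law. Positivity is needed for the factors 1/p of `bk_sharing`. -/
lemma PowerLaw.criticalPoint_pos (hd : 6 < d) (h : PowerLaw M d 0) :
    0 < (criticalPoint M d : ℝ) := by
  obtain ⟨C', C, hC', hCC, h⟩ := h
  refine (criticalPoint M d).2.1.lt_of_ne fun h0 => ?_
  have h0 : criticalPoint M d = 0 := Subtype.ext h0.symm
  set i₀ : Fin d := ⟨0, by omega⟩
  have hne := ne_add_step i₀ 0
  have h1 := (h _ _ hne).1
  rw [rpow_dimension hd, h0] at h1
  have hE : 0 < euclDist 0 (0 + step i₀ 1) := by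
    refine lt_of_lt_of_le ?_ (supDist_le_euclDist _ _)
    exact_mod_cast Nat.pos_of_ne_zero fun h => hne (eq_of_supDist_eq_zero h)
  have h2 : twoPoint M d 0 0 (0 + step i₀ 1) = 0 := by
    rw [twoPoint, measureReal_eq_zero_iff]
    refine measure_mono_null (t := ⋃ a : Item M d, {ω | a ∈ ω}) (fun ω hω => ?_) ?_
    · rcases exists_conn_of_connected hω with h | ⟨a, b, -, -, hab⟩
      · exact absurd h hne
      · exact Set.mem_iUnion.2 ⟨a.1, hab.left_mem⟩
    · refine measure_iUnion_null fun a => ?_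
      rw [law, setBernoulli_zero, Measure.dirac_apply' _ (measurableSet_mem_config a)]
      simp
  rw [h2] at h1
  exact absurd h1 (not_le.2 (by positivity))

lemma PowerLaw.exists_le_twoPoint (hd : 6 < d) (h : PowerLaw M d 0) :
    ∃ c : ℝ, 0 < c ∧ ∀ L : ℕ, 1 ≤ L → ∀ x y : Site d, supDist x y ≤ 4 * L →
      c / (L : ℝ) ^ (d - 2) ≤ twoPoint M d (criticalPoint M d) x y := by
  obtain ⟨C', C, hC', hCC, h⟩ := h
  have hd0 : (0 : ℝ) < d := by exact_mod_cast (show 0 < d by omega)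
  have key : ∀ L : ℕ, 1 ≤ L → ∀ x y : Site d, x ≠ y → supDist x y ≤ 4 * L →
      C' / (4 * d) ^ (d - 2) / (L : ℝ) ^ (d - 2) ≤ twoPoint M d (criticalPoint M d) x y := by
    intro L hL x y hxy hxyL
    have h1 := (h x y hxy).1
    rw [rpow_dimension hd] at h1
    refine le_trans ?_ h1
    rw [div_div, ← mul_pow]
    have hE : 0 < euclDist x y := by
      refine lt_of_lt_of_le ?_ (supDist_le_euclDist _ _)
      exact_mod_cast Nat.pos_of_ne_zero fun h => hxy (eq_of_supDist_eq_zero h)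
    have h2 : (supDist x y : ℝ) ≤ 4 * L := by exact_mod_cast hxyL
    have h3 : euclDist x y ≤ 4 * d * L := by
      refine (euclDist_le x y).trans ?_
      nlinarith
    gcongr
  refine ⟨C' / (4 * d) ^ (d - 2), by positivity, fun L hL x y hxyL => ?_⟩
  by_cases hxy : x = y
  · subst hxy
    set i₀ : Fin d := ⟨0, by omega⟩
    -- The power law says nothing on the diagonal; a connection to a neighbour and back connects `x`
    -- to itself.
    refine (key L hL x (x + step i₀ 1) (ne_add_step i₀ x) ?_).trans ?_
    · have := supDist_le_one_of_adj (adj_add_step i₀ x)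
      omega
    · exact measureReal_mono fun ω hω => Connected.trans hω (Connected.symm hω)
  · exact key L hL x y hxy hxyL

/-- Forcing the two end items open costs at most p². Half of `t` is given up to have a strict
inequality in the limit, so that it holds in all large volumes. -/
lemma eventually_le_tau (i₀ : Fin d) {p : unitInterval} {x y : Site d} {t : ℝ}
    (ht : 0 < t) (h : t ≤ twoPoint M d p x y) :
    ∀ᶠ F in atTop, (p : ℝ) ^ 2 * (t / 2) ≤
      tau itemAdj (p : ℝ) F (itemOf M i₀ x) (itemOf M i₀ y) := by
  set B : Finset (candidates M d) := {itemOf M i₀ x, itemOf M i₀ y} with hB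
  have hBc : (B : Set (candidates M d)) = {itemOf M i₀ x, itemOf M i₀ y} := by simp [hB]
  have hlim := (tendsto_PF_atTop (p := p)
    (A := fun S : Finset (candidates M d) =>
      Conn itemAdj ((S : Set (candidates M d)) ∪ B) (itemOf M i₀ x) (itemOf M i₀ y))
    (E := fun ω => Conn itemAdj (Subtype.val ⁻¹' ω ∪ B) (itemOf M i₀ x) (itemOf M i₀ y))
    fun ω => eventually_conn_window (u := candidates M d) (H := itemAdj) ω (itemOf M i₀ x)
      (itemOf M i₀ y) (B : Set (candidates M d))).2
  have h1 : t / 2 < (setBernoulli (candidates M d) p).real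
      {ω | Conn itemAdj (Subtype.val ⁻¹' ω ∪ B) (itemOf M i₀ x) (itemOf M i₀ y)} := by
    refine lt_of_lt_of_le (half_lt_self ht) (h.trans ?_)
    refine measureReal_mono fun ω hω => ?_
    have := conn_itemOf_of_connected i₀ hω
    rw [← hBc] at this
    exact this
  filter_upwards [hlim.eventually (lt_mem_nhds h1), eventually_ge_atTop B] with F hF hBF
  have h2 : PF (p : ℝ) F (fun S => Conn itemAdj (S : Set (candidates M d)) (itemOf M i₀ x)
      (itemOf M i₀ y) ∧ B ⊆ S) = _ := PF_and_subset hBF _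
  have h3 : PF (p : ℝ) F (fun S => Conn itemAdj (S : Set (candidates M d)) (itemOf M i₀ x)
      (itemOf M i₀ y) ∧ B ⊆ S) ≤ tau itemAdj (p : ℝ) F (itemOf M i₀ x) (itemOf M i₀ y) :=
    PF_mono p.2.1 p.2.2 fun S _ h => h.1
  rw [h2] at h3
  simp only [Finset.coe_union] at h3
  refine le_trans ?_ h3
  have h4 : (p : ℝ) ^ 2 ≤ (p : ℝ) ^ B.card :=
    pow_le_pow_of_le_one p.2.1 p.2.2 Finset.card_le_two
  exact mul_le_mul h4 hF.le (by positivity) (pow_nonneg p.2.1 _)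

lemma PowerLaw.exists_le_tau (hd : 6 < d) (h : PowerLaw M d 0) (i₀ : Fin d) :
    ∃ c : ℝ, 0 < c ∧ ∀ L : ℕ, 1 ≤ L → ∀ᶠ F in atTop, ∀ x ∈ ball 0 (2 * L), ∀ y ∈ ball 0 (2 * L),
      c / (L : ℝ) ^ (d - 2) ≤
        tau itemAdj (criticalPoint M d : ℝ) F (itemOf M i₀ x) (itemOf M i₀ y) := by
  obtain ⟨c, hc, h1⟩ := h.exists_le_twoPoint hd
  have hp := h.criticalPoint_pos hd
  refine ⟨(criticalPoint M d : ℝ) ^ 2 * (c / 2), by positivity, fun L hL => ?_⟩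
  rw [eventually_all_finset]
  intro x hx
  rw [eventually_all_finset]
  intro y hy
  have hxy : supDist x y ≤ 4 * L := by
    have h2 := mem_ball.1 hx
    have h3 := mem_ball.1 hy
    have := supDist_triangle x 0 y
    rw [supDist_comm x 0] at this
    omega
  have hL' : (0 : ℝ) < L := by exact_mod_cast hL
  filter_upwards [eventually_le_tau i₀ (by positivity) (h1 L hL x y hxy)] with F hF
  refine le_trans (le_of_eq ?_) hF
  ring

lemma supDist_le_itemDist (i₀ : Fin d) (x y : Site d) :
    supDist x y ≤ itemDist (itemOf M i₀ x) (itemOf M i₀ y) + 2 := by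
  have h1 := supDist_le_one_of_incident (itemOf M i₀ x) (incident_itemOf i₀ x) (incident_position _)
  have h2 := supDist_le_one_of_incident (itemOf M i₀ y) (incident_position _) (incident_itemOf i₀ y)
  have h3 := supDist_triangle x (position (itemOf M i₀ x)) y
  have h4 := supDist_triangle (position (itemOf M i₀ x)) (position (itemOf M i₀ y)) y
  unfold itemDist
  omega

/-- The items of a line segment of `m` sites which starts in `s`. -/
noncomputable def segment (M : Model) (i₀ : Fin d) (m : ℕ) (s : Site d) : Finset (candidates M d) :=
  (Finset.range m).image fun t : ℕ => itemOf M i₀ (s + step i₀ t)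

lemma itemOf_mem_segment {i₀ : Fin d} {m t : ℕ} (s : Site d) (ht : t < m) :
    itemOf M i₀ (s + step i₀ t) ∈ segment M i₀ m s :=
  Finset.mem_image.2 ⟨t, Finset.mem_range.2 ht, rfl⟩

lemma conn_segment {i₀ : Fin d} {m : ℕ} {s : Site d} {a b : candidates M d}
    (ha : a ∈ segment M i₀ m s) (hb : b ∈ segment M i₀ m s) :
    Conn itemAdj (segment M i₀ m s : Set (candidates M d)) a b := by
  have key : ∀ t : ℕ, t < m → Conn itemAdj (segment M i₀ m s : Set (candidates M d))
      (itemOf M i₀ (s + step i₀ (0 : ℕ))) (itemOf M i₀ (s + step i₀ t)) := by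
    intro t
    induction t with
    | zero => exact fun ht => .refl (itemOf_mem_segment s ht)
    | succ t ih =>
      intro ht
      refine (ih (by omega)).tail ?_ (itemOf_mem_segment s ht)
      have := itemAdj_itemOf (M := M) i₀ (s + step i₀ t)
      rw [add_assoc, step, step, ← Pi.single_add] at this
      exact_mod_cast this
  obtain ⟨t, ht, rfl⟩ := Finset.mem_image.1 ha
  obtain ⟨t', ht', rfl⟩ := Finset.mem_image.1 hb
  exact ((key t (Finset.mem_range.1 ht)).symm itemAdj_symm).trans (key t' (Finset.mem_range.1 ht'))

/-- The starting points of disjoint segments of `m` sites. -/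
noncomputable def segmentStarts (i₀ : Fin d) (m L : ℕ) : Finset (Site d) :=
  Fintype.piFinset fun j => if j = i₀ then (Finset.range (L / m + 1)).image fun q : ℕ => (m * q : ℤ)
    else Finset.Icc (0 : ℤ) L

lemma card_segmentStarts (i₀ : Fin d) {m : ℕ} (hm : 0 < m) (L : ℕ) :
    (segmentStarts i₀ m L).card = (L / m + 1) * (L + 1) ^ (d - 1) := by
  rw [segmentStarts, Fintype.card_piFinset]
  rw [Finset.prod_congr rfl (g := fun j => if j = i₀ then L / m + 1 else L + 1) fun j _ => by
    split_ifs
    · rw [Finset.card_image_of_injective, Finset.card_range]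
      intro q q' h
      have hm' : (m : ℤ) ≠ 0 := by exact_mod_cast hm.ne'
      exact_mod_cast mul_left_cancel₀ hm' h
    · simp]
  rw [Finset.prod_ite, Finset.prod_const, Finset.prod_const, Finset.filter_ne',
    Finset.card_erase_of_mem (Finset.mem_univ i₀), Finset.card_univ, Fintype.card_fin,
    Finset.filter_eq', if_pos (Finset.mem_univ i₀), Finset.card_singleton, pow_one]

lemma segmentStarts_spec {i₀ : Fin d} {m L : ℕ} {s : Site d} (hs : s ∈ segmentStarts i₀ m L) :
    (m : ℤ) ∣ s i₀ ∧ ∀ j, 0 ≤ s j ∧ s j ≤ L := by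
  rw [segmentStarts, Fintype.mem_piFinset] at hs
  have h0 := hs i₀
  rw [if_pos rfl, Finset.mem_image] at h0
  obtain ⟨q, hq, hqs⟩ := h0
  refine ⟨⟨q, hqs.symm⟩, fun j => ?_⟩
  by_cases hj : j = i₀
  · subst hj
    rw [← hqs]
    have h1 : m * q ≤ L := (Nat.mul_le_mul_left m (by have := Finset.mem_range.1 hq; omega)).trans
      (Nat.mul_div_le L m)
    exact ⟨by positivity, by exact_mod_cast h1⟩
  · have := hs j
    rwa [if_neg hj, Finset.mem_Icc] at this

lemma disjoint_segment {i₀ : Fin d} {m L : ℕ} {s s' : Site d}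
    (hs : s ∈ segmentStarts i₀ m L) (hs' : s' ∈ segmentStarts i₀ m L) (hne : s ≠ s') :
    Disjoint (segment M i₀ m s) (segment M i₀ m s') := by
  refine Finset.disjoint_left.2 fun a ha ha' => hne ?_
  obtain ⟨t, ht, rfl⟩ := Finset.mem_image.1 ha
  obtain ⟨t', ht', h⟩ := Finset.mem_image.1 ha'
  have h := itemOf_injective i₀ h
  have ht := Finset.mem_range.1 ht
  have ht' := Finset.mem_range.1 ht'
  have h0 := congrFun h i₀
  simp only [step, Pi.add_apply, Pi.single_eq_same] at h0
  -- The starts are multiples of `m` in this direction, whereas the offsets differ by less than `m`.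
  have h1 : s i₀ - s' i₀ = 0 := by
    refine Int.eq_zero_of_abs_lt_dvd (m := m)
      (dvd_sub (segmentStarts_spec hs).1 (segmentStarts_spec hs').1) ?_
    rw [abs_lt]; constructor <;> omega
  have h2 : (t : ℤ) = t' := by omega
  rw [h2] at h
  exact (add_right_cancel h).symm

/-- The junctions are parallel segments which tile part of the box; the three items sit at the
start, the middle and the end. The constant `t₀` comes from the power law alone, before `R` is
given. -/
lemma PowerLaw.exists_hasJunctions (hd : 6 < d) (h : PowerLaw M d 0) (i₀ : Fin d) :
    ∃ t₀ : ℝ, 0 < t₀ ∧ ∀ TA TB TD : ℕ → Finset (Site d), (∀ L, TA L ⊆ box d L) →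
      (∀ L, TB L ⊆ box d L) → (∀ L, TD L ⊆ box d L) →
      HasJunctions itemAdj itemDist d (criticalPoint M d : ℝ) t₀
        (fun L => (TA L).image (itemOf M i₀)) (fun L => (TB L).image (itemOf M i₀))
        (fun L => (TD L).image (itemOf M i₀)) := by
  obtain ⟨t₀, ht₀, hlow⟩ := h.exists_le_tau hd i₀
  refine ⟨t₀, ht₀, fun TA TB TD hA hB hD R => ?_⟩
  -- The distance of two canonical items may fall short of that of their sites by two.
  set r := R + 2
  set m := 2 * r + 1
  refine ⟨m, 1 / m, m, by positivity, fun L hL => ?_⟩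
  have hL1 : 1 ≤ L := by omega
  obtain ⟨F₀, hF₀⟩ := eventually_atTop.1 ((hlow L hL1).and
    (eventually_ge_atTop ((segmentStarts i₀ m L).biUnion (segment M i₀ m))))
  refine ⟨Site d, segmentStarts i₀ m L, segment M i₀ m, fun s => itemOf M i₀ (s + step i₀ (0 : ℕ)),
    fun s => itemOf M i₀ (s + step i₀ r), fun s => itemOf M i₀ (s + step i₀ (2 * r : ℕ)), F₀,
    ?_, ?_, fun s hs t ht hst => disjoint_segment hs ht hst, ?_⟩
  · rw [card_segmentStarts i₀ (by omega)]
    have h1 : L ≤ m * (L / m + 1) := by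
      have := Nat.lt_mul_div_succ L (show 0 < m by omega)
      exact this.le
    have h1' : (L : ℝ) ≤ m * ((L / m : ℕ) + 1) := by exact_mod_cast h1
    have hm : (0 : ℝ) < m := by positivity
    push_cast
    calc 1 / (m : ℝ) * (L : ℝ) ^ d = (L : ℝ) / m * (L : ℝ) ^ (d - 1) := by
          rw [← Nat.succ_pred_eq_of_pos (show 0 < d by omega), pow_succ]
          simp only [Nat.pred_eq_sub_one, Nat.succ_eq_add_one, Nat.add_sub_cancel]
          ring
      _ ≤ (((L / m : ℕ) : ℝ) + 1) * ((L : ℝ) + 1) ^ (d - 1) := by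
          gcongr
          · rw [div_le_iff₀ hm]; linarith
          · linarith
  · intro s hs
    have dist : ∀ t t' : ℕ, R + 2 ≤ (((t : ℤ) - t')).natAbs →
        R ≤ itemDist (itemOf M i₀ (s + step i₀ t)) (itemOf M i₀ (s + step i₀ t')) := by
      intro t t' ht
      have := supDist_le_itemDist (M := M) i₀ (s + step i₀ t) (s + step i₀ t')
      rw [supDist_add_step] at this
      omega
    refine ⟨Finset.card_image_le.trans (by simp), ?_, itemOf_mem_segment s (by omega),
      itemOf_mem_segment s (by omega), itemOf_mem_segment s (by omega),
      fun a ha b hb => conn_segment ha hb, dist _ _ (by omega), dist _ _ (by omega),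
      dist _ _ (by omega)⟩
    exact (Finset.subset_biUnion_of_mem _ hs).trans (hF₀ F₀ le_rfl).2
  · intro F hF s hs
    have hF := (hF₀ F hF).1
    -- A segment starts in [0, L]^d and its length is less than m ≤ L.
    have hmem : ∀ t : ℕ, t < m → s + step i₀ t ∈ ball (0 : Site d) (2 * L) := by
      intro t ht
      refine mem_ball.2 (supDist_le_iff.2 fun j => ?_)
      have := (segmentStarts_spec hs).2 j
      by_cases hj : j = i₀
      · subst hj
        simp only [step, Pi.add_apply, Pi.single_eq_same, Pi.zero_apply]
        rw [abs_le]; push_cast; constructor <;> omega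
      · simp only [step, Pi.add_apply, Pi.single_eq_of_ne hj, Pi.zero_apply]
        rw [abs_le]; push_cast; constructor <;> omega
    have hbox : ∀ x ∈ box d L, x ∈ ball (0 : Site d) (2 * L) := by
      intro x hx
      rw [box_eq_ball] at hx
      exact mem_ball.2 ((mem_ball.1 hx).trans (by omega))
    have main : ∀ t : ℕ, t < m → ∀ T : Finset (Site d), T ⊆ box d L →
        ∀ x ∈ T.image (itemOf M i₀), t₀ / (L : ℝ) ^ (d - 2) ≤
          tau itemAdj (criticalPoint M d : ℝ) F (itemOf M i₀ (s + step i₀ t)) x := by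
      intro t ht T hT x hx
      obtain ⟨y, hy, rfl⟩ := Finset.mem_image.1 hx
      exact hF _ (hmem t ht) _ (hbox y (hT hy))
    exact ⟨main 0 (by omega) _ (hA L), main r (by omega) _ (hB L), main (2 * r) (by omega) _ (hD L)⟩

end TwoPoint


/-! ### Clusters in the box and the limit statements. -/

section Clusters

variable {M : Model} {d : ℕ}

lemma eventually_conn_iff (ω : Config M d) (S S' : Finset (candidates M d)) :
    ∀ᶠ F in atTop, ∀ i ∈ S, ∀ j ∈ S',
      (Conn itemAdj ((window F ω : Finset (candidates M d)) : Set (candidates M d)) i j ↔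
        Conn itemAdj (Subtype.val ⁻¹' ω) i j) := by
  rw [eventually_all_finset]
  intro i _
  rw [eventually_all_finset]
  intro j _
  simpa using eventually_conn_window (u := candidates M d) (H := itemAdj) ω i j ∅

lemma hits_congr {V : Type*} {H : V → V → Prop} {ω ω' : Set V} {S : Finset V} {i : V}
    (h : ∀ j ∈ S, (Conn H ω i j ↔ Conn H ω' i j)) : hits H ω S i = hits H ω' S i :=
  Finset.sum_congr rfl fun j hj => ind_congr (h j hj)

/-- The maximal size of the intersection with `T` of the members of a family of clusters. -/
def maxIn (T : Finset (Site d)) (F : Finset (Finset (Site d))) : ℕ := F.sup fun C => (C ∩ T).card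

lemma exists_of_mem_clusters {ω : Config M d} {L : ℕ} {C : Finset (Site d)}
    (hC : C ∈ clusters ω L) : C ⊆ box d L ∧ ∃ x, ∀ y ∈ C, Connected ω x y := by
  classical
  rw [clusters, Finset.mem_filter, Finset.mem_image] at hC
  obtain ⟨⟨x, -, rfl⟩, -⟩ := hC
  refine ⟨fun y hy => (Finset.mem_filter.1 hy).1, x, fun y hy => (Finset.mem_filter.1 hy).2⟩

lemma maxIn_box {F : Finset (Finset (Site d))} {L : ℕ} (hF : ∀ C ∈ F, C ⊆ box d L) :
    maxIn (box d L) F = maxSize F :=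
  Finset.sup_congr rfl fun C hC => by rw [Finset.inter_eq_left.2 (hF C hC)]

/-- A cluster is controlled by the hits of one of its items. -/
lemma exists_card_le_hits {ω : Config M d} {C T : Finset (Site d)} {x : Site d}
    (hC : ∀ y ∈ C, Connected ω x y) (h1 : 1 < (C ∩ T).card) :
    ∃ e ∈ itemsIn M T, ((C ∩ T).card : ℝ) ≤
      3 ^ d * hits itemAdj (Subtype.val ⁻¹' ω) (itemsIn M T) e := by
  classical
  -- Two distinct sites guarantee an open item; the cluster of an isolated site contains no open
  -- bond.
  obtain ⟨y₀, hy₀, y₁, hy₁, hne⟩ := Finset.one_lt_card.1 h1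
  have hconn : ∀ y ∈ C ∩ T, Connected ω y₀ y := fun y hy =>
    (hC y₀ (Finset.mem_inter.1 hy₀).1).symm.trans (hC y (Finset.mem_inter.1 hy).1)
  obtain ⟨e, b₁, he, -, heb⟩ := (exists_conn_of_connected (hconn y₁ hy₁)).resolve_left hne
  have heω := heb.left_mem
  have hmem : ∀ y ∈ C ∩ T, ∀ b : candidates M d, Incident b.1 y → b ∈ itemsIn M T :=
    fun y hy b hb => mem_itemsIn.2 ⟨y, (Finset.mem_inter.1 hy).2, hb⟩
  refine ⟨e, hmem y₀ hy₀ e he, ?_⟩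
  -- Every site of the cluster lies within distance one of the position of a hit item, which gives
  -- at most 3^d sites for each hit.
  have hcov : C ∩ T ⊆ ((itemsIn M T).filter fun b => Conn itemAdj (Subtype.val ⁻¹' ω) e b).biUnion
      fun b => ball (position b) 1 := by
    intro y hy
    obtain ⟨b, hb, heb⟩ : ∃ b : candidates M d, Incident b.1 y ∧
        Conn itemAdj (Subtype.val ⁻¹' ω) e b := by
      rcases exists_conn_of_connected (hconn y hy) with rfl | ⟨a, b, ha, hb, hab⟩
      · exact ⟨e, he, .refl heω⟩
      · refine ⟨b, hb, Conn.trans ?_ hab⟩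
        rcases eq_or_itemAdj_of_incident he ha with rfl | h
        · exact .refl heω
        · exact .single heω hab.left_mem h
    exact Finset.mem_biUnion.2 ⟨b, Finset.mem_filter.2 ⟨hmem y hy b hb, heb⟩,
      mem_ball.2 (supDist_le_one_of_incident b (incident_position b) hb)⟩
  have hcard := (Finset.card_le_card hcov).trans (Finset.card_biUnion_le_card_mul _ _ (3 ^ d)
    fun b _ => by rw [card_ball])
  have hhits : hits itemAdj (Subtype.val ⁻¹' ω) (itemsIn M T) e =
      (((itemsIn M T).filter fun b => Conn itemAdj (Subtype.val ⁻¹' ω) e b).card : ℝ) := by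
    rw [hits, Finset.card_filter]
    push_cast
    refine Finset.sum_congr rfl fun b _ => ?_
    rw [ind]
  rw [hhits, mul_comm]
  exact_mod_cast hcard

/-- A cluster which connects opposite faces contains the hits of its items. -/
lemma hits_le_maxIn {i₀ : Fin d} {ω : Config M d} {L : ℕ} {T : Finset (Site d)}
    (hT : T ⊆ box d L) {x y : Site d} (hx : x ∈ box d L) (hxi : x i₀ = -(L : ℤ))
    (hy : y ∈ box d L) (hyi : y i₀ = L)
    (h : Conn itemAdj (Subtype.val ⁻¹' ω) (itemOf M i₀ x) (itemOf M i₀ y)) :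
    hits itemAdj (Subtype.val ⁻¹' ω) (T.image (itemOf M i₀)) (itemOf M i₀ x) ≤
      maxIn T (spanningClusters i₀ ω L) := by
  classical
  have hconn : ∀ z, Conn itemAdj (Subtype.val ⁻¹' ω) (itemOf M i₀ x) (itemOf M i₀ z) →
      Connected ω x z := fun z hz =>
    connected_of_conn hz (incident_itemOf i₀ x) (incident_itemOf i₀ z)
  set C := (box d L).filter fun z => Connected ω x z with hCdef
  have hxC : x ∈ C := Finset.mem_filter.2 ⟨hx, hconn x (.refl h.left_mem)⟩
  have hyC : y ∈ C := Finset.mem_filter.2 ⟨hy, hconn y h⟩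
  have hC : C ∈ spanningClusters i₀ ω L := by
    rw [spanningClusters, clusters, Finset.mem_filter, Finset.mem_filter, Finset.mem_image]
    refine ⟨⟨⟨x, hx, ?_⟩, ⟨x, hxC⟩⟩, ⟨x, hxC, hxi⟩, ⟨y, hyC, hyi⟩⟩
    ext z; simp [hCdef]
  have h1 : (C ∩ T).card ≤ maxIn T (spanningClusters i₀ ω L) :=
    Finset.le_sup (f := fun C : Finset (Site d) => (C ∩ T).card) hC
  have h2 : hits itemAdj (Subtype.val ⁻¹' ω) (T.image (itemOf M i₀)) (itemOf M i₀ x) ≤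
      ((C ∩ T).card : ℝ) := by
    -- Distinct canonical items belong to distinct sites, so no constant is lost here.
    rw [hits, Finset.sum_image (itemOf_injective i₀).injOn, Finset.inter_comm,
      ← Finset.filter_mem_eq_inter, Finset.card_filter]
    push_cast
    refine Finset.sum_le_sum fun z hz => ?_
    by_cases hzc : Conn itemAdj (Subtype.val ⁻¹' ω) (itemOf M i₀ x) (itemOf M i₀ z)
    · rw [ind_of_true hzc, if_pos (Finset.mem_filter.2 ⟨hT hz, hconn z hzc⟩)]
    · rw [ind_of_false hzc]; positivity
  exact h2.trans (by exact_mod_cast h1)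

lemma maxIn_spanningClusters_le (i₀ : Fin d) (ω : Config M d) (L : ℕ) (T : Finset (Site d)) :
    maxIn T (spanningClusters i₀ ω L) ≤ maxIn T (clusters ω L) := by
  classical
  exact Finset.sup_mono (Finset.filter_subset _ _)

/-- The families of sets which grow with dimension `d - 2 + a`. -/
structure Regular (T : ℕ → Finset (Site d)) (a : ℕ) : Prop where
  card_inter_ball_le : ∀ (L : ℕ) (x : Site d) (k : ℕ), 1 ≤ k →
    ((T L ∩ ball x k).card : ℝ) ≤ (2 * d * 3 ^ d) * (k : ℝ) ^ (d - 2 + a)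
  subset_box : ∀ L, T L ⊆ box d L
  le_card : ∀ L : ℕ, (L : ℝ) ^ (d - 2 + a) ≤ (T L).card

lemma regular_box (hd : 6 < d) : Regular (box d) 2 where
  card_inter_ball_le := card_box_inter_ball_le hd
  subset_box _ := subset_rfl
  le_card L := by
    rw [show d - 2 + 2 = d by omega]
    exact pow_le_card_box L

lemma regular_boundary (hd : 6 < d) : Regular (boundary d) 1 where
  card_inter_ball_le := card_boundary_inter_ball_le hd
  subset_box _ := Finset.filter_subset _ _
  le_card L := by
    rw [show d - 2 + 1 = d - 1 by omega]
    exact pow_le_card_boundary ⟨0, by omega⟩ L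

lemma Regular.spread {T : ℕ → Finset (Site d)} {a : ℕ} (hT : Regular T a) (M : Model) (i₀ : Fin d) :
    Spread itemDist d (itemOf M i₀ 0) (fun L => itemsIn M (T L)) a (3 ^ d * (2 * d * 3 ^ d)) :=
  spread_itemsIn hT.card_inter_ball_le hT.subset_box

lemma tendsto_upper (hd : 6 < d) (h : PowerLaw M d 0) {T : ℕ → Finset (Site d)} {a : ℕ}
    (ha : 1 ≤ a) (hT : Regular T a) :
    ∃ c : ℝ, 0 < c ∧ ∀ c' ≥ c, Tendsto (fun L : ℕ => (law M d (criticalPoint M d)).real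
      {ω | c' * Real.log L * (L : ℝ) ^ (2 + a) < maxIn (T L) (clusters ω L)}) atTop (𝓝 0) := by
  obtain ⟨C, hC, hτ⟩ := h.exists_tau_le hd
  have hp := h.criticalPoint_pos hd
  obtain ⟨c, K, hc, hK⟩ := (hT.spread M ⟨0, by omega⟩).exists_upper_tail (itemGeometry M d) hd ha hp
    (criticalPoint M d).2.2 hC hτ
  -- The factor 3^d comes from `exists_card_le_hits`; the added 1 ensures that the maximal
  -- intersection has more than one site, as that lemma requires.
  refine ⟨3 ^ d * c + 1, by positivity, fun c' hc' => ?_⟩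
  have hKlim : Tendsto (fun L : ℕ => K / (L : ℝ)) atTop (𝓝 0) :=
    tendsto_const_div_atTop_nhds_zero_nat K
  refine squeeze_zero' (.of_forall fun L => measureReal_nonneg) ?_ hKlim
  filter_upwards [eventually_ge_atTop 3] with L hL
  have hlim := (tendsto_PF_atTop (p := criticalPoint M d)
    (A := fun S : Finset (candidates M d) => ∃ e ∈ itemsIn M (T L),
      c * Real.log L * (L : ℝ) ^ (2 + a) ≤ hits itemAdj (S : Set (candidates M d)) (itemsIn M (T L)) e)
    (E := fun ω => ∃ e ∈ itemsIn M (T L),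
      c * Real.log L * (L : ℝ) ^ (2 + a) ≤ hits itemAdj (Subtype.val ⁻¹' ω) (itemsIn M (T L)) e)
    fun ω => by
      filter_upwards [eventually_conn_iff ω (itemsIn M (T L)) (itemsIn M (T L))] with F hF
      refine exists_congr fun e => and_congr_right fun he => ?_
      rw [hits_congr (hF e he)]).2
  have h1 := le_of_tendsto hlim (.of_forall fun F => hK L hL F)
  refine le_trans (measureReal_mono fun ω hω => ?_) h1
  have hω : c' * Real.log L * (L : ℝ) ^ (2 + a) < maxIn (T L) (clusters ω L) := hω
  have hL3 : (3 : ℝ) ≤ L := by exact_mod_cast hL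
  have hlog : 1 ≤ Real.log L := by
    rw [Real.le_log_iff_exp_le (by linarith)]
    linarith [Real.exp_one_lt_d9]
  have hpow : 1 ≤ (L : ℝ) ^ (2 + a) := one_le_pow₀ (by linarith)
  have hlp : 1 ≤ Real.log L * (L : ℝ) ^ (2 + a) := one_le_mul_of_one_le_of_one_le hlog hpow
  have hbig : 3 ^ d * (c * Real.log L * (L : ℝ) ^ (2 + a)) + 1 < maxIn (T L) (clusters ω L) := by
    refine lt_of_le_of_lt ?_ hω
    have : (3 ^ d * c + 1) * (Real.log L * (L : ℝ) ^ (2 + a)) ≤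
        c' * (Real.log L * (L : ℝ) ^ (2 + a)) := by gcongr
    nlinarith
  have hpos : 0 < 3 ^ d * (c * Real.log L * (L : ℝ) ^ (2 + a)) := by positivity
  have hmax : 0 < maxIn (T L) (clusters ω L) := by
    have : (0 : ℝ) < maxIn (T L) (clusters ω L) := by linarith
    exact_mod_cast this
  have hne : (clusters ω L).Nonempty := by
    by_contra hne
    rw [Finset.not_nonempty_iff_eq_empty.1 hne] at hmax
    simp [maxIn] at hmax
  obtain ⟨D, hD, hDmax⟩ := Finset.exists_mem_eq_sup _ hne fun C : Finset (Site d) => (C ∩ T L).card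
  rw [maxIn, hDmax] at hbig
  obtain ⟨-, x, hx⟩ := exists_of_mem_clusters hD
  have hD1 : 1 < (D ∩ T L).card := by
    have : (1 : ℝ) < (D ∩ T L).card := by linarith
    exact_mod_cast this
  obtain ⟨e, he, hle⟩ := exists_card_le_hits hx hD1
  refine ⟨e, he, ?_⟩
  have h3 : (3 ^ d : ℝ) * (c * Real.log L * (L : ℝ) ^ (2 + a)) ≤
      3 ^ d * hits itemAdj (Subtype.val ⁻¹' ω) (itemsIn M (T L)) e := by linarith
  exact le_of_mul_le_mul_left h3 (by positivity)

lemma tendsto_lower (hd : 6 < d) (h : PowerLaw M d 0) (i₀ : Fin d) {T : ℕ → Finset (Site d)}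
    {a : ℕ} (ha : 1 ≤ a) (hT : Regular T a) {ε : ℕ → ℝ} (hε : Tendsto ε atTop (𝓝 0)) :
    Tendsto (fun L : ℕ => (law M d (criticalPoint M d)).real
      {ω | (maxIn (T L) (spanningClusters i₀ ω L) : ℝ) < ε L * (L : ℝ) ^ (2 + a)})
      atTop (𝓝 0) := by
  obtain ⟨C, hC, hτ⟩ := h.exists_tau_le hd
  have hp := h.criticalPoint_pos hd
  obtain ⟨t₀, ht₀, hJ⟩ := h.exists_hasJunctions hd i₀
  have hface : ∀ s : ℕ → ℤ, (∀ L, s L = -(L : ℤ) ∨ s L = L) →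
      Spread itemDist d (itemOf M i₀ 0) (fun L => (slab 0 L i₀ (s L)).image (itemOf M i₀)) 1
        (3 ^ d * (2 * d * 3 ^ d)) := fun s hs =>
    ((regular_boundary hd).spread M i₀).subset fun L => (image_itemOf_subset i₀ _).trans
      (Finset.biUnion_subset_biUnion_of_subset_left _ (slab_subset_boundary (hs L)))
  have hcard : ∀ (s : ℕ → ℤ) (L : ℕ), 1 ≤ L →
      (L : ℝ) ^ (d - 1) ≤ ((slab 0 L i₀ (s L)).image (itemOf M i₀)).card := fun s L _ => by
    rw [card_image_itemOf]; exact pow_le_card_slab 0 L i₀ (s L)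
  have hfb : ∀ (s : ℕ → ℤ), (∀ L, s L = -(L : ℤ) ∨ s L = L) → ∀ L, slab 0 L i₀ (s L) ⊆ box d L :=
    fun s hs L => (slab_subset_boundary (hs L)).trans (Finset.filter_subset _ _)
  obtain ⟨K, L₀, hK, hlow⟩ := exists_lower_tail (hface (fun L => -L) fun L => .inl rfl)
    (hface (fun L => L) fun L => .inr rfl)
    ((hT.spread M i₀).subset fun L => image_itemOf_subset i₀ (T L)) (itemGeometry M d) hd ha hp
    (criticalPoint M d).2.2 hC hτ ht₀ (hcard _) (hcard _)
    (fun L _ => by rw [card_image_itemOf]; exact hT.le_card L)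
    (hJ _ _ T (hfb _ fun L => .inl rfl) (hfb _ fun L => .inr rfl) hT.subset_box)
  have hlim : Tendsto (fun L : ℕ => K / (L : ℝ) + K * (|ε L| + 1 / (L : ℝ))) atTop (𝓝 0) := by
    have h1 := tendsto_const_div_atTop_nhds_zero_nat (𝕜 := ℝ) K
    have h2 := tendsto_const_div_atTop_nhds_zero_nat (𝕜 := ℝ) 1
    have h3 := hε.abs
    rw [abs_zero] at h3
    simpa using h1.add ((h3.add h2).const_mul K)
  refine squeeze_zero' (.of_forall fun L => measureReal_nonneg) ?_ hlim
  filter_upwards [eventually_ge_atTop L₀, eventually_ge_atTop 1] with L hL hL1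
  have hL1' : (0 : ℝ) < L := by exact_mod_cast hL1
  -- A positive level above the one in the statement, still small compared to L^(2 + a).
  set t : ℝ := (|ε L| + 1 / (L : ℝ)) * (L : ℝ) ^ (2 + a)
  have ht : 0 < t := by positivity
  obtain ⟨F₀, hF₀⟩ := hlow L hL
  set SA := (slab 0 L i₀ (-(L : ℤ))).image (itemOf M i₀)
  set SB := (slab 0 L i₀ (L : ℤ)).image (itemOf M i₀)
  set SD := (T L).image (itemOf M i₀)
  have hPF := (tendsto_PF_atTop (p := criticalPoint M d)
    (A := fun S : Finset (candidates M d) => ∀ x ∈ SA, ∀ y ∈ SB,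
      Conn itemAdj (S : Set (candidates M d)) x y → hits itemAdj (S : Set (candidates M d)) SD x < t)
    (E := fun ω => ∀ x ∈ SA, ∀ y ∈ SB, Conn itemAdj (Subtype.val ⁻¹' ω) x y →
      hits itemAdj (Subtype.val ⁻¹' ω) SD x < t)
    fun ω => by
      filter_upwards [eventually_conn_iff ω SA SB, eventually_conn_iff ω SA SD] with F h1 h2
      refine forall_congr' fun x => forall_congr' fun hx => forall_congr' fun y =>
        forall_congr' fun hy => ?_
      rw [h1 x hx y hy, hits_congr (h2 x hx)]).2
  have hbound : ∀ᶠ F : Finset (candidates M d) in atTop, _ ≤ K / (L : ℝ) + K * (|ε L| + 1 / (L : ℝ)) :=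
    (eventually_ge_atTop F₀).mono fun F hF => (hF₀ F hF t ht).trans (le_of_eq (by
      simp only [t]; field_simp))
  refine le_trans (measureReal_mono fun ω hω => ?_) (le_of_tendsto hPF hbound)
  have hω : (maxIn (T L) (spanningClusters i₀ ω L) : ℝ) < ε L * (L : ℝ) ^ (2 + a) := hω
  intro x hx y hy hxy
  obtain ⟨x', hx', rfl⟩ := Finset.mem_image.1 hx
  obtain ⟨y', hy', rfl⟩ := Finset.mem_image.1 hy
  refine (hits_le_maxIn (hT.subset_box L) (hfb (fun L => -L) (fun L => .inl rfl) L hx')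
    (mem_slab.1 hx').1 (hfb (fun L => L) (fun L => .inr rfl) L hy') (mem_slab.1 hy').1
    hxy).trans_lt (hω.trans_le ?_)
  have : 0 ≤ 1 / (L : ℝ) := by positivity
  exact mul_le_mul_of_nonneg_right (by linarith [le_abs_self (ε L)]) (by positivity)

/-- A union bound for the complement; subadditivity alone is used, so that no measurability of the
maxima enters. -/
lemma typicallyBetween_of_tendsto {X : ℕ → Config M d → ℕ} {ε : ℕ → ℝ} {c : ℝ} {k : ℕ}
    (hlow : Tendsto (fun L : ℕ => (law M d (criticalPoint M d)).real
      {ω | (X L ω : ℝ) < ε L * (L : ℝ) ^ k}) atTop (𝓝 0))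
    (hup : Tendsto (fun L : ℕ => (law M d (criticalPoint M d)).real
      {ω | c * Real.log L * (L : ℝ) ^ k < X L ω}) atTop (𝓝 0)) :
    TypicallyBetween M d X ε c k := by
  have hlim := (tendsto_const_nhds (x := (1 : ℝ))).sub (hlow.add hup)
  rw [add_zero, sub_zero] at hlim
  refine tendsto_of_tendsto_of_tendsto_of_le_of_le hlim tendsto_const_nhds (fun L => ?_)
    fun L => measureReal_le_one
  set G := {ω | ε L * (L : ℝ) ^ k ≤ (X L ω : ℝ) ∧ (X L ω : ℝ) ≤ c * Real.log L * (L : ℝ) ^ k}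
  set E₁ := {ω | (X L ω : ℝ) < ε L * (L : ℝ) ^ k} with hE₁
  set E₂ := {ω | c * Real.log L * (L : ℝ) ^ k < X L ω} with hE₂
  have hcov : (Set.univ : Set (Config M d)) ⊆ G ∪ (E₁ ∪ E₂) := by
    intro ω _
    by_cases h1 : (X L ω : ℝ) < ε L * (L : ℝ) ^ k
    · exact .inr (.inl h1)
    · by_cases h2 : c * Real.log L * (L : ℝ) ^ k < X L ω
      · exact .inr (.inr h2)
      · exact .inl ⟨not_lt.1 h1, not_lt.1 h2⟩
  have h1 : (law M d (criticalPoint M d)).real Set.univ ≤ _ := measureReal_mono hcov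
  have h2 := measureReal_union_le (μ := law M d (criticalPoint M d)) G (E₁ ∪ E₂)
  have h3 := measureReal_union_le (μ := law M d (criticalPoint M d)) E₁ E₂
  rw [probReal_univ] at h1
  dsimp only
  linarith

/-- The maximal intersections of the clusters and of the spanning clusters with a regular family. -/
lemma exists_typicallyBetween_maxIn (hd : 6 < d) (h : PowerLaw M d 0) (i₀ : Fin d)
    {T : ℕ → Finset (Site d)} {a : ℕ} (ha : 1 ≤ a) (hT : Regular T a) :
    ∃ c : ℝ, 0 < c ∧ ∀ c' ≥ c, ∀ ε : ℕ → ℝ, Tendsto ε atTop (𝓝 0) →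
      TypicallyBetween M d (fun L ω => maxIn (T L) (clusters ω L)) ε c' (2 + a) ∧
      TypicallyBetween M d (fun L ω => maxIn (T L) (spanningClusters i₀ ω L)) ε c' (2 + a) := by
  obtain ⟨c, hc, hup⟩ := tendsto_upper hd h ha hT
  refine ⟨c, hc, fun c' hc' ε hε => ?_⟩
  have hlow := tendsto_lower hd h i₀ ha hT hε
  have hle : ∀ L (ω : Config M d), (maxIn (T L) (spanningClusters i₀ ω L) : ℝ) ≤
      maxIn (T L) (clusters ω L) := fun L ω => by
    exact_mod_cast maxIn_spanningClusters_le i₀ ω L (T L)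
  -- The maximum over the spanning clusters is the smaller one: it passes on its lower bound and
  -- inherits the upper bound.
  refine ⟨typicallyBetween_of_tendsto ?_ (hup c' hc'), typicallyBetween_of_tendsto hlow ?_⟩
  · exact squeeze_zero (fun L => measureReal_nonneg)
      (fun L => measureReal_mono fun ω hω => (hle L ω).trans_lt hω) hlow
  · exact squeeze_zero (fun L => measureReal_nonneg)
      (fun L => measureReal_mono fun ω hω => LT.lt.trans_le hω (hle L ω)) (hup c' hc')

end Clusters

end Percolation

open Percolation
theorem theorem5 (M : Model) (d : ℕ) (hd : 6 < d) (hτ : PowerLaw M d 0) :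
    ∃ c : ℝ, 0 < c ∧ ∀ ε : ℕ → ℝ, Tendsto ε atTop (𝓝 0) →
      TypicallyBetween M d (fun L ω => maxSize (clusters ω L)) ε c 4 ∧
      TypicallyBetween M d
        (fun L ω => maxSize (spanningClusters ⟨0, by omega⟩ ω L)) ε c 4 ∧
      TypicallyBetween M d (fun L ω => maxBoundarySize L (clusters ω L)) ε c 3 ∧
      TypicallyBetween M d
        (fun L ω => maxBoundarySize L (spanningClusters ⟨0, by omega⟩ ω L)) ε c 3 := by
  -- The box has a = 2 and the boundary a = 1, whence the powers 4 and 3. Larger constants remain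
  -- admissible, so the maximum of the two serves for both.
  obtain ⟨c₁, hc₁, h₁⟩ := exists_typicallyBetween_maxIn hd hτ ⟨0, by omega⟩ (by norm_num)
    (regular_box hd)
  obtain ⟨c₂, hc₂, h₂⟩ := exists_typicallyBetween_maxIn hd hτ ⟨0, by omega⟩ le_rfl
    (regular_boundary hd)
  refine ⟨max c₁ c₂, lt_max_of_lt_left hc₁, fun ε hε => ?_⟩
  obtain ⟨h1, h2⟩ := h₁ (max c₁ c₂) (le_max_left _ _) ε hε
  obtain ⟨h3, h4⟩ := h₂ (max c₁ c₂) (le_max_right _ _) ε hε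
  have e1 : ∀ (L : ℕ) (ω : Config M d), maxIn (box d L) (clusters ω L) = maxSize (clusters ω L) :=
    fun L ω => maxIn_box fun C hC => (exists_of_mem_clusters hC).1
  have e2 : ∀ (L : ℕ) (ω : Config M d), maxIn (box d L) (spanningClusters ⟨0, by omega⟩ ω L) =
      maxSize (spanningClusters ⟨0, by omega⟩ ω L) := fun L ω => maxIn_box fun C hC => by
    classical
    exact (exists_of_mem_clusters (Finset.mem_filter.1 hC).1).1
  simp only [e1] at h1
  simp only [e2] at h2
  exact ⟨h1, h2, h3, h4⟩
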